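/- **Setting.** A polygonal domain $P\subset\mathbb R^2$ is a compact simply connected set (with Lipschitz interior) whose boundary is a simple closed polygon through $n\ge 3$ distinct consecutive nodes; its edges $E\in\mathcal E(P)$ are the segments between consecutive nodes (straight angles at nodes are allowed). Let $h_P$ be its diameter and $|E|$ the length of $E$. Fix $\rho>0$; $P$ is called $\rho$-regular if it is star-shaped with respect to every point of some ball of radius $\ge\rho h_P$ and if $|E|\ge\rho h_P$ for all $E\in\mathcal E(P)$. Function spaces on $P$ are those on its interior; $\|\cdot\|$ is the norm of $L^2(P)$ (of scalar or vector fields), $|v|_{1,P}:=\|\nabla v\|$; for $0<s<1$, $$|v|_{1+s,P}^2:=\int_P\int_P\frac{|\nabla v(x)-\nabla v(y)|^2}{|x-y|^{2(1+s)}}\,dx\,dy,$$ $|v|_{2,P}^2:=\sum_{|\alpha|=2}\|\partial^\alpha v\|^2$, and $H^{1+s}(P)$ is the set of $v\in H^1(P)$ for which $|v|_{1+s,P}$ is defined and finite. Let $\mathcal P_1(P)$ be the affine functions, $\Pi_1$ the $L^2(P)$-orthogonal projection onto $\mathcal P_1(P)$, and $\Pi_0$ that of $L^2(P;\mathbb R^2)$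 onto constant vector fields. Values on edges are traces. The Ritz projection $\Pi_1^\nabla v\in\mathcal P_1(P)$ of $v\in H^1(P)$ is given by $(\nabla \Pi_1^\nabla v-\nabla v,\nabla\chi)_{L^2(P)}=0$ for all $\chi\in\mathcal P_1(P)$ and $\int_{\partial P}\Pi_1^\nabla v\,ds=\int_{\partial P}v\,ds$. The local nonconforming virtual element space $V_h(P)$ consists of all $w\in H^1(P)$ such that $\Delta w\in\mathcal P_1(P)$, the normal derivative of $w$ is constant on each edge (in the weak sense), and $w-\Pi_1^\nabla w\perp\mathcal P_1(P)$ in $L^2(P)$. Put $\mathrm{dof}_E(v):=|E|^{-1}\int_E v\,ds$. Let $(\psi_E)_{E\in\mathcal E(P)}$ be the nodal basis of $V_h(P)$, $\mathrm{dof}_F(\psi_E)=\delta_{EF}$, and let $I_hv:=\sum_{E\in\mathcal E(P)}\mathrm{dof}_E(v)\,\psi_E$ for $v\in H^1(P)$. **Theorem (interpolation error).** For every $\rho>0$ there exist positive constants $C_{\rm PF},C_{\rm apx},C_{\rm Itn}$, which depend only on $\rho$, such that the following holds for all $\rho$-regular polygonal domains $P$. The constant $C_{\rm PF}$ is a Poincaré–Friedrichs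 constant: $\|f\|\le C_{\rm PF}h_P|f|_{1,P}$ for all $f\in H^1(P)$ with $\sum_{E\in J}\int_E f\,ds=0$ for some nonempty $J\subseteq\mathcal E(P)$. The constant $C_{\rm apx}$ is an approximation constant: $\|f-\Pi_1f\|+h_P|f-\Pi_1f|_{1,P}\le C_{\rm apx}h_P^{1+s}|f|_{1+s,P}$ for all $0\le s\le1$ and $f\in H^{1+s}(P)$. For every $v\in H^1(P)$, $I_hv$ is well defined and is the unique $w\in V_h(P)$ with $\mathrm{dof}_E(w)=\mathrm{dof}_E(v)$ for all $E\in\mathcal E(P)$. Moreover: (a) $|I_hv|_{1,P}\le C_{\rm Itn}|v|_{1,P}$ for all $v\in H^1(P)$. (b) For all $v\in H^1(P)$, $|v-I_hv|_{1,P}\le(1+C_{\rm Itn})\|(1-\Pi_0)\nabla v\|$ and $$h_P^{-1}\|(1-\Pi_1I_h)v\|+|(1-\Pi_1I_h)v|_{1,P}\le(1+C_{\rm PF})\|(1-\Pi_0)\nabla v\|.$$ (c) With $C_{\rm I}:=C_{\rm apx}(1+C_{\rm Itn})(1+C_{\rm PF})$, all $0<\sigma\le1$ and $v\in H^{1+\sigma}(P)$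 satisfy $$\|v-I_hv\|+h_P|v-I_hv|_{1,P}\le C_{\rm I}h_P^{1+\sigma}|v|_{1+\sigma,P}.$$ -/

import Mathlib

open MeasureTheory Filter Topology
open scoped ENNReal ContDiff

noncomputable section

namespace VEM

/-- The Euclidean plane. -/
abbrev Plane : Type := EuclideanSpace ℝ (Fin 2)

/-- A polygonal domain: a compact simply connected set (in particular non-void) whose boundary is
the simple closed polygon through `n ≥ 3` consecutive nodes. The edge `j` joins the node `j` to the
cyclically next one. Straight angles at nodes are allowed. The interior of such a set is
automatically a Lipschitz domain. -/
structure Polygon where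
  /-- number of nodes, which is also the number of edges -/
  n : ℕ
  three_le : 3 ≤ n
  node : Fin n → Plane
  carrier : Set Plane
  isCompact : IsCompact carrier
  simplyConnected : SimplyConnectedSpace carrier
  node_injective : Function.Injective node
  frontier_eq : frontier carrier = ⋃ j, segment ℝ (node j) (node (finRotate n j))
  inter_next : ∀ j, segment ℝ (node j) (node (finRotate n j)) ∩
    segment ℝ (node (finRotate n j)) (node (finRotate n (finRotate n j))) = {node (finRotate n j)}
  disjoint_of_not_adjacent : ∀ j k, k ≠ j → k ≠ finRotate n j → j ≠ finRotate n k →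
    Disjoint (segment ℝ (node j) (node (finRotate n j)))
      (segment ℝ (node k) (node (finRotate n k)))

namespace Polygon

variable (P : Polygon)

/-- The diameter `h_P`. -/
def h : ℝ := Metric.diam P.carrier

/-- The length `|E|` of the edge `j`. -/
def edgeLength (j : Fin P.n) : ℝ := dist (P.node j) (P.node (finRotate P.n j))

/-- Affine parametrization over `[0,1]` of the edge `j`. -/
def edgePoint (j : Fin P.n) (t : ℝ) : Plane :=
  P.node j + t • (P.node (finRotate P.n j) - P.node j)

/-- Mesh regularity with parameter `ρ`: star-shapedness with respect to every point of a ball of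
radius at least `ρ h_P`, and every edge has length at least `ρ h_P`. -/
def MeshRegular (ρ : ℝ) : Prop :=
  (∃ (c : Plane) (r : ℝ), ρ * P.h ≤ r ∧ ∀ y ∈ Metric.ball c r, StarConvex ℝ y P.carrier) ∧
    ∀ j, ρ * P.h ≤ P.edgeLength j

/-- Lebesgue measure on the interior of `P`. -/
abbrev μ : Measure Plane := volume.restrict (interior P.carrier)

instance instFiniteMeasure : IsFiniteMeasure P.μ :=
  ⟨by
    rw [Measure.restrict_apply_univ]
    exact lt_of_le_of_lt (measure_mono interior_subset) P.isCompact.measure_lt_top⟩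

/-- `L²(P)`. -/
abbrev L2 : Type := Lp ℝ 2 P.μ

/-- `L²(P;ℝ²)`. -/
abbrev L2v : Type := Lp Plane 2 P.μ

/-- `G` is the weak gradient of `f` in the interior of `P`. -/
def IsWeakGrad (f : Plane → ℝ) (G : Plane → Plane) : Prop :=
  ∀ φ : Plane → ℝ, ContDiff ℝ ∞ φ → HasCompactSupport φ → tsupport φ ⊆ interior P.carrier →
    ∀ e : Plane, ∫ x, f x * fderiv ℝ φ x e ∂P.μ = -∫ x, inner ℝ (G x) e * φ x ∂P.μ

/-- The Sobolev space `H¹(P)`. -/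
def H1 : Set P.L2 := {v | ∃ G : P.L2v, P.IsWeakGrad v G}

/-- The weak gradient in `L²(P;ℝ²)` of a function in `H¹(P)`. -/
def grad (v : P.L2) : P.L2v := Classical.epsilon fun G : P.L2v => P.IsWeakGrad v G

/-- The seminorm `|v|_{1,P}`. -/
def semi1 (v : P.L2) : ℝ := ‖P.grad v‖

/-- The seminorm `|v|_{1+s,P}` of `v ∈ H¹(P)` for `0 ≤ s ≤ 1`, with the value `∞` when `v` is not in
`H^{1+s}(P)`: the `L²` norm of the gradient for `s = 0`, the Slobodeckij seminorm for `0 < s < 1`,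
and the `L²` norm of the three second order weak derivatives for `s = 1` (the infimum runs over at
most one pair `D`, namely the weak gradients of the two components of the gradient). -/
def sobolevSeminorm (s : ℝ) (v : P.L2) : ℝ≥0∞ :=
  if s = 0 then ENNReal.ofReal (P.semi1 v)
  else if s = 1 then
    ⨅ (D : Fin 2 → P.L2v) (_ : ∀ i, P.IsWeakGrad (fun x => P.grad v x i) (D i)),
      (∫⁻ x, ENNReal.ofReal ((D 0 x 0) ^ 2 + (D 0 x 1) ^ 2 + (D 1 x 1) ^ 2) ∂P.μ) ^ (1 / 2 : ℝ)
  else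
    (∫⁻ x, ∫⁻ y, ENNReal.ofReal
      (‖P.grad v x - P.grad v y‖ ^ 2 / ‖x - y‖ ^ (2 * (1 + s))) ∂P.μ ∂P.μ) ^ (1 / 2 : ℝ)

/-- The Sobolev space `H^{1+s}(P)` for `0 ≤ s ≤ 1`. -/
def HOneAdd (s : ℝ) : Set P.L2 := {v | v ∈ P.H1 ∧ P.sobolevSeminorm s v < ⊤}

/-- The `L²` limits `τ j` on the edges (parametrized over `[0,1]`) are the trace of `v ∈ H¹(P)`:
smooth functions converge to `v` in `H¹(P)` while their restrictions to the edges converge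
to `τ`. -/
def IsTrace (v : P.L2) (τ : Fin P.n → Lp ℝ 2 (volume.restrict (Set.Icc (0 : ℝ) 1))) : Prop :=
  ∃ φ : ℕ → Plane → ℝ, (∀ k, ContDiff ℝ ∞ (φ k)) ∧
    Tendsto (fun k => eLpNorm (fun x => φ k x - v x) 2 P.μ) atTop (𝓝 0) ∧
    Tendsto (fun k => eLpNorm (fun x => gradient (φ k) x - P.grad v x) 2 P.μ) atTop (𝓝 0) ∧
    ∀ j, Tendsto (fun k => eLpNorm (fun t => φ k (P.edgePoint j t) - τ j t) 2
      (volume.restrict (Set.Icc (0 : ℝ) 1))) atTop (𝓝 0)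

/-- The trace of `v ∈ H¹(P)`, edge by edge. -/
def trace (v : P.L2) : Fin P.n → Lp ℝ 2 (volume.restrict (Set.Icc (0 : ℝ) 1)) :=
  Classical.epsilon fun τ => P.IsTrace v τ

/-- The integral `∫_E v ds` of the trace of `v` over the edge `j`. -/
def edgeIntegral (v : P.L2) (j : Fin P.n) : ℝ :=
  P.edgeLength j * ∫ t in Set.Icc (0 : ℝ) 1, P.trace v j t

/-- The degree of freedom `dof_E(v) = |E|⁻¹ ∫_E v ds`. -/
def dof (v : P.L2) (j : Fin P.n) : ℝ := (P.edgeLength j)⁻¹ * P.edgeIntegral v j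

lemma memLp_affine (p : ℝ × Plane) : MemLp (fun x : Plane => p.1 + inner ℝ p.2 x) 2 P.μ := by
  have hc : Continuous fun x : Plane => p.1 + inner ℝ p.2 x := by fun_prop
  obtain ⟨C, hC⟩ := P.isCompact.exists_bound_of_continuousOn hc.continuousOn
  refine MemLp.of_bound hc.aestronglyMeasurable C ?_
  exact (ae_restrict_iff' isOpen_interior.measurableSet).2
    (Eventually.of_forall fun x hx => hC x (interior_subset hx))

/-- The affine function `x ↦ a + b · x` as an element of `L²(P)`. -/
def affine : (ℝ × Plane) →ₗ[ℝ] P.L2 where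
  toFun p := (P.memLp_affine p).toLp
  map_add' p q := by
    rw [← MemLp.toLp_add]
    apply MemLp.toLp_congr
    refine Eventually.of_forall fun x => ?_
    simp only [Prod.fst_add, Prod.snd_add, inner_add_left, Pi.add_apply]
    ring
  map_smul' c p := by
    rw [RingHom.id_apply, ← MemLp.toLp_const_smul]
    apply MemLp.toLp_congr
    refine Eventually.of_forall fun x => ?_
    simp only [Prod.smul_fst, Prod.smul_snd, real_inner_smul_left, Pi.smul_apply, smul_eq_mul]
    ring

/-- The space of affine functions on `P`, a subspace of `L²(P)`. -/
def P1 : Submodule ℝ P.L2 := LinearMap.range P.affine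

instance instFiniteP1 : FiniteDimensional ℝ P.P1 :=
  inferInstanceAs (FiniteDimensional ℝ (LinearMap.range P.affine))

/-- The space of constant vector fields on `P`, a subspace of `L²(P;ℝ²)`. -/
def P0v : Submodule ℝ P.L2v := LinearMap.range (Lp.constₗ (μ := P.μ) 2 ℝ : Plane →ₗ[ℝ] P.L2v)

instance instFiniteP0v : FiniteDimensional ℝ P.P0v :=
  inferInstanceAs (FiniteDimensional ℝ
    (LinearMap.range (Lp.constₗ (μ := P.μ) 2 ℝ : Plane →ₗ[ℝ] P.L2v)))

/-- The `L²` projection `Π₁` onto the affine functions. -/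
def Pi1 (v : P.L2) : P.L2 := P.P1.starProjection v

/-- The `L²` projection `Π₀` of vector fields onto the constant vector fields. -/
def Pi0v (G : P.L2v) : P.L2v := P.P0v.starProjection G

/-- `q` is the weak (distributional) Laplacian of `v ∈ H¹(P)` in the interior of `P`. -/
def IsWeakLaplacian (v q : P.L2) : Prop :=
  ∀ φ : Plane → ℝ, ContDiff ℝ ∞ φ → HasCompactSupport φ → tsupport φ ⊆ interior P.carrier →
    ∫ x, fderiv ℝ φ x (P.grad v x) ∂P.μ = -∫ x, q x * φ x ∂P.μ

/-- The normal derivative of `v ∈ H¹(P)` with weak Laplacian `q` is the constant `g j` on each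
edge `j`; the normal derivative is the functional
`φ ↦ (∇v, ∇φ)_{L²(P)} + (Δv, φ)_{L²(P)}` on `H¹(P)`. -/
def IsNormalDeriv (v q : P.L2) (g : Fin P.n → ℝ) : Prop :=
  ∀ φ ∈ P.H1, inner ℝ (P.grad v) (P.grad φ) + inner ℝ q φ = ∑ j, g j * P.edgeIntegral φ j

/-- The extended local virtual element space: functions in `H¹(P)` with affine Laplacian and
edgewise constant normal derivative. -/
def VhHat : Set P.L2 :=
  {v | v ∈ P.H1 ∧ ∃ q ∈ P.P1, P.IsWeakLaplacian v q ∧ ∃ g : Fin P.n → ℝ, P.IsNormalDeriv v q g}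

/-- `p` is the Ritz projection of `v ∈ H¹(P)` onto the affine functions. -/
def IsRitzProjection (v p : P.L2) : Prop :=
  p ∈ P.P1 ∧ (∀ χ ∈ P.P1, inner ℝ (P.grad p - P.grad v) (P.grad χ) = 0) ∧
    ∑ j, P.edgeIntegral p j = ∑ j, P.edgeIntegral v j

/-- The local virtual element space `V_h(P)`: functions `v` of the extended space such that `v` minus
its Ritz projection is `L²` orthogonal to the affine functions. -/
def Vh : Set P.L2 :=
  {v | v ∈ P.VhHat ∧ ∃ p, P.IsRitzProjection v p ∧ ∀ q ∈ P.P1, inner ℝ (v - p) q = 0}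

/-- The nodal basis function of the edge `j` in `V_h(P)`. -/
def nodalBasis (j : Fin P.n) : P.L2 :=
  Classical.epsilon fun ψ => ψ ∈ P.Vh ∧ ∀ k, P.dof ψ k = if k = j then 1 else 0

/-- The local interpolation operator `I_h v = ∑_E dof_E(v) ψ_E`. -/
def Ih (v : P.L2) : P.L2 := ∑ j, P.dof v j • P.nodalBasis j

end Polygon

end VEM

end

/-! The analytic tools come from the fan of triangles that joins the centre `c` of the ball to the
edges. Star-shapedness makes these triangles disjoint and equally oriented, lets them exhaust the
interior up to a null set, and bounds twice their areas below by `(ρ h)²`. The divergence theorem on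
each triangle yields a trace inequality (`integral_edge_sq`) and, after the contributions of the
interior sides cancel, Green's formula for constant fields (`exists_green`). Averaging along
segments that start in the ball gives a Poincaré inequality; with the trace inequality it becomes
the Poincaré–Friedrichs inequality (`Regular.norm_le`). These estimates are proved for smooth
functions and passed to `H¹` by mollified dilations (`exists_tendsto_smooth`).

The interpolation rests on one observation: by Green's formula the mean of `∇v` depends only on the
edge integrals, so the Ritz projection of `v` depends only on the degrees of freedom
(`IsRitzProjection.of_dof_eq`). In `V_h` the `L²` projection is the Ritz projection. Hence `Π₁ I_h
v` is the Ritz projection of `v` itself, its gradient is `Π₀ ∇v`, and the second estimate of (b) is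
the Poincaré–Friedrichs inequality.

For (a) put `q = Δ I_h v`. The energy identity `norm_grad_sq_of_isNormalDeriv` reads `‖∇I_h v‖² =
(∇I_h v, ∇v) + (q, v - I_h v)`, and since `q` is affine, `I_h v` may be replaced by `Π₁ I_h v` in
the last term. That difference is bounded by `h ‖∇v‖`, while testing with a cut-off times `q` gives
`h ‖q‖ ≤ C ‖∇I_h v‖` (`exists_norm_laplacian_le`); a factor `‖∇I_h v‖` cancels. Stability applied to
`v` minus its Ritz projection gives the rest of (b), and (c) follows from bounds for `(1 - Π₀)∇v` by
the Sobolev seminorms.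

Uniqueness in `V_h` comes from the same energy identity. For existence, a function with the given
degrees of freedom receives the right affine moments from a bubble, and then its gradient norm is
minimized with degrees of freedom and moments fixed. The constraints are finitely many, and their
Lagrange multipliers are the affine Laplacian and the edgewise constant normal derivatives. -/

noncomputable section

namespace VEM

/-! ### Star-shaped sets -/

section Star

variable {E : Type*} [NormedAddCommGroup E] [NormedSpace ℝ E] {K : Set E} {c : E} {r : ℝ}

/-- The homothety with centre `x` and ratio `1 - θ` maps the whole ball to an open set, which
star-shapedness keeps inside `K`. -/
lemma smul_add_smul_mem_interior (hs : ∀ y ∈ Metric.ball c r, StarConvex ℝ y K) {x y : E}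
    (hx : x ∈ K) (hy : y ∈ Metric.ball c r) {θ : ℝ} (h0 : 0 ≤ θ) (h1 : θ < 1) :
    (1 - θ) • y + θ • x ∈ interior K := by
  have hθ : (1 - θ) ≠ 0 := by linarith
  have hopen : IsOpen ((fun z : E => (1 - θ) • z + θ • x) '' Metric.ball c r) := by
    have := ((Homeomorph.smulOfNeZero (1 - θ) hθ).trans
      (Homeomorph.addRight (θ • x))).isOpenMap (Metric.ball c r) Metric.isOpen_ball
    exact this
  refine interior_maximal ?_ hopen ⟨y, hy, rfl⟩
  rintro _ ⟨z, hz, rfl⟩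
  exact hs z hz hx (by linarith) h0 (by ring)

lemma ball_subset_of_starConvex (hs : ∀ y ∈ Metric.ball c r, StarConvex ℝ y K)
    (hK : K.Nonempty) : Metric.ball c r ⊆ K := fun y hy => (hs y hy).mem hK

lemma ball_subset_interior_of_starConvex (hs : ∀ y ∈ Metric.ball c r, StarConvex ℝ y K)
    (hK : K.Nonempty) : Metric.ball c r ⊆ interior K :=
  interior_maximal (ball_subset_of_starConvex hs hK) Metric.isOpen_ball

lemma add_smul_mem_interior (hr : 0 < r) (hs : ∀ y ∈ Metric.ball c r, StarConvex ℝ y K) {x : E}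
    (hx : x ∈ K) {θ : ℝ} (h0 : 0 ≤ θ) (h1 : θ < 1) : c + θ • (x - c) ∈ interior K := by
  convert smul_add_smul_mem_interior hs hx (Metric.mem_ball_self hr) h0 h1 using 1
  module

/-- Of two distinct points on a ray from `c`, the nearer one is interior as soon as the farther one
lies in `K`. -/
lemma frontier_ray_unique (hr : 0 < r) (hs : ∀ y ∈ Metric.ball c r, StarConvex ℝ y K)
    (hK : IsClosed K) {x y : E} (hx : x ∈ frontier K) (hy : y ∈ frontier K) {l : ℝ} (hl : 0 < l)
    (h : y - c = l • (x - c)) : x = y := by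
  rcases lt_trichotomy l 1 with h1 | h1 | h1
  · have := add_smul_mem_interior hr hs (hK.frontier_subset hx) hl.le h1
    rw [← h] at this
    simp only [add_sub_cancel] at this
    exact absurd this hy.2
  · rw [h1, one_smul] at h
    exact (sub_left_injective h).symm
  · have := add_smul_mem_interior hr hs (hK.frontier_subset hy) (inv_pos.2 hl).le
      (inv_lt_one_of_one_lt₀ h1)
    rw [h, inv_smul_smul₀ hl.ne', add_sub_cancel] at this
    exact absurd this hx.2

/-- The part of the ray beyond `x` is connected, starts in the interior and leaves the bounded set,
so it has to cross the frontier. -/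
lemma exists_ray_mem_frontier (hb : Bornology.IsBounded K) {x : E} (hx : x ∈ interior K)
    (hxc : x ≠ c) : ∃ R : ℝ, 1 < R ∧ c + R • (x - c) ∈ frontier K := by
  obtain ⟨M, hM⟩ := hb.subset_closedBall c
  have hpos : 0 < ‖x - c‖ := norm_pos_iff.2 (sub_ne_zero.2 hxc)
  have hpre : IsPreconnected ((fun R : ℝ => c + R • (x - c)) '' Set.Ici 1) :=
    (isPreconnected_Ici).image _ (by fun_prop)
  -- With this factor the point has distance at least `M + 1` from `c`, beyond the enclosing ball of
  -- radius `M`.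
  have hout : c + (max 1 ((M + 1) / ‖x - c‖)) • (x - c) ∉ K := fun hmem => by
    have := hM hmem
    rw [Metric.mem_closedBall, dist_eq_norm, add_sub_cancel_left, norm_smul, Real.norm_eq_abs,
      abs_of_pos (lt_of_lt_of_le one_pos (le_max_left _ _))] at this
    have h2 : M + 1 ≤ max 1 ((M + 1) / ‖x - c‖) * ‖x - c‖ := by
      rw [← div_le_iff₀ hpos]; exact le_max_right _ _
    linarith
  obtain ⟨R, hR, hf⟩ : ∃ R ∈ Set.Ici (1 : ℝ), c + R • (x - c) ∈ frontier K := by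
    by_contra! hno
    obtain ⟨z, -, hz1, hz2⟩ := hpre (interior K) (closure K)ᶜ isOpen_interior
      isClosed_closure.isOpen_compl (by
        rintro _ ⟨R, hR, rfl⟩
        by_cases hi : c + R • (x - c) ∈ interior K
        · exact Or.inl hi
        · exact Or.inr fun hcl => hno R hR ⟨hcl, hi⟩)
      ⟨x, ⟨1, Set.self_mem_Ici, by simp⟩, hx⟩
      ⟨_, ⟨_, le_max_left 1 ((M + 1) / ‖x - c‖), rfl⟩, fun hcl =>
        hno _ (le_max_left 1 ((M + 1) / ‖x - c‖)) ⟨hcl, fun hi => hout (interior_subset hi)⟩⟩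
    exact hz2 (subset_closure (interior_subset hz1))
  refine ⟨R, lt_of_le_of_ne hR ?_, hf⟩
  rintro rfl
  simp only [one_smul, add_sub_cancel] at hf
  exact hf.2 hx

end Star

/-! ### Planar determinants -/

/-- The determinant of two plane vectors. -/
def det2 (u v : Plane) : ℝ := u 0 * v 1 - u 1 * v 0

lemma plane_ext {u v : Plane} (h0 : u 0 = v 0) (h1 : u 1 = v 1) : u = v := by
  ext i; fin_cases i <;> assumption

lemma inner_plane (u v : Plane) : inner ℝ u v = u 0 * v 0 + u 1 * v 1 := by
  rw [PiLp.inner_apply, Fin.sum_univ_two]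
  simp [mul_comm]

lemma norm_sq_plane (u : Plane) : ‖u‖ ^ 2 = u 0 ^ 2 + u 1 ^ 2 := by
  rw [EuclideanSpace.norm_sq_eq, Fin.sum_univ_two]
  simp

/-- Rotation by a right angle. -/
def rot (u : Plane) : Plane := !₂[-u 1, u 0]

@[simp] lemma rot_zero (u : Plane) : rot u 0 = -u 1 := rfl

@[simp] lemma rot_one (u : Plane) : rot u 1 = u 0 := rfl

lemma norm_rot (u : Plane) : ‖rot u‖ = ‖u‖ := by
  have := norm_sq_plane (rot u)
  rw [rot_zero, rot_one, neg_sq, add_comm, ← norm_sq_plane] at this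
  exact (pow_left_inj₀ (norm_nonneg _) (norm_nonneg _) two_ne_zero).1 this

lemma eq_smul_of_det2_eq_zero {u v : Plane} (hu : u ≠ 0) (h : det2 u v = 0) :
    v = (inner ℝ u v / ‖u‖ ^ 2) • u := by
  have hp : u 0 ^ 2 + u 1 ^ 2 ≠ 0 := by
    rw [← norm_sq_plane]; exact pow_ne_zero 2 (norm_ne_zero_iff.2 hu)
  unfold det2 at h
  apply plane_ext <;> simp only [PiLp.smul_apply, smul_eq_mul] <;>
    rw [norm_sq_plane, inner_plane] <;> field_simp
  · linear_combination (-u 1) * h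
  · linear_combination (u 0) * h

/-- Cramer's rule in the basis `m`, `a`. -/
lemma eq_smul_add_smul {a m b : Plane} (h : det2 a m ≠ 0) :
    b = (det2 a b / det2 a m) • m + (det2 b m / det2 a m) • a := by
  apply plane_ext <;> simp only [PiLp.smul_apply, PiLp.add_apply, smul_eq_mul] <;> field_simp <;>
    unfold det2 <;> ring

/-- The determinant is `‖B - A‖` times the distance from `c` to the line `AB`, up to sign. Were this
distance less than `r`, the foot of the perpendicular would lie in the ball, and then some point of
the segment would be interior. -/
lemma mul_norm_le_det2 {K : Set Plane} {c : Plane} {r : ℝ}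
    (hs : ∀ y ∈ Metric.ball c r, StarConvex ℝ y K) (hK : IsClosed K) {A B : Plane} (hAB : A ≠ B)
    (hseg : segment ℝ A B ⊆ frontier K) : r * ‖B - A‖ ≤ |det2 (A - c) (B - c)| := by
  by_contra! hlt
  have hne : B - A ≠ 0 := sub_ne_zero.2 hAB.symm
  have hb : 0 < ‖B - A‖ := norm_pos_iff.2 hne
  set d := det2 (A - c) (B - c) with hd
  -- The foot of the perpendicular from `c` to the line `AB`.
  set y := c + (-d / ‖B - A‖ ^ 2) • rot (B - A) with hy
  have hyb : y ∈ Metric.ball c r := by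
    rw [Metric.mem_ball, dist_eq_norm, hy, add_sub_cancel_left, norm_smul, norm_rot, norm_div,
      norm_neg, Real.norm_eq_abs, norm_pow, norm_norm, sq, ← div_div, div_mul_cancel₀ _ hb.ne',
      div_lt_iff₀ hb]
    exact hlt
  have hdet : det2 (B - A) (y - A) = 0 := by
    have hp : (B 0 - A 0) ^ 2 + (B 1 - A 1) ^ 2 ≠ 0 := by
      have := norm_sq_plane (B - A)
      simp only [PiLp.sub_apply] at this
      rw [← this]; positivity
    rw [hy, norm_sq_plane]
    simp only [det2, hd, PiLp.add_apply, PiLp.sub_apply, PiLp.smul_apply, smul_eq_mul, rot_zero,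
      rot_one]
    field_simp
    ring
  obtain ⟨s, hsy⟩ : ∃ s : ℝ, y = A + s • (B - A) :=
    ⟨_, eq_add_of_sub_eq' (eq_smul_of_det2_eq_zero hne hdet)⟩
  have hA : A ∈ frontier K := hseg (left_mem_segment ℝ A B)
  have hB : B ∈ frontier K := hseg (right_mem_segment ℝ A B)
  have hyi : y ∈ interior K :=
    ball_subset_interior_of_starConvex hs ⟨A, hK.frontier_subset hA⟩ hyb
  -- If `y` lies outside the segment, the endpoint nearer to it is strictly between `y` and the
  -- other endpoint, hence interior; if `y` lies on the segment, it is itself both frontier and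
  -- interior point.
  rcases lt_or_ge s 0 with h0 | h0
  · refine hA.2 ?_
    have := smul_add_smul_mem_interior hs (hK.frontier_subset hB) hyb (θ := (-s) / (1 - s))
      (div_nonneg (by linarith) (by linarith)) ((div_lt_one (by linarith)).2 (by linarith))
    convert this using 1
    have h1s : 1 - s ≠ 0 := by linarith
    have : A = (1 - (-s) / (1 - s)) • (A + s • (B - A)) + ((-s) / (1 - s)) • B := by
      have e : 1 - (-s) / (1 - s) = 1 / (1 - s) := by field_simp; ring
      rw [e]
      have e2 : (-s) / (1 - s) = (-s) * (1 / (1 - s)) := by ring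
      have e3 : A = ((1 - s) * (1 / (1 - s))) • A := by field_simp; simp
      rw [e2]; nth_rw 1 [e3]; module
    rw [hsy]; exact this
  rcases le_or_gt s 1 with h1 | h1
  · refine (hseg ?_).2 hyi
    rw [hsy, segment_eq_image']
    exact ⟨s, ⟨h0, h1⟩, rfl⟩
  · refine hB.2 ?_
    have hs0 : s ≠ 0 := by linarith
    have := smul_add_smul_mem_interior hs (hK.frontier_subset hA) hyb (θ := 1 - 1 / s)
      (by rw [sub_nonneg, div_le_one (by linarith)]; exact h1.le) (by
        have : 0 < 1 / s := by positivity
        linarith)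
    convert this using 1
    have e3 : B - A = (1 / s * s) • (B - A) := by field_simp; simp
    rw [hsy, sub_sub_cancel, smul_add, smul_smul, ← e3]
    module


/-! ### The fan triangulation of a star-shaped polygon -/

lemma finRotate_ne_self {n : ℕ} (hn : 3 ≤ n) (j : Fin n) : finRotate n j ≠ j := by
  obtain ⟨m, rfl⟩ := Nat.exists_eq_add_of_le' hn
  intro h
  have := (isCycle_finRotate (n := m + 1))
  have h2 := support_finRotate (n := m + 1)
  have h3 : j ∈ (finRotate (m + 1 + 2)).support := by rw [h2]; simp
  exact (Equiv.Perm.mem_support.1 h3) h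

/-- The rotation is a single cycle through all indices, so its powers reach every index from `j₀`.
-/
lemma finRotate_induction {n : ℕ} (hn : 3 ≤ n) {p : Fin n → Prop} (j₀ : Fin n) (h0 : p j₀)
    (h : ∀ j, p j → p (finRotate n j)) (j : Fin n) : p j := by
  obtain ⟨m, rfl⟩ := Nat.exists_eq_add_of_le' hn
  obtain ⟨i, hi⟩ := ((isCycle_finRotate (n := m + 1)).sameCycle (finRotate_ne_self hn j₀)
    (finRotate_ne_self hn j)).exists_nat_pow_eq
  rw [← hi]
  clear hi
  induction i with
  | zero => simpa using h0
  | succ k ih => rw [pow_succ']; exact h _ ih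

namespace Polygon

/-- The carrier is star-shaped with respect to every point of the ball. -/
structure StarBall (P : Polygon) (c : Plane) (r : ℝ) : Prop where
  pos : 0 < r
  star : ∀ y ∈ Metric.ball c r, StarConvex ℝ y P.carrier

variable {P : Polygon} {c : Plane} {r : ℝ}

lemma edge_subset_frontier (j : Fin P.n) :
    segment ℝ (P.node j) (P.node (finRotate P.n j)) ⊆ frontier P.carrier := by
  rw [P.frontier_eq]
  exact Set.subset_iUnion (fun j => segment ℝ (P.node j) (P.node (finRotate P.n j))) j

lemma frontier_subset : frontier P.carrier ⊆ P.carrier := P.isCompact.isClosed.frontier_subset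

lemma node_mem_frontier (j : Fin P.n) : P.node j ∈ frontier P.carrier :=
  edge_subset_frontier j (left_mem_segment ℝ _ _)

lemma node_mem (j : Fin P.n) : P.node j ∈ P.carrier := frontier_subset (node_mem_frontier j)

instance : NeZero P.n := ⟨by have := P.three_le; omega⟩

lemma carrier_nonempty : P.carrier.Nonempty := ⟨_, node_mem 0⟩

lemma node_ne_next (j : Fin P.n) : P.node j ≠ P.node (finRotate P.n j) := fun h =>
  finRotate_ne_self P.three_le j (P.node_injective h).symm

lemma edgePoint_eq (j : Fin P.n) (t : ℝ) :
    P.edgePoint j t = P.node j + t • (P.node (finRotate P.n j) - P.node j) := rfl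

lemma edgePoint_mem_segment (j : Fin P.n) {t : ℝ} (ht : t ∈ Set.Icc (0 : ℝ) 1) :
    P.edgePoint j t ∈ segment ℝ (P.node j) (P.node (finRotate P.n j)) := by
  rw [segment_eq_image']; exact ⟨t, ht, rfl⟩

lemma edgePoint_mem_frontier (j : Fin P.n) {t : ℝ} (ht : t ∈ Set.Icc (0 : ℝ) 1) :
    P.edgePoint j t ∈ frontier P.carrier := edge_subset_frontier j (edgePoint_mem_segment j ht)

lemma edgeLength_eq (j : Fin P.n) :
    P.edgeLength j = ‖P.node (finRotate P.n j) - P.node j‖ := by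
  rw [edgeLength, dist_comm, dist_eq_norm]

lemma edgeLength_pos (j : Fin P.n) : 0 < P.edgeLength j := dist_pos.2 (node_ne_next j)

lemma edgePoint_injective (j : Fin P.n) : Function.Injective (P.edgePoint j) := fun s t h => by
  have h2 := add_left_cancel h
  exact smul_left_injective ℝ (sub_ne_zero.2 (node_ne_next j).symm) h2

lemma edgePoint_zero (j : Fin P.n) : P.edgePoint j 0 = P.node j := by simp [edgePoint_eq]

lemma edgePoint_one (j : Fin P.n) : P.edgePoint j 1 = P.node (finRotate P.n j) := by
  simp [edgePoint_eq]

/-- Edges meet at nodes only. -/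
lemma edgePoint_ne_edgePoint {j k : Fin P.n} (hjk : j ≠ k) {t t' : ℝ} (ht : t ∈ Set.Ioo (0 : ℝ) 1)
    (ht' : t' ∈ Set.Icc (0 : ℝ) 1) : P.edgePoint j t ≠ P.edgePoint k t' := by
  intro h1
  have h2 := edgePoint_mem_segment j ⟨ht.1.le, ht.2.le⟩
  have h3 : P.edgePoint j t ∈ segment ℝ (P.node k) (P.node (finRotate P.n k)) :=
    h1 ▸ edgePoint_mem_segment k ht'
  by_cases hk : k = finRotate P.n j
  · subst hk
    have h4 := Set.mem_inter h2 h3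
    rw [P.inter_next j, Set.mem_singleton_iff, ← edgePoint_one] at h4
    exact ht.2.ne (edgePoint_injective j h4)
  by_cases hj : j = finRotate P.n k
  · subst hj
    have h4 := Set.mem_inter h3 h2
    rw [P.inter_next k, Set.mem_singleton_iff, ← edgePoint_zero] at h4
    exact ht.1.ne' (edgePoint_injective _ h4)
  · exact Set.disjoint_left.1 (P.disjoint_of_not_adjacent j k hjk.symm hk hj) h2 h3

variable (P c) in
/-- Twice the signed area of the triangle spanned by `c` and the edge `j`. -/
def det (j : Fin P.n) : ℝ := det2 (P.node j - c) (P.node (finRotate P.n j) - c)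

namespace StarBall

lemma le_abs_det (h : P.StarBall c r) (j : Fin P.n) : r * P.edgeLength j ≤ |P.det c j| := by
  rw [edgeLength_eq]
  exact mul_norm_le_det2 h.star P.isCompact.isClosed (node_ne_next j) (edge_subset_frontier j)

lemma abs_det_pos (h : P.StarBall c r) (j : Fin P.n) : 0 < |P.det c j| :=
  (mul_pos h.pos (edgeLength_pos j)).trans_le (h.le_abs_det j)

lemma det_ne_zero (h : P.StarBall c r) (j : Fin P.n) : P.det c j ≠ 0 :=
  abs_pos.1 (h.abs_det_pos j)

lemma ray_unique (h : P.StarBall c r) {x y : Plane} (hx : x ∈ frontier P.carrier)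
    (hy : y ∈ frontier P.carrier) {l : ℝ} (hl : 0 < l) (hxy : y - c = l • (x - c)) : x = y :=
  frontier_ray_unique h.pos h.star P.isCompact.isClosed hx hy hl hxy

/-- If the orientation changed at the node `m`, both neighbours of `m` would lie on the same side of
the ray from `c` through `m`, that is `b = α m + β a` with `β > 0`. A point of the second edge near
`m` would then share its ray with a point of the first edge and coincide with it, although the two
edges meet at the node only. -/
lemma det_mul_det_next_pos (h : P.StarBall c r) (j : Fin P.n) :
    0 < P.det c j * P.det c (finRotate P.n j) := by
  set k := finRotate P.n j with hk
  set m := P.node k - c with hm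
  set a := P.node j - c with ha
  set b := P.node (finRotate P.n k) - c with hb
  have h1 : det2 a m ≠ 0 := h.det_ne_zero j
  have h2 : det2 m b ≠ 0 := h.det_ne_zero k
  change 0 < det2 a m * det2 m b
  by_contra! hneg
  have hlt : det2 a m * det2 m b < 0 := lt_of_le_of_ne hneg (mul_ne_zero h1 h2)
  set α := det2 a b / det2 a m with hα
  set β := det2 b m / det2 a m with hβ
  have hb' : b = α • m + β • a := eq_smul_add_smul h1
  have hβ0 : 0 < β := by
    have e : det2 b m = -det2 m b := by unfold det2; ring
    rw [hβ, e, ← mul_div_mul_right _ _ h1]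
    apply div_pos
    · nlinarith
    · exact mul_self_pos.2 h1
  -- So small that `1 - s + s α ≥ 1/2`, which makes the scaling factor `N` positive and puts `t`
  -- into `[0, 1]`.
  set s := 1 / (2 * (1 + |α|)) with hs
  have hs0 : 0 < s := by positivity
  have hsa : s * (1 + |α|) = 1 / 2 := by rw [hs]; field_simp
  have hs1 : s ≤ 1 := by nlinarith [abs_nonneg α]
  have hN1 : 1 / 2 ≤ 1 - s + s * α := by nlinarith [neg_abs_le α]
  set N := 1 - s + s * α + s * β with hN
  have hsb : 0 < s * β := mul_pos hs0 hβ0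
  have hNpos : 0 < N := by linarith
  set t := s * β / N with ht
  have ht0 : 0 ≤ t := by positivity
  have ht1 : t ≤ 1 := by rw [ht, div_le_one hNpos]; linarith
  have e1 : P.edgePoint k s - c = N • (P.edgePoint j (1 - t) - c) := by
    have ea : P.edgePoint k s - c = m + s • (b - m) := by
      rw [edgePoint_eq, hm, hb]; module
    have eb : P.edgePoint j (1 - t) - c = m + t • (a - m) := by
      rw [edgePoint_eq, hm, ha]; module
    have et : N * t = s * β := by rw [ht]; field_simp
    have e5 : N • (m + t • (a - m)) = (N - N * t) • m + (N * t) • a := by module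
    rw [ea, eb, hb', e5, et, hN]
    module
  have e2 := h.ray_unique (edgePoint_mem_frontier j ⟨by linarith, by linarith⟩)
    (edgePoint_mem_frontier k ⟨hs0.le, hs1⟩) hNpos e1
  have e3 : P.edgePoint k s ∈ ({P.node k} : Set Plane) := by
    rw [hk, ← P.inter_next j]
    exact ⟨e2 ▸ edgePoint_mem_segment j ⟨by linarith, by linarith⟩,
      edgePoint_mem_segment _ ⟨hs0.le, hs1⟩⟩
  have e4 : s = 0 := edgePoint_injective k (by
    rw [Set.mem_singleton_iff.1 e3, edgePoint_eq, zero_smul, add_zero])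
  exact hs0.ne' e4

/-- The number `σ` is the common sign of all determinants; a common sign is what makes the interior
sides cancel in the divergence theorem. -/
lemma exists_orientation (h : P.StarBall c r) :
    ∃ σ : ℝ, ∀ j, |P.det c j| = σ * P.det c j := by
  have key : ∀ j, 0 < P.det c 0 * P.det c j :=
    finRotate_induction P.three_le 0 (mul_self_pos.2 (h.det_ne_zero 0)) fun j hj => by
      have h1 := h.det_mul_det_next_pos j
      have h2 : 0 < P.det c j * P.det c j := mul_self_pos.2 (h.det_ne_zero j)
      have h3 := mul_pos hj h1
      have h4 : P.det c 0 * P.det c j * (P.det c j * P.det c (finRotate P.n j)) =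
        (P.det c j * P.det c j) * (P.det c 0 * P.det c (finRotate P.n j)) := by ring
      rw [h4] at h3
      exact (pos_iff_pos_of_mul_pos h3).1 h2
  rcases lt_or_gt_of_ne (h.det_ne_zero 0) with h0 | h0
  · refine ⟨-1, fun j => ?_⟩
    rw [abs_of_neg (by nlinarith [key j]), neg_one_mul]
  · refine ⟨1, fun j => ?_⟩
    rw [abs_of_pos (by nlinarith [key j]), one_mul]

end StarBall

variable (P c) in
/-- Parametrization of the triangle spanned by `c` and the edge `j`. -/
def fan (j : Fin P.n) (q : ℝ × ℝ) : Plane := c + q.1 • (P.edgePoint j q.2 - c)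

variable (P c) in
/-- The open triangle spanned by `c` and the edge `j`. -/
def tri (j : Fin P.n) : Set Plane := P.fan c j '' (Set.Ioo 0 1 ×ˢ Set.Ioo 0 1)

namespace StarBall

lemma fan_mem_interior (h : P.StarBall c r) (j : Fin P.n) {q : ℝ × ℝ} (h0 : 0 ≤ q.1)
    (h1 : q.1 < 1) (h2 : q.2 ∈ Set.Icc (0 : ℝ) 1) : P.fan c j q ∈ interior P.carrier :=
  add_smul_mem_interior h.pos h.star (frontier_subset (edgePoint_mem_frontier j h2)) h0 h1

lemma tri_subset (h : P.StarBall c r) (j : Fin P.n) : P.tri c j ⊆ interior P.carrier := by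
  rintro _ ⟨q, hq, rfl⟩
  exact h.fan_mem_interior j hq.1.1.le hq.1.2 ⟨hq.2.1.le, hq.2.2.le⟩

lemma mem_interior (h : P.StarBall c r) : c ∈ interior P.carrier :=
  ball_subset_interior_of_starConvex h.star carrier_nonempty (Metric.mem_ball_self h.pos)

lemma edgePoint_ne (h : P.StarBall c r) (j : Fin P.n) {t : ℝ} (ht : t ∈ Set.Icc (0 : ℝ) 1) :
    P.edgePoint j t - c ≠ 0 := fun he =>
  (edgePoint_mem_frontier j ht).2 (sub_eq_zero.1 he ▸ h.mem_interior)

/-- Both edge points lie on the ray from `c` through the common image point, and a ray meets the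
frontier only once. Injectivity on a triangle and disjointness of the triangles follow. -/
lemma edgePoint_eq_of_fan_eq (h : P.StarBall c r) {j k : Fin P.n} {q q' : ℝ × ℝ}
    (h1 : 0 < q.1) (h1' : 0 < q'.1) (h2 : q.2 ∈ Set.Icc (0 : ℝ) 1)
    (h2' : q'.2 ∈ Set.Icc (0 : ℝ) 1) (he : P.fan c j q = P.fan c k q') :
    P.edgePoint j q.2 = P.edgePoint k q'.2 := by
  refine h.ray_unique (edgePoint_mem_frontier j h2) (edgePoint_mem_frontier k h2')
    (div_pos h1 h1') ?_
  rw [div_eq_inv_mul, ← smul_smul, add_left_cancel he, inv_smul_smul₀ h1'.ne']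

lemma injOn_fan (h : P.StarBall c r) (j : Fin P.n) :
    Set.InjOn (P.fan c j) (Set.Ioo 0 1 ×ˢ Set.Ioo 0 1) := by
  rintro ⟨u, t⟩ ⟨hu, ht⟩ ⟨u', t'⟩ ⟨hu', ht'⟩ he
  have h1 := h.edgePoint_eq_of_fan_eq hu.1 hu'.1 ⟨ht.1.le, ht.2.le⟩ ⟨ht'.1.le, ht'.2.le⟩ he
  obtain rfl : t = t' := edgePoint_injective j h1
  have h2 := add_left_cancel he
  exact Prod.ext (smul_left_injective ℝ (h.edgePoint_ne j ⟨ht.1.le, ht.2.le⟩) h2) rfl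

lemma disjoint_tri (h : P.StarBall c r) {j k : Fin P.n} (hjk : j ≠ k) :
    Disjoint (P.tri c j) (P.tri c k) := by
  rw [Set.disjoint_left]
  rintro _ ⟨⟨u, t⟩, ⟨hu, ht⟩, rfl⟩ ⟨⟨u', t'⟩, ⟨hu', ht'⟩, he⟩
  have ht2 : t ∈ Set.Icc (0 : ℝ) 1 := ⟨ht.1.le, ht.2.le⟩
  have ht2' : t' ∈ Set.Icc (0 : ℝ) 1 := ⟨ht'.1.le, ht'.2.le⟩
  exact edgePoint_ne_edgePoint hjk ht ht2' (h.edgePoint_eq_of_fan_eq hu'.1 hu.1 ht2' ht2 he).symm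

/-- The ray through an interior point hits some edge, either in its relative interior or at a node.
In the second case the point lies on one of finitely many lines through `c`, which form a null set.
-/
lemma interior_subset_union (_ : P.StarBall c r) : interior P.carrier ⊆
    (⋃ j, P.tri c j) ∪ ⋃ j, (line[ℝ, c, P.node j] : Set Plane) := by
  intro x hx
  by_cases hxc : x = c
  · exact Or.inr (Set.mem_iUnion.2 ⟨0, hxc ▸ left_mem_affineSpan_pair ℝ _ _⟩)
  obtain ⟨R, hR, hf⟩ := exists_ray_mem_frontier P.isCompact.isBounded hx hxc
  have hR0 : 0 < R := by linarith
  rw [P.frontier_eq, Set.mem_iUnion] at hf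
  obtain ⟨j, hj⟩ := hf
  rw [segment_eq_image'] at hj
  obtain ⟨t, ht, he⟩ := hj
  change P.edgePoint j t = _ at he
  have hxf : x = P.fan c j (R⁻¹, t) := by
    simp only [fan, he, add_sub_cancel_left]
    rw [inv_smul_smul₀ hR0.ne', add_sub_cancel]
  rcases ht.1.eq_or_lt with h0 | h0
  · refine Or.inr (Set.mem_iUnion.2 ⟨j, ?_⟩)
    rw [hxf, ← h0]
    have := AffineMap.lineMap_mem_affineSpan_pair R⁻¹ c (P.node j)
    rw [AffineMap.lineMap_apply_module'] at this
    simpa [fan, edgePoint_eq, add_comm] using this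
  rcases ht.2.eq_or_lt with h1 | h1
  · refine Or.inr (Set.mem_iUnion.2 ⟨finRotate P.n j, ?_⟩)
    rw [hxf, h1]
    have := AffineMap.lineMap_mem_affineSpan_pair R⁻¹ c (P.node (finRotate P.n j))
    rw [AffineMap.lineMap_apply_module'] at this
    simpa [fan, edgePoint_eq, add_comm] using this
  · exact Or.inl (Set.mem_iUnion.2 ⟨j, _, ⟨⟨inv_pos.2 hR0, inv_lt_one_of_one_lt₀ hR⟩, h0, h1⟩,
      hxf.symm⟩)

lemma interior_ae_eq (h : P.StarBall c r) :
    (interior P.carrier : Set Plane) =ᵐ[volume] ⋃ j, P.tri c j := by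
  have hnull : volume (⋃ j, (line[ℝ, c, P.node j] : Set Plane)) = 0 := by
    refine measure_iUnion_null fun j => Measure.addHaar_affineSubspace _ _ fun htop => ?_
    have h1 : Module.finrank ℝ (vectorSpan ℝ ({c, P.node j} : Set Plane)) ≤ 1 :=
      (collinear_iff_finrank_le_one).1 (collinear_pair ℝ _ _)
    rw [← direction_affineSpan, htop, AffineSubspace.direction_top, finrank_top,
      finrank_euclideanSpace] at h1
    simp at h1
  refine (ae_le_set.2 ?_).antisymm
    (LE.le.eventuallyLE (Set.iUnion_subset fun j => h.tri_subset j))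
  refine measure_mono_null ?_ hnull
  rintro x ⟨hx, hx2⟩
  exact (h.interior_subset_union hx).resolve_left hx2

end StarBall

end Polygon

/-! ### Integration over the triangles of the fan -/

lemma det2_add_smul (a b : Plane) (t : ℝ) : det2 (a + t • b) b = det2 a b := by
  simp only [det2, PiLp.add_apply, PiLp.smul_apply, smul_eq_mul]; ring

/-- Cramer's rule without division; it converts derivatives along the fan coordinates into the
derivative along a fixed vector `e`. -/
lemma det2_smul_sub_smul (e a b : Plane) :
    det2 e b • a - det2 e a • b = det2 a b • e := by
  apply plane_ext <;> simp only [det2, PiLp.sub_apply, PiLp.smul_apply, smul_eq_mul] <;> ring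

/-- Cartesian coordinates on the plane. -/
def planeEquiv : Plane ≃ᵐ ℝ × ℝ :=
  (MeasurableEquiv.toLp 2 (Fin 2 → ℝ)).symm.trans MeasurableEquiv.finTwoArrow

lemma measurePreserving_planeEquiv : MeasurePreserving planeEquiv :=
  (volume_preserving_finTwoArrow ℝ).comp
    (EuclideanSpace.volume_preserving_symm_measurableEquiv_toLp (Fin 2))

namespace Polygon

variable {P : Polygon} {c : Plane} {r : ℝ}

lemma continuous_edgePoint (j : Fin P.n) : Continuous (P.edgePoint j) := by
  unfold edgePoint; fun_prop

lemma contDiff_fan (j : Fin P.n) : ContDiff ℝ ∞ (P.fan c j) := by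
  unfold fan edgePoint; fun_prop

lemma continuous_fan (j : Fin P.n) : Continuous (P.fan c j) := (contDiff_fan j).continuous

lemma hasFDerivAt_fan (j : Fin P.n) (q : ℝ × ℝ) : HasFDerivAt (P.fan c j)
    ((ContinuousLinearMap.fst ℝ ℝ ℝ).smulRight (P.edgePoint j q.2 - c) +
      q.1 • (ContinuousLinearMap.snd ℝ ℝ ℝ).smulRight
        (P.node (finRotate P.n j) - P.node j)) q := by
  have h1 : HasFDerivAt (fun q : ℝ × ℝ => P.edgePoint j q.2 - c)
      ((ContinuousLinearMap.snd ℝ ℝ ℝ).smulRight (P.node (finRotate P.n j) - P.node j)) q :=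
    (((hasFDerivAt_snd (𝕜 := ℝ)).smul_const _).const_add _).sub_const _
  have h2 := (hasFDerivAt_fst (𝕜 := ℝ) (p := q)).smul h1
  refine (h2.const_add c).congr_fderiv ?_
  rw [add_comm]

lemma fan_sub (j : Fin P.n) (q : ℝ × ℝ) : P.fan c j q - c = q.1 • (P.edgePoint j q.2 - c) := by
  simp [fan]

lemma edgePoint_sub (j : Fin P.n) (t : ℝ) : P.edgePoint j t - c =
    (P.node j - c) + t • ((P.node (finRotate P.n j) - c) - (P.node j - c)) := by
  rw [edgePoint_eq]; module

lemma det2_edgePoint_sub (j : Fin P.n) (t : ℝ) :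
    det2 (P.edgePoint j t - c) (P.node (finRotate P.n j) - P.node j) = P.det c j := by
  rw [edgePoint_sub, ← sub_sub_sub_cancel_right _ (P.node j) c, det2_add_smul, det]
  simp only [det2, PiLp.sub_apply]; ring

lemma measurableSet_tri (h : P.StarBall c r) (j : Fin P.n) : MeasurableSet (P.tri c j) :=
  (measurableSet_Ioo.prod measurableSet_Ioo).image_of_continuousOn_injOn
    (continuous_fan j).continuousOn (h.injOn_fan j)

/-- Change of variables: the columns of the Jacobian matrix of `fan` are `edgePoint - c` and `q.1`
times the edge vector, so its determinant is `q.1 * det`. -/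
lemma setIntegral_tri (h : P.StarBall c r) (j : Fin P.n) (f : Plane → ℝ) :
    ∫ x in P.tri c j, f x =
      ∫ q in Set.Ioo (0 : ℝ) 1 ×ˢ Set.Ioo (0 : ℝ) 1, |P.det c j| * (q.1 * f (P.fan c j q)) := by
  obtain ⟨b, hb⟩ : ∃ b, b = P.node (finRotate P.n j) - P.node j := ⟨_, rfl⟩
  set S := Set.Ioo (0 : ℝ) 1 ×ˢ Set.Ioo (0 : ℝ) 1 with hS
  let F' : ℝ × ℝ → ℝ × ℝ →L[ℝ] ℝ × ℝ := fun q =>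
    (Matrix.toLin (.finTwoProd ℝ) (.finTwoProd ℝ)
      !![(P.edgePoint j q.2 - c) 0, q.1 * b 0; (P.edgePoint j q.2 - c) 1,
        q.1 * b 1]).toContinuousLinearMap
  have hF : ∀ q ∈ S, HasFDerivWithinAt (planeEquiv ∘ P.fan c j) (F' q) S q := by
    intro q _
    refine HasFDerivAt.hasFDerivWithinAt ?_
    have hX := hasFDerivAt_fan (c := c) j q
    rw [← hb] at hX
    have h0 := (hasFDerivAt_pi'.1 ((PiLp.hasFDerivAt_ofLp (𝕜 := ℝ) 2 _).comp q hX)) 0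
    have h1 := (hasFDerivAt_pi'.1 ((PiLp.hasFDerivAt_ofLp (𝕜 := ℝ) 2 _).comp q hX)) 1
    refine (h0.prodMk h1).congr_fderiv ?_
    simp only [F']
    rw [Matrix.toLin_finTwoProd_toContinuousLinearMap]
    ext <;> simp
  have hdet : ∀ q, (F' q).det = q.1 * P.det c j := by
    intro q
    rw [← det2_edgePoint_sub j q.2]
    simp only [F', LinearMap.det_toContinuousLinearMap, LinearMap.det_toLin,
      Matrix.det_fin_two_of, det2, hb]
    ring
  have hmp := measurePreserving_planeEquiv.symm planeEquiv
  rw [← hmp.setIntegral_preimage_emb planeEquiv.symm.measurableEmbedding,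
    ← MeasurableEquiv.image_eq_preimage_symm, tri, ← Set.image_comp,
    integral_image_eq_integral_abs_det_fderiv_smul volume
      (measurableSet_Ioo.prod measurableSet_Ioo) hF
      (planeEquiv.injective.comp_injOn (h.injOn_fan j))]
  refine setIntegral_congr_fun (measurableSet_Ioo.prod measurableSet_Ioo) fun q hq => ?_
  simp only [hdet, Function.comp_apply, MeasurableEquiv.symm_apply_apply, smul_eq_mul, abs_mul,
    abs_of_pos hq.1.1]
  ring

lemma integral_tri (h : P.StarBall c r) (j : Fin P.n) {f : Plane → ℝ} (hf : Continuous f) :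
    ∫ x in P.tri c j, f x =
      |P.det c j| * ∫ u in (0 : ℝ)..1, ∫ t in (0 : ℝ)..1, u * f (P.fan c j (u, t)) := by
  rw [setIntegral_tri h, integral_const_mul]
  congr 1
  have hc : Continuous fun q : ℝ × ℝ => q.1 * f (P.fan c j q) := by
    have := continuous_fan (c := c) j
    fun_prop
  rw [Measure.volume_eq_prod, setIntegral_prod]
  · simp only [intervalIntegral.integral_of_le zero_le_one, ← integral_Ioc_eq_integral_Ioo]
  · rw [← Measure.volume_eq_prod]
    exact (hc.continuousOn.integrableOn_compact (isCompact_Icc.prod isCompact_Icc)).mono_set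
      (Set.prod_mono Set.Ioo_subset_Icc_self Set.Ioo_subset_Icc_self)

lemma integral_divergence_unitSquare {f g : ℝ × ℝ → ℝ} {f' g' : ℝ × ℝ → ℝ × ℝ →L[ℝ] ℝ}
    (hf : ∀ q, HasFDerivAt f (f' q) q) (hg : ∀ q, HasFDerivAt g (g' q) q)
    (hc : Continuous fun q => f' q (1, 0) + g' q (0, 1)) :
    (∫ x in (0 : ℝ)..1, ∫ y in (0 : ℝ)..1, f' (x, y) (1, 0) + g' (x, y) (0, 1)) =
      (((∫ x in (0 : ℝ)..1, g (x, 1)) - ∫ x in (0 : ℝ)..1, g (x, 0)) +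
        ∫ y in (0 : ℝ)..1, f (1, y)) - ∫ y in (0 : ℝ)..1, f (0, y) :=
  integral2_divergence_prod_of_hasFDerivAt f g f' g' 0 0 1 1
    (fun q _ => (hf q).continuousAt.continuousWithinAt)
    (fun q _ => (hg q).continuousAt.continuousWithinAt) (fun q _ => hf q) (fun q _ => hg q)
    (hc.continuousOn.integrableOn_compact (isCompact_uIcc.prod isCompact_uIcc))

/-- Divergence theorem for the field `φ² (x - c)`, which is tangential on the two sides through `c`.
In fan coordinates it is the fundamental theorem of calculus for `u² φ²` along the rays. -/
lemma integral_edge_sq (h : P.StarBall c r) (j : Fin P.n) {φ : Plane → ℝ}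
    (hφ : ContDiff ℝ ∞ φ) :
    |P.det c j| * ∫ t in (0 : ℝ)..1, φ (P.edgePoint j t) ^ 2 =
      ∫ x in P.tri c j, (2 * φ x ^ 2 + 2 * φ x * fderiv ℝ φ x (x - c)) := by
  have hφ' : Continuous (fderiv ℝ φ) := hφ.continuous_fderiv (by simp)
  have hφc := hφ.continuous
  have hfan := continuous_fan (c := c) j
  have hE := continuous_edgePoint j
  have hcont : Continuous fun x => 2 * φ x ^ 2 + 2 * φ x * fderiv ℝ φ x (x - c) := by fun_prop
  rw [integral_tri h j hcont]
  congr 1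
  have hφX : ∀ q, HasFDerivAt (fun q => φ (P.fan c j q)) _ q := fun q =>
    ((hφ.differentiable (by simp)) _).hasFDerivAt.comp q (hasFDerivAt_fan (c := c) j q)
  have hf : ∀ q : ℝ × ℝ, HasFDerivAt (fun q : ℝ × ℝ => q.1 ^ 2 * φ (P.fan c j q) ^ 2) _ q :=
    fun q => ((hasFDerivAt_fst (𝕜 := ℝ) (p := q)).pow 2).mul ((hφX q).pow 2)
  have key := integral_divergence_unitSquare (g := fun _ => 0) hf
    (fun q => hasFDerivAt_const 0 q) (by simp; fun_prop)
  simp only [zero_apply, add_zero, intervalIntegral.integral_zero, sub_zero,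
    zero_add] at key
  simp only [one_pow, one_mul, ne_eq, OfNat.ofNat_ne_zero, not_false_eq_true, zero_pow, zero_mul,
    intervalIntegral.integral_zero, sub_zero] at key
  have e1 : ∀ t, P.fan c j (1, t) = P.edgePoint j t := fun t => by simp [fan]
  simp only [e1] at key
  rw [← key]
  refine intervalIntegral.integral_congr fun u _ => intervalIntegral.integral_congr fun t _ => ?_
  simp [fan_sub]
  ring

/-- Divergence theorem for the field `φ e` on one triangle; the last two integrals belong to the
sides from `c` to the nodes. -/
lemma integral_tri_fderiv (h : P.StarBall c r) (j : Fin P.n) {φ : Plane → ℝ}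
    (hφ : ContDiff ℝ ∞ φ) (e : Plane) :
    P.det c j * ∫ x in P.tri c j, fderiv ℝ φ x e = |P.det c j| *
      (det2 e (P.node (finRotate P.n j) - P.node j) * (∫ t in (0 : ℝ)..1, φ (P.edgePoint j t))
      + (∫ u in (0 : ℝ)..1, det2 e (P.node j - c) * φ (c + u • (P.node j - c)))
      - ∫ u in (0 : ℝ)..1, det2 e (P.node (finRotate P.n j) - c) *
          φ (c + u • (P.node (finRotate P.n j) - c))) := by
  have hφ' : Continuous (fderiv ℝ φ) := hφ.continuous_fderiv (by simp)
  have hφc := hφ.continuous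
  have hfan := continuous_fan (c := c) j
  have hE := continuous_edgePoint j
  have hcont : Continuous fun x => fderiv ℝ φ x e := by fun_prop
  rw [integral_tri h j hcont, mul_left_comm]
  congr 1
  obtain ⟨b, hb⟩ : ∃ b, b = P.node (finRotate P.n j) - P.node j := ⟨_, rfl⟩
  have hX := hasFDerivAt_fan (c := c) j
  rw [← hb] at hX ⊢
  have hφX : ∀ q, HasFDerivAt (fun q => φ (P.fan c j q)) _ q := fun q =>
    ((hφ.differentiable (by simp)) _).hasFDerivAt.comp q (hX q)
  -- The functions in `hf` and `hg` are the components of the Piola transform of `φ e` under the fan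
  -- map, the adjugate of the Jacobian applied to `e`, times `φ`.
  have hf : ∀ q : ℝ × ℝ, HasFDerivAt (fun q : ℝ × ℝ => (q.1 * det2 e b) * φ (P.fan c j q)) _ q :=
    fun q => ((hasFDerivAt_fst (𝕜 := ℝ) (p := q)).mul_const (det2 e b)).mul (hφX q)
  have hlin : ∀ t, -det2 e (P.edgePoint j t - c) = -det2 e (P.node j - c) + t * -det2 e b := by
    intro t
    rw [edgePoint_eq, hb]
    simp only [det2, PiLp.sub_apply, PiLp.add_apply, PiLp.smul_apply, smul_eq_mul]; ring
  have hg : ∀ q : ℝ × ℝ, HasFDerivAt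
      (fun q : ℝ × ℝ => (-det2 e (P.node j - c) + q.2 * -det2 e b) * φ (P.fan c j q)) _ q :=
    fun q => (((hasFDerivAt_snd (𝕜 := ℝ) (p := q)).mul_const (-det2 e b)).const_add _).mul (hφX q)
  have key := integral_divergence_unitSquare hf hg (by simp; fun_prop)
  have e1 : ∀ t, P.fan c j (1, t) = P.edgePoint j t := fun t => by simp [fan]
  have e2 : ∀ u, P.fan c j (u, 1) = c + u • (P.node (finRotate P.n j) - c) := fun u => by
    simp [fan, edgePoint]
  have e3 : ∀ u, P.fan c j (u, 0) = c + u • (P.node j - c) := fun u => by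
    simp [fan, edgePoint]
  have e4 : -det2 e (P.node j - c) + -det2 e b = -det2 e (P.node (finRotate P.n j) - c) := by
    rw [hb]
    simp only [det2, PiLp.sub_apply]; ring
  simp only [e1, e2, e3, zero_mul, add_zero, one_mul, intervalIntegral.integral_zero,
    sub_zero, neg_mul, intervalIntegral.integral_neg] at key
  simp only [e4, neg_mul, intervalIntegral.integral_neg] at key
  rw [intervalIntegral.integral_const_mul (det2 e b)] at key
  have key2 : P.det c j * (∫ u in (0 : ℝ)..1, ∫ t in (0 : ℝ)..1,
      u * fderiv ℝ φ (P.fan c j (u, t)) e) = det2 e b * (∫ t in (0 : ℝ)..1, φ (P.edgePoint j t))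
      + (∫ u in (0 : ℝ)..1, det2 e (P.node j - c) * φ (c + u • (P.node j - c)))
      - ∫ u in (0 : ℝ)..1, det2 e (P.node (finRotate P.n j) - c) *
          φ (c + u • (P.node (finRotate P.n j) - c)) := by
    refine Eq.trans ?_ (key.trans (by ring))
    rw [← intervalIntegral.integral_const_mul]
    refine intervalIntegral.integral_congr fun u _ => ?_
    rw [← intervalIntegral.integral_const_mul]
    refine intervalIntegral.integral_congr fun t _ => ?_
    have h1 := det2_smul_sub_smul e (P.edgePoint j t - c) b
    rw [hb, det2_edgePoint_sub, ← hb] at h1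
    have h2 := congrArg (fderiv ℝ φ (P.fan c j (u, t))) h1
    simp only [map_sub, map_smul, smul_eq_mul] at h2
    have h3 := hlin t
    simp
    linear_combination (-u) * h2 + (u * fderiv ℝ φ (P.fan c j (u, t)) b) * h3
  rw [key2]

lemma setIntegral_interior_eq_sum (h : P.StarBall c r) {f : Plane → ℝ}
    (hf : IntegrableOn f (interior P.carrier)) :
    ∫ x, f x ∂P.μ = ∑ j, ∫ x in P.tri c j, f x := by
  rw [setIntegral_congr_set h.interior_ae_eq]
  exact integral_iUnion_fintype (fun j => measurableSet_tri h j)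
    (fun j k hjk => h.disjoint_tri hjk) (fun j => hf.mono_set (h.tri_subset j))

lemma integrable_of_continuous {F : Type*} [NormedAddCommGroup F] {f : Plane → F}
    (hf : Continuous f) : Integrable f P.μ :=
  (hf.continuousOn.integrableOn_compact P.isCompact).mono_set interior_subset

/-- The divergence theorem on a star-shaped polygon. -/
theorem exists_integral_fderiv_eq (h : P.StarBall c r) : ∃ g : Plane → Fin P.n → ℝ,
    ∀ φ : Plane → ℝ, ContDiff ℝ ∞ φ → ∀ e : Plane,
      ∫ x, fderiv ℝ φ x e ∂P.μ = ∑ j, g e j * ∫ t in (0 : ℝ)..1, φ (P.edgePoint j t) := by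
  obtain ⟨σ, hσ⟩ := h.exists_orientation
  refine ⟨fun e j => σ * det2 e (P.node (finRotate P.n j) - P.node j), fun φ hφ e => ?_⟩
  have hφ' : Continuous (fderiv ℝ φ) := hφ.continuous_fderiv (by simp)
  rw [setIntegral_interior_eq_sum h (integrable_of_continuous (by fun_prop))]
  -- The contribution of the side from `c` to the node `j`. It occurs with opposite signs in the two
  -- adjacent triangles, so the sum over the cycle vanishes.
  set S : Fin P.n → ℝ := fun j =>
    ∫ u in (0 : ℝ)..1, det2 e (P.node j - c) * φ (c + u • (P.node j - c)) with hS
  have hj : ∀ j, ∫ x in P.tri c j, fderiv ℝ φ x e =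
      σ * det2 e (P.node (finRotate P.n j) - P.node j) *
        (∫ t in (0 : ℝ)..1, φ (P.edgePoint j t)) + σ * (S j - S (finRotate P.n j)) := by
    intro j
    have := integral_tri_fderiv h j hφ e
    rw [hσ j] at this
    refine mul_left_cancel₀ (h.det_ne_zero j) (this.trans ?_)
    simp only [hS]
    ring
  simp only [hj]
  rw [Finset.sum_add_distrib, ← Finset.mul_sum _ _ σ, Finset.sum_sub_distrib,
    Equiv.sum_comp (finRotate P.n) S, sub_self, mul_zero, add_zero]

end Polygon

/-! ### The space `H¹` -/

namespace Polygon

variable {P : Polygon}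

lemma memLp_of_continuous {F : Type*} [NormedAddCommGroup F] {f : Plane → F}
    (hf : Continuous f) : MemLp f 2 P.μ := by
  obtain ⟨C, hC⟩ := P.isCompact.exists_bound_of_continuousOn hf.continuousOn
  refine MemLp.of_bound hf.aestronglyMeasurable C ?_
  exact (ae_restrict_iff' isOpen_interior.measurableSet).2
    (Eventually.of_forall fun x hx => hC x (interior_subset hx))

variable (P) in
/-- The restriction to `P` of a continuous function on the plane, as an element of `L²(P)`. -/
def toL2 {F : Type*} [NormedAddCommGroup F] (f : Plane → F) (hf : Continuous f) : Lp F 2 P.μ :=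
  (memLp_of_continuous hf).toLp f

lemma coeFn_toL2 {F : Type*} [NormedAddCommGroup F] {f : Plane → F} (hf : Continuous f) :
    P.toL2 f hf =ᵐ[P.μ] f := MemLp.coeFn_toLp _

lemma inner_toL2 {F : Type*} [NormedAddCommGroup F] [InnerProductSpace ℝ F] (v : Lp F 2 P.μ)
    {f : Plane → F} (hf : Continuous f) :
    inner ℝ v (P.toL2 f hf) = ∫ x, inner ℝ (v x) (f x) ∂P.μ := by
  rw [L2.inner_def]
  refine integral_congr_ae ?_
  filter_upwards [coeFn_toL2 (P := P) hf] with x hx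
  rw [hx]

lemma toL2_inner {F : Type*} [NormedAddCommGroup F] [InnerProductSpace ℝ F] (v : Lp F 2 P.μ)
    {f : Plane → F} (hf : Continuous f) :
    inner ℝ (P.toL2 f hf) v = ∫ x, inner ℝ (f x) (v x) ∂P.μ := by
  rw [real_inner_comm, inner_toL2]
  simp only [real_inner_comm]

lemma norm_sq_toL2 {F : Type*} [NormedAddCommGroup F] [InnerProductSpace ℝ F]
    {f : Plane → F} (hf : Continuous f) : ‖P.toL2 f hf‖ ^ 2 = ∫ x, ‖f x‖ ^ 2 ∂P.μ := by
  rw [← real_inner_self_eq_norm_sq, inner_toL2]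
  refine integral_congr_ae ?_
  filter_upwards [coeFn_toL2 (P := P) hf] with x hx
  rw [hx, real_inner_self_eq_norm_sq]

lemma norm_toL2_le {F : Type*} [NormedAddCommGroup F] {f : Plane → F} (hf : Continuous f)
    {C : ℝ} (hC0 : 0 ≤ C) (hC : ∀ x ∈ interior P.carrier, ‖f x‖ ≤ C) :
    ‖P.toL2 f hf‖ ≤ P.μ.real Set.univ ^ (1 / 2 : ℝ) * C := by
  have := Lp.norm_le_of_ae_bound (f := P.toL2 f hf) hC0 (by
    filter_upwards [coeFn_toL2 (P := P) hf,
      ae_restrict_mem isOpen_interior.measurableSet] with x hx hxP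
    rw [hx]; exact hC x hxP)
  rwa [one_div]

/-- Written with inner products against fixed elements of `L²`, the condition is visibly linear and
closed under `L²` limits. -/
lemma isWeakGrad_iff (v : P.L2) (G : P.L2v) : P.IsWeakGrad v G ↔
    ∀ ψ : Plane → ℝ, ∀ hψ : ContDiff ℝ ∞ ψ, HasCompactSupport ψ →
      tsupport ψ ⊆ interior P.carrier → ∀ e : Plane,
        inner ℝ v (P.toL2 (fun x => fderiv ℝ ψ x e)
          ((hψ.continuous_fderiv (by simp)).clm_apply continuous_const)) =
        -inner ℝ G (P.toL2 (fun x => ψ x • e) (hψ.continuous.smul continuous_const)) := by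
  refine forall_congr' fun ψ => forall_congr' fun hψ => forall_congr' fun _ => forall_congr' fun _ =>
    forall_congr' fun e => ?_
  rw [inner_toL2, inner_toL2]
  simp only [inner_smul_right, mul_comm (inner ℝ (G _) e)]
  simp only [RCLike.inner_apply, conj_trivial, mul_comm]

lemma IsWeakGrad.of_tendsto {v : P.L2} {G : P.L2v} {vk : ℕ → P.L2} {Gk : ℕ → P.L2v}
    (h : ∀ k, P.IsWeakGrad (vk k) (Gk k)) (hv : Tendsto vk atTop (𝓝 v))
    (hG : Tendsto Gk atTop (𝓝 G)) : P.IsWeakGrad v G := by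
  rw [isWeakGrad_iff]
  intro ψ hψ hc hs e
  refine tendsto_nhds_unique (hv.inner tendsto_const_nhds) ?_
  simp only [fun k => (isWeakGrad_iff (vk k) (Gk k)).1 (h k) ψ hψ hc hs e]
  exact (hG.inner tendsto_const_nhds).neg

/-- Fundamental lemma of the calculus of variations, used for the two coordinate directions. It
makes the choice in `grad` unambiguous. -/
lemma IsWeakGrad.unique {f : Plane → ℝ} {G G' : P.L2v} (h : P.IsWeakGrad f G)
    (h' : P.IsWeakGrad f G') : G = G' := by
  have key : ∀ e : Plane, ∀ᵐ x, x ∈ interior P.carrier → inner ℝ (G x - G' x) e = 0 := by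
    intro e
    have hint : ∀ G : P.L2v, Integrable (fun x => inner ℝ (G x) e) P.μ := fun G =>
      ((Lp.memLp G).integrable (by norm_num)).inner_const e
    have hint2 : ∀ (G : P.L2v) {ψ : Plane → ℝ} (_ : Continuous ψ),
        Integrable (fun x => inner ℝ (G x) e * ψ x) P.μ := fun G ψ hψ =>
      MemLp.integrable_mul ((Lp.memLp G).inner_const e) (memLp_of_continuous hψ)
    refine isOpen_interior.ae_eq_zero_of_integral_contDiff_smul_eq_zero ?_ fun ψ hψ hc hs => ?_
    · simp only [inner_sub_left]
      exact IntegrableOn.locallyIntegrableOn ((hint G).sub (hint G'))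
    · have h1 := (h ψ hψ hc hs e).symm.trans (h' ψ hψ hc hs e)
      rw [← setIntegral_eq_integral_of_forall_compl_eq_zero (s := interior P.carrier)]
      · simp only [inner_sub_left, smul_eq_mul, mul_comm (ψ _), sub_mul]
        rw [integral_sub (hint2 G hψ.continuous) (hint2 G' hψ.continuous)]
        linarith
      · intro x hx
        rw [image_eq_zero_of_notMem_tsupport fun hx' => hx (hs hx'), zero_smul]
  refine Lp.ext ((ae_restrict_iff' isOpen_interior.measurableSet).2 ?_)
  filter_upwards [key (EuclideanSpace.single 0 1), key (EuclideanSpace.single 1 1)] with x h0 h1 hx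
  have h0 := h0 hx
  have h1 := h1 hx
  simp [inner_plane] at h0 h1
  exact plane_ext (sub_eq_zero.1 h0) (sub_eq_zero.1 h1)

lemma grad_spec {v : P.L2} (hv : v ∈ P.H1) : P.IsWeakGrad v (P.grad v) :=
  Classical.epsilon_spec (p := fun G : P.L2v => P.IsWeakGrad v G) hv

lemma IsWeakGrad.mem {v : P.L2} {G : P.L2v} (h : P.IsWeakGrad v G) : v ∈ P.H1 := ⟨G, h⟩

lemma IsWeakGrad.grad_eq {v : P.L2} {G : P.L2v} (h : P.IsWeakGrad v G) : P.grad v = G :=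
  (grad_spec h.mem).unique h

lemma IsWeakGrad.add {v w : P.L2} {G H : P.L2v} (h : P.IsWeakGrad v G) (h' : P.IsWeakGrad w H) :
    P.IsWeakGrad (v + w : P.L2) (G + H : P.L2v) := by
  rw [isWeakGrad_iff] at *
  intro ψ hψ hc hs e
  rw [inner_add_left, inner_add_left, h ψ hψ hc hs e, h' ψ hψ hc hs e, neg_add]

lemma IsWeakGrad.smul {v : P.L2} {G : P.L2v} (a : ℝ) (h : P.IsWeakGrad v G) :
    P.IsWeakGrad (a • v : P.L2) (a • G : P.L2v) := by
  rw [isWeakGrad_iff] at *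
  intro ψ hψ hc hs e
  rw [real_inner_smul_left, real_inner_smul_left, h ψ hψ hc hs e, mul_neg]

variable (P) in
/-- `H¹(P)` as a linear subspace of `L²(P)`. -/
def H1Sub : Submodule ℝ P.L2 where
  carrier := P.H1
  add_mem' h h' := ((grad_spec h).add (grad_spec h')).mem
  zero_mem' := ⟨0, by
    rw [isWeakGrad_iff]; intros; simp⟩
  smul_mem' a _ h := ((grad_spec h).smul a).mem

lemma add_mem_H1 {v w : P.L2} (hv : v ∈ P.H1) (hw : w ∈ P.H1) : v + w ∈ P.H1 :=
  P.H1Sub.add_mem hv hw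

lemma sub_mem_H1 {v w : P.L2} (hv : v ∈ P.H1) (hw : w ∈ P.H1) : v - w ∈ P.H1 :=
  P.H1Sub.sub_mem hv hw

lemma smul_mem_H1 (a : ℝ) {v : P.L2} (hv : v ∈ P.H1) : a • v ∈ P.H1 := P.H1Sub.smul_mem a hv

variable (P) in
/-- The weak gradient as a linear map on `H¹(P)`. -/
def gradL : P.H1Sub →ₗ[ℝ] P.L2v where
  toFun v := P.grad v
  map_add' v w := ((grad_spec v.2).add (grad_spec w.2)).grad_eq
  map_smul' a v := ((grad_spec v.2).smul a).grad_eq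

lemma grad_add {v w : P.L2} (hv : v ∈ P.H1) (hw : w ∈ P.H1) :
    P.grad (v + w) = P.grad v + P.grad w := P.gradL.map_add ⟨v, hv⟩ ⟨w, hw⟩

lemma grad_sub {v w : P.L2} (hv : v ∈ P.H1) (hw : w ∈ P.H1) :
    P.grad (v - w) = P.grad v - P.grad w := P.gradL.map_sub ⟨v, hv⟩ ⟨w, hw⟩

lemma grad_smul (a : ℝ) {v : P.L2} (hv : v ∈ P.H1) : P.grad (a • v) = a • P.grad v :=
  P.gradL.map_smul a ⟨v, hv⟩

lemma continuous_gradient {φ : Plane → ℝ} (hφ : ContDiff ℝ ∞ φ) : Continuous (gradient φ) :=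
  (InnerProductSpace.toDual ℝ Plane).symm.continuous.comp (hφ.continuous_fderiv (by simp))

lemma inner_gradient (φ : Plane → ℝ) (x e : Plane) :
    inner ℝ (gradient φ x) e = fderiv ℝ φ x e := by
  rw [gradient, InnerProductSpace.toDual_symm_apply]

lemma norm_gradient (φ : Plane → ℝ) (x : Plane) : ‖gradient φ x‖ = ‖fderiv ℝ φ x‖ := by
  rw [gradient, LinearIsometryEquiv.norm_map]

lemma integral_mul_fderiv_test {f : Plane → ℝ} (hf : ContDiff ℝ ∞ f) {ψ : Plane → ℝ}
    (hψ : ContDiff ℝ ∞ ψ) (hc : HasCompactSupport ψ) (hs : tsupport ψ ⊆ interior P.carrier)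
    (e : Plane) :
    ∫ x, f x * fderiv ℝ ψ x e ∂P.μ = -∫ x, fderiv ℝ f x e * ψ x ∂P.μ := by
  have hψ0 : ∀ x ∉ interior P.carrier, ψ x = 0 := fun x hx =>
    image_eq_zero_of_notMem_tsupport fun hx' => hx (hs hx')
  have hψ1 : ∀ x ∉ interior P.carrier, fderiv ℝ ψ x = 0 := fun x hx =>
    image_eq_zero_of_notMem_tsupport fun hx' => hx (hs (tsupport_fderiv_subset ℝ hx'))
  have hf' : Continuous (fderiv ℝ f) := hf.continuous_fderiv (by simp)
  have hψ' : Continuous (fderiv ℝ ψ) := hψ.continuous_fderiv (by simp)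
  have hfc := hf.continuous
  have hψc := hψ.continuous
  have hc' : HasCompactSupport fun x => fderiv ℝ ψ x e := hc.fderiv_apply ℝ e
  rw [setIntegral_eq_integral_of_forall_compl_eq_zero fun x hx => by simp [hψ1 x hx],
    setIntegral_eq_integral_of_forall_compl_eq_zero fun x hx => by simp [hψ0 x hx]]
  exact integral_mul_fderiv_eq_neg_fderiv_mul_of_integrable
    ((by fun_prop : Continuous fun x => fderiv ℝ f x e * ψ x).integrable_of_hasCompactSupport
      hc.mul_left)
    ((by fun_prop : Continuous fun x => f x * fderiv ℝ ψ x e).integrable_of_hasCompactSupport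
      hc'.mul_left)
    ((by fun_prop : Continuous fun x => f x * ψ x).integrable_of_hasCompactSupport hc.mul_left)
    (fun x _ => hf.differentiable (by simp) x) (fun x _ => hψ.differentiable (by simp) x)

lemma isWeakGrad_toL2 {φ : Plane → ℝ} (hφ : ContDiff ℝ ∞ φ) :
    P.IsWeakGrad (P.toL2 φ hφ.continuous) (P.toL2 (gradient φ) (continuous_gradient hφ)) := by
  intro ψ hψ hc hs e
  have h1 : ∫ x, P.toL2 φ hφ.continuous x * fderiv ℝ ψ x e ∂P.μ =
      ∫ x, φ x * fderiv ℝ ψ x e ∂P.μ := by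
    refine integral_congr_ae ?_
    filter_upwards [coeFn_toL2 (P := P) hφ.continuous] with x hx
    rw [hx]
  have h2 : ∫ x, inner ℝ (P.toL2 (gradient φ) (continuous_gradient hφ) x) e * ψ x ∂P.μ =
      ∫ x, fderiv ℝ φ x e * ψ x ∂P.μ := by
    refine integral_congr_ae ?_
    filter_upwards [coeFn_toL2 (P := P) (continuous_gradient hφ)] with x hx
    rw [hx, inner_gradient]
  rw [h1, h2]
  exact integral_mul_fderiv_test hφ hψ hc hs e

lemma toL2_mem_H1 {φ : Plane → ℝ} (hφ : ContDiff ℝ ∞ φ) : P.toL2 φ hφ.continuous ∈ P.H1 :=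
  (isWeakGrad_toL2 hφ).mem

lemma grad_toL2 {φ : Plane → ℝ} (hφ : ContDiff ℝ ∞ φ) :
    P.grad (P.toL2 φ hφ.continuous) = P.toL2 (gradient φ) (continuous_gradient hφ) :=
  (isWeakGrad_toL2 hφ).grad_eq

lemma toL2_add {F : Type*} [NormedAddCommGroup F] {f g : Plane → F} (hf : Continuous f)
    (hg : Continuous g) : P.toL2 (fun x => f x + g x) (hf.add hg) = P.toL2 f hf + P.toL2 g hg :=
  MemLp.toLp_add _ _

lemma toL2_sub {F : Type*} [NormedAddCommGroup F] {f g : Plane → F} (hf : Continuous f)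
    (hg : Continuous g) : P.toL2 (fun x => f x - g x) (hf.sub hg) = P.toL2 f hf - P.toL2 g hg :=
  MemLp.toLp_sub _ _

lemma toL2_smul {F : Type*} [NormedAddCommGroup F] [NormedSpace ℝ F] (a : ℝ) {f : Plane → F}
    (hf : Continuous f) : P.toL2 (fun x => a • f x) (hf.const_smul a) = a • P.toL2 f hf :=
  MemLp.toLp_const_smul _ _

end Polygon

/-! ### Mollified dilations -/

lemma lintegral_comp_affine {θ : ℝ} (hθ : θ ≠ 0) (w : Plane) (f : Plane → ℝ≥0∞)
    (hf : Measurable f) :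
    ∫⁻ x, f (θ • x + w) = ENNReal.ofReal (θ ^ 2)⁻¹ * ∫⁻ x, f x := by
  have h1 : ∫⁻ x, f (θ • x + w) = ∫⁻ z, f (z + w) ∂(Measure.map (θ • ·) volume) :=
    (lintegral_map (f := fun z => f (z + w)) (by fun_prop) (by fun_prop)).symm
  rw [h1, Measure.map_addHaar_smul volume hθ, lintegral_smul_measure,
    lintegral_add_right_eq_self f w, finrank_euclideanSpace, Fintype.card_fin,
    abs_of_nonneg (by positivity), smul_eq_mul]

/-- On a probability space the `L¹` norm is at most the `L²` norm. -/
lemma enorm_integral_sq_le {α F : Type*} [MeasurableSpace α] [NormedAddCommGroup F]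
    [NormedSpace ℝ F] (ν : Measure α) [IsProbabilityMeasure ν] {f : α → F}
    (hf : AEStronglyMeasurable f ν) : ‖∫ y, f y ∂ν‖ₑ ^ 2 ≤ ∫⁻ y, ‖f y‖ₑ ^ 2 ∂ν := by
  have h1 : ‖∫ y, f y ∂ν‖ₑ ≤ eLpNorm f 2 ν :=
    ((enorm_integral_le_lintegral_enorm f).trans_eq eLpNorm_one_eq_lintegral_enorm.symm).trans
      (eLpNorm_le_eLpNorm_of_exponent_le (by norm_num) hf)
  have h2 := eLpNorm_nnreal_pow_eq_lintegral (f := f) (μ := ν) (p := 2) (by norm_num)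
  have h3 : eLpNorm f 2 ν ^ 2 = ∫⁻ y, ‖f y‖ₑ ^ 2 ∂ν := by
    have e : ((2 : NNReal) : ℝ) = ((2 : ℕ) : ℝ) := by norm_num
    simp only [e, ENNReal.rpow_natCast] at h2
    exact h2
  rw [← h3]
  gcongr

lemma eLpNorm_two_sq {α F : Type*} [MeasurableSpace α] [NormedAddCommGroup F] (f : α → F)
    (ν : Measure α) : eLpNorm f 2 ν ^ 2 = ∫⁻ y, ‖f y‖ₑ ^ 2 ∂ν := by
  have h2 := eLpNorm_nnreal_pow_eq_lintegral (f := f) (μ := ν) (p := 2) (by norm_num)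
  have e : ((2 : NNReal) : ℝ) = ((2 : ℕ) : ℝ) := by norm_num
  simp only [e, ENNReal.rpow_natCast] at h2
  exact h2

section Mollify

variable {c : Plane} (b : ContDiffBump c) {F : Type*} [NormedAddCommGroup F] [NormedSpace ℝ F]

/-- The probability measure with the normalized bump function as density. -/
def bumpMeasure : Measure Plane := volume.withDensity fun y => ENNReal.ofReal (b.normed volume y)

lemma measurable_bump : Measurable fun y => ENNReal.ofReal (b.normed volume y) :=
  (b.continuous_normed (μ := volume)).measurable.ennreal_ofReal

instance : IsProbabilityMeasure (bumpMeasure b) := ⟨by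
  rw [bumpMeasure, withDensity_apply _ MeasurableSet.univ, Measure.restrict_univ,
    ← ofReal_integral_eq_lintegral_ofReal b.integrable_normed
      (Eventually.of_forall fun x => b.nonneg_normed x), b.integral_normed, ENNReal.ofReal_one]⟩

lemma bumpMeasure_ae_mem : ∀ᵐ y ∂bumpMeasure b, y ∈ Metric.ball c b.rOut := by
  rw [bumpMeasure, ae_withDensity_iff (measurable_bump b)]
  refine Eventually.of_forall fun y hy => ?_
  rw [← b.support_normed_eq (μ := volume)]
  intro h0
  simp [h0] at hy

/-- Average of the function `u` over small balls around the points of a dilated domain. -/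
def mollify (θ : ℝ) (u : Plane → F) (x : Plane) : F :=
  ∫ y, u (θ • x + (1 - θ) • y) ∂bumpMeasure b

/-- The convolution kernel of `mollify`. -/
def mollifyKernel (θ : ℝ) (w : Plane) : ℝ :=
  ((1 - θ) ^ 2)⁻¹ * b.normed volume ((-(1 - θ)⁻¹) • w)

lemma contDiff_mollifyKernel (θ : ℝ) : ContDiff ℝ ∞ (mollifyKernel b θ) :=
  contDiff_const.mul ((b.contDiff_normed (μ := volume) (n := ⊤)).comp
    (contDiff_id.const_smul _))

lemma hasCompactSupport_mollifyKernel {θ : ℝ} (hθ : θ < 1) :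
    HasCompactSupport (mollifyKernel b θ) := by
  have h1 : -(1 - θ)⁻¹ ≠ 0 := neg_ne_zero.2 (inv_ne_zero (by linarith))
  exact ((b.hasCompactSupport_normed (μ := volume)).comp_homeomorph
    (Homeomorph.smulOfNeZero _ h1)).mul_left

lemma mollifyKernel_sub {θ : ℝ} (hθ : θ < 1) (x y : Plane) :
    mollifyKernel b θ (x - (x + (1 - θ) • y)) = ((1 - θ) ^ 2)⁻¹ * b.normed volume y := by
  have h1 : 1 - θ ≠ 0 := by linarith
  rw [mollifyKernel, sub_add_cancel_left, ← smul_neg, smul_smul, neg_mul, inv_mul_cancel₀ h1,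
    neg_one_smul, neg_neg]

/-- The substitution `z = θ x + (1 - θ) y` turns the average into a convolution evaluated at `θ x`,
whence smoothness. -/
lemma mollify_eq_integral {θ : ℝ} (hθ : θ < 1) (u : Plane → F) (x : Plane) :
    mollify b θ u x = ∫ z, mollifyKernel b θ (θ • x - z) • u z := by
  have h1 : 0 < 1 - θ := by linarith
  set g : Plane → F := fun z => mollifyKernel b θ (θ • x - z) • u z with hg
  have h2 : ∫ y, g (θ • x + (1 - θ) • y) = ((1 - θ) ^ 2)⁻¹ • ∫ z, g z := by
    rw [Measure.integral_comp_smul volume (fun z => g (θ • x + z)), integral_add_left_eq_self,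
      finrank_euclideanSpace, Fintype.card_fin, abs_of_pos (by positivity)]
  rw [mollify, bumpMeasure, integral_withDensity_eq_integral_toReal_smul (measurable_bump b)
    (Eventually.of_forall fun y => ENNReal.ofReal_lt_top)]
  have h3 : ∀ y, (ENNReal.ofReal (b.normed volume y)).toReal • u (θ • x + (1 - θ) • y) =
      (1 - θ) ^ 2 • g (θ • x + (1 - θ) • y) := by
    intro y
    rw [ENNReal.toReal_ofReal (b.nonneg_normed y), hg]
    simp only [mollifyKernel_sub b hθ, smul_smul]
    congr 1
    field_simp
  simp only [h3]
  rw [integral_smul, h2, smul_inv_smul₀ (by positivity)]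

lemma integrable_mollify [CompleteSpace F] {θ : ℝ} (hθ : θ < 1) {u : Plane → F} (hu : LocallyIntegrable u)
    (x : Plane) : Integrable (fun y => u (θ • x + (1 - θ) • y)) (bumpMeasure b) := by
  have h1 : 0 < 1 - θ := by linarith
  rw [bumpMeasure, integrable_withDensity_iff_integrable_smul' (measurable_bump b)
    (Eventually.of_forall fun y => ENNReal.ofReal_lt_top)]
  have h2 : Integrable fun z => mollifyKernel b θ (θ • x - z) • u z :=
    (hasCompactSupport_mollifyKernel b hθ).convolutionExists_right
      (ContinuousLinearMap.lsmul ℝ ℝ).flip hu (contDiff_mollifyKernel b θ).continuous (θ • x)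
  have h3 := ((h2.comp_add_left (θ • x)).comp_smul h1.ne').smul ((1 - θ) ^ 2)
  refine h3.congr (Eventually.of_forall fun y => ?_)
  simp only [Pi.smul_apply]
  rw [ENNReal.toReal_ofReal (b.nonneg_normed y)]
  simp only [mollifyKernel_sub b hθ, smul_smul]
  congr 1
  field_simp

lemma hasFDerivAt_mollify {θ : ℝ} (hθ : θ < 1) {u : Plane → ℝ} (hu : LocallyIntegrable u) :
    ContDiff ℝ ∞ (mollify b θ u) ∧ ∀ x e, fderiv ℝ (mollify b θ u) x e =
      θ * ∫ z, fderiv ℝ (mollifyKernel b θ) (θ • x - z) e * u z := by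
  have hk := hasCompactSupport_mollifyKernel b hθ
  have hkd := contDiff_mollifyKernel b θ
  set L := (ContinuousLinearMap.lsmul ℝ ℝ : ℝ →L[ℝ] ℝ →L[ℝ] ℝ).flip with hL
  have hfun : mollify b θ u =
      (convolution u (mollifyKernel b θ) L volume) ∘ (fun x => θ • x) := by
    funext x
    rw [mollify_eq_integral b hθ]
    rfl
  have hd : ∀ x, HasFDerivAt (mollify b θ u) _ x := fun x => by
    rw [hfun]
    exact (hk.hasFDerivAt_convolution_right L hu (hkd.of_le (by simp)) (θ • x)).comp x
      ((hasFDerivAt_id x).const_smul θ)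
  refine ⟨?_, fun x e => ?_⟩
  · rw [hfun]
    exact (hk.contDiff_convolution_right L hu hkd).comp (contDiff_id.const_smul _)
  · rw [(hd x).fderiv]
    simp only [ContinuousLinearMap.comp_apply, smul_apply, map_smul,
      smul_eq_mul, ContinuousLinearMap.id_apply]
    congr 1
    rw [convolution_precompR_apply L hu (hk.fderiv ℝ) (hkd.continuous_fderiv (by simp))]
    rfl

lemma stronglyMeasurable_mollify (θ : ℝ) {u : Plane → F} (hu : StronglyMeasurable u) :
    StronglyMeasurable (mollify b θ u) := by
  have : StronglyMeasurable (fun p : Plane × Plane => u (θ • p.1 + (1 - θ) • p.2)) :=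
    hu.comp_measurable (by fun_prop)
  exact this.integral_prod_right

/-- Jensen's inequality, Tonelli, and the factor `θ⁻²` of the planar dilation in the squared norm.
-/
lemma eLpNorm_mollify_le {θ : ℝ} (h0 : 0 < θ) {u : Plane → F}
    (hu : StronglyMeasurable u) :
    eLpNorm (mollify b θ u) 2 volume ≤ ENNReal.ofReal θ⁻¹ * eLpNorm u 2 volume := by
  have hm : StronglyMeasurable (fun p : Plane × Plane => u (θ • p.1 + (1 - θ) • p.2)) :=
    hu.comp_measurable (by fun_prop)
  have hsq : eLpNorm (mollify b θ u) 2 volume ^ 2 ≤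
      (ENNReal.ofReal θ⁻¹ * eLpNorm u 2 volume) ^ 2 := by
    rw [mul_pow, eLpNorm_two_sq, eLpNorm_two_sq, ← ENNReal.ofReal_pow (by positivity)]
    calc ∫⁻ x, ‖mollify b θ u x‖ₑ ^ 2
        ≤ ∫⁻ x, ∫⁻ y, ‖u (θ • x + (1 - θ) • y)‖ₑ ^ 2 ∂bumpMeasure b :=
          lintegral_mono fun x => enorm_integral_sq_le _
            (hu.comp_measurable (by fun_prop)).aestronglyMeasurable
      _ = ∫⁻ y, ∫⁻ x, ‖u (θ • x + (1 - θ) • y)‖ₑ ^ 2 ∂volume ∂bumpMeasure b :=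
          lintegral_lintegral_swap (hm.enorm.pow_const 2).aemeasurable
      _ = ∫⁻ _, ENNReal.ofReal (θ ^ 2)⁻¹ * ∫⁻ x, ‖u x‖ₑ ^ 2 ∂volume ∂bumpMeasure b :=
          lintegral_congr fun y => lintegral_comp_affine h0.ne' _ (fun z => ‖u z‖ₑ ^ 2)
            (hu.enorm.pow_const 2)
      _ = ENNReal.ofReal (θ⁻¹ ^ 2) * ∫⁻ x, ‖u x‖ₑ ^ 2 := by
          rw [lintegral_const, measure_univ, mul_one, inv_pow]
  exact (ENNReal.pow_le_pow_left_iff two_ne_zero).1 hsq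

/-- Density argument with a continuous compactly supported `g` near `u`: mollification has norm at
most `2` because `θ ≥ 1/2`, and for `g` uniform continuity applies since the averaging points are at
distance `(1 - θ) |y - x|` from `x`. The error splits as `2 · ε/4 + ε/4 + ε/4`. -/
lemma tendsto_eLpNorm_mollify_sub [CompleteSpace F] {μ : Measure Plane} [IsFiniteMeasure μ] (hμ : μ ≤ volume)
    {R : ℝ} (hR : ∀ᵐ x ∂μ, ∀ y ∈ Metric.ball c b.rOut, dist x y ≤ R) {u : Plane → F}
    (hum : StronglyMeasurable u) (hu : MemLp u 2 volume) {θ : ℕ → ℝ} (h0 : ∀ k, 1 / 2 ≤ θ k)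
    (h1 : ∀ k, θ k < 1) (hθ : Tendsto θ atTop (𝓝 1)) :
    Tendsto (fun k => eLpNorm (fun x => mollify b (θ k) u x - u x) 2 μ) atTop (𝓝 0) := by
  rw [ENNReal.tendsto_atTop_zero]
  intro ε hε
  rcases eq_or_ne ε ⊤ with rfl | hεt
  · exact ⟨0, fun _ _ => le_top⟩
  -- The summand one only keeps `M` away from zero, so that it can be divided by.
  set M : ℝ≥0∞ := μ Set.univ ^ (1 / 2 : ℝ) + 1 with hM
  have hMt : M ≠ ⊤ := ENNReal.add_ne_top.2
    ⟨ENNReal.rpow_ne_top_of_nonneg (by norm_num) (measure_ne_top _ _), ENNReal.one_ne_top⟩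
  have hM0 : M ≠ 0 := by simp [hM]
  have hε4 : ε / 4 ≠ 0 := (ENNReal.div_pos hε.ne' (by norm_num)).ne'
  obtain ⟨g, hgc, hge, hgcont, hgm⟩ := hu.exists_hasCompactSupport_eLpNorm_sub_le
    (by norm_num) hε4
  obtain ⟨δ, hδ0, hδ⟩ : ∃ δ : ℝ, 0 < δ ∧ ENNReal.ofReal δ * M ≤ ε / 4 := by
    refine ⟨(ε / 4 / M).toReal, ENNReal.toReal_pos (ENNReal.div_ne_zero.2 ⟨hε4, hMt⟩)
      (ENNReal.div_ne_top (ENNReal.div_ne_top hεt (by norm_num)) hM0), ?_⟩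
    rw [ENNReal.ofReal_toReal (ENNReal.div_ne_top (ENNReal.div_ne_top hεt (by norm_num)) hM0),
      ENNReal.div_mul_cancel hM0 hMt]
  obtain ⟨η, hη0, hη⟩ := Metric.uniformContinuous_iff.1
    (hgc.uniformContinuous_of_continuous hgcont) δ hδ0
  have hlim : Tendsto (fun k => (1 - θ k) * |R|) atTop (𝓝 0) := by
    simpa using ((tendsto_const_nhds (x := (1 : ℝ))).sub hθ).mul_const |R|
  obtain ⟨N, hN⟩ := eventually_atTop.1 (hlim.eventually_lt_const hη0)
  refine ⟨N, fun k hk => ?_⟩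
  have hulc : LocallyIntegrable u := hu.locallyIntegrable (by norm_num)
  have hglc : LocallyIntegrable g := hgm.locallyIntegrable (by norm_num)
  have hgs : StronglyMeasurable g := hgcont.stronglyMeasurable
  have hdec : (fun x => mollify b (θ k) u x - u x) =
      (mollify b (θ k) (u - g) + fun x => (mollify b (θ k) g x - g x)) - (u - g) := by
    funext x
    have : mollify b (θ k) (u - g) x = mollify b (θ k) u x - mollify b (θ k) g x :=
      integral_sub (integrable_mollify b (h1 k) hulc x) (integrable_mollify b (h1 k) hglc x)
    simp only [Pi.add_apply, Pi.sub_apply, this]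
    abel
  have hA : eLpNorm (mollify b (θ k) (u - g)) 2 μ ≤ 2 * (ε / 4) := by
    refine (eLpNorm_mono_measure _ hμ).trans ((eLpNorm_mollify_le b (by linarith [h0 k])
      (hum.sub hgs)).trans ?_)
    gcongr
    rw [← ENNReal.ofReal_ofNat]
    apply ENNReal.ofReal_le_ofReal
    rw [inv_le_comm₀ (by linarith [h0 k]) (by norm_num)]
    linarith [h0 k]
  have hB : eLpNorm (fun x => mollify b (θ k) g x - g x) 2 μ ≤ ε / 4 := by
    refine le_trans ?_ hδ
    have hpt : ∀ᵐ x ∂μ, ‖mollify b (θ k) g x - g x‖ ≤ δ := by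
      filter_upwards [hR] with x hx
      have e1 : mollify b (θ k) g x - g x =
          ∫ y, (g (θ k • x + (1 - θ k) • y) - g x) ∂bumpMeasure b := by
        rw [integral_sub (integrable_mollify b (h1 k) hglc x) (integrable_const _)]
        simp [mollify]
      rw [e1]
      refine (norm_integral_le_of_norm_le_const (C := δ) ?_).trans (by simp)
      filter_upwards [bumpMeasure_ae_mem b] with y hy
      rw [← dist_eq_norm]
      refine (hη ?_).le
      have e2 : θ k • x + (1 - θ k) • y - x = (1 - θ k) • (y - x) := by module
      rw [dist_eq_norm, e2, norm_smul, Real.norm_eq_abs, abs_of_pos (by linarith [h1 k]),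
        ← dist_eq_norm, dist_comm]
      refine lt_of_le_of_lt ?_ (hN k hk)
      exact mul_le_mul_of_nonneg_left ((hx y hy).trans (le_abs_self R)) (by linarith [h1 k])
    have := eLpNorm_le_of_ae_bound (p := 2) hpt
    refine this.trans ?_
    rw [mul_comm]
    gcongr
    rw [hM]
    simp only [one_div, ENNReal.toReal_ofNat]
    exact le_self_add
  have hC : eLpNorm (u - g) 2 μ ≤ ε / 4 := (eLpNorm_mono_measure _ hμ).trans hge
  rw [hdec]
  have hms : AEStronglyMeasurable (mollify b (θ k) (u - g)) μ :=
    (stronglyMeasurable_mollify b (θ k) (hum.sub hgs)).aestronglyMeasurable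
  have hms2 : AEStronglyMeasurable (fun x => mollify b (θ k) g x - g x) μ :=
    ((stronglyMeasurable_mollify b (θ k) hgs).sub hgs).aestronglyMeasurable
  have hms3 : AEStronglyMeasurable (u - g) μ := (hum.sub hgs).aestronglyMeasurable
  calc _ ≤ _ := eLpNorm_sub_le (hms.add hms2) hms3 (by norm_num)
    _ ≤ (2 * (ε / 4) + ε / 4) + ε / 4 :=
        add_le_add ((eLpNorm_add_le hms hms2 (by norm_num)).trans (add_le_add hA hB)) hC
    _ = 4 * (ε / 4) := by ring
    _ = ε := ENNReal.mul_div_cancel (by norm_num) (by norm_num)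

end Mollify

/-! ### Density of smooth functions in `H¹(P)` -/

namespace Polygon

variable {P : Polygon} {c : Plane} {r : ℝ}

lemma tendsto_toLp {α F : Type*} [MeasurableSpace α] {ν : Measure α} [NormedAddCommGroup F]
    {f : ℕ → α → F} (hf : ∀ k, MemLp (f k) 2 ν) (v : Lp F 2 ν) :
    Tendsto (fun k => (hf k).toLp (f k)) atTop (𝓝 v) ↔
      Tendsto (fun k => eLpNorm (fun x => f k x - v x) 2 ν) atTop (𝓝 0) := by
  rw [Lp.tendsto_Lp_iff_tendsto_eLpNorm']
  refine iff_of_eq (congrArg (Tendsto · _ _) (funext fun k => eLpNorm_congr_ae ?_))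
  filter_upwards [(hf k).coeFn_toLp] with x hx
  rw [Pi.sub_apply, hx]

variable (P) in
/-- Extension by zero outside the interior of `P`. -/
def extend {F : Type*} [NormedAddCommGroup F] (v : Lp F 2 P.μ) : Plane → F :=
  (interior P.carrier).indicator v

section Extend

variable {F : Type*} [NormedAddCommGroup F] (v : Lp F 2 P.μ)

lemma stronglyMeasurable_extend : StronglyMeasurable (P.extend v) :=
  (Lp.stronglyMeasurable v).indicator isOpen_interior.measurableSet

lemma memLp_extend : MemLp (P.extend v) 2 volume :=
  (memLp_indicator_iff_restrict isOpen_interior.measurableSet).2 (Lp.memLp v)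

lemma extend_ae_eq : P.extend v =ᵐ[P.μ] v := indicator_ae_eq_restrict isOpen_interior.measurableSet

end Extend

lemma dist_le_h {x y : Plane} (hx : x ∈ P.carrier) (hy : y ∈ P.carrier) : dist x y ≤ P.h :=
  Metric.dist_le_diam_of_mem P.isCompact.isBounded hx hy

lemma tendsto_mollify (h : P.StarBall c r) (b : ContDiffBump c) (hb : b.rOut ≤ r)
    {F : Type*} [NormedAddCommGroup F] [NormedSpace ℝ F] [CompleteSpace F] (v : Lp F 2 P.μ)
    {θ : ℕ → ℝ} (h0 : ∀ k, 1 / 2 ≤ θ k) (h1 : ∀ k, θ k < 1) (hθ : Tendsto θ atTop (𝓝 1)) :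
    Tendsto (fun k => eLpNorm (fun x => mollify b (θ k) (P.extend v) x - v x) 2 P.μ)
      atTop (𝓝 0) := by
  have hR : ∀ᵐ x ∂P.μ, ∀ y ∈ Metric.ball c b.rOut, dist x y ≤ P.h := by
    filter_upwards [ae_restrict_mem isOpen_interior.measurableSet] with x hx y hy
    exact dist_le_h (interior_subset hx)
      (ball_subset_of_starConvex h.star carrier_nonempty (Metric.ball_subset_ball hb hy))
  refine (tendsto_eLpNorm_mollify_sub b Measure.restrict_le_self hR (stronglyMeasurable_extend v)
    (memLp_extend v) h0 h1 hθ).congr fun k => eLpNorm_congr_ae ?_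
  filter_upwards [extend_ae_eq v] with x hx
  rw [hx]

/-- The support is contained in the points `θ x + (1 - θ) y` with `y` in the closed bump ball, a
compact set that star-shapedness places in the interior. So the kernel is an admissible test
function for every `x` in the carrier. -/
lemma test_mollifyKernel (h : P.StarBall c r) (b : ContDiffBump c) (hb : b.rOut < r) {θ : ℝ}
    (h0 : 0 ≤ θ) (h1 : θ < 1) {x : Plane} (hx : x ∈ P.carrier) :
    HasCompactSupport (fun z => mollifyKernel b θ (θ • x - z)) ∧
      tsupport (fun z => mollifyKernel b θ (θ • x - z)) ⊆ interior P.carrier := by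
  have h1' : 1 - θ ≠ 0 := by linarith
  set S : Set Plane := (fun y => θ • x + (1 - θ) • y) '' Metric.closedBall c b.rOut with hS
  have hSc : IsCompact S := (isCompact_closedBall c b.rOut).image (by fun_prop)
  have hsub : Function.support (fun z => mollifyKernel b θ (θ • x - z)) ⊆ S := by
    intro z hz
    have e : z = θ • x + (1 - θ) • ((1 - θ)⁻¹ • (z - θ • x)) := by
      rw [smul_inv_smul₀ h1', add_sub_cancel]
    refine ⟨(1 - θ)⁻¹ • (z - θ • x), ?_, e.symm⟩
    rw [Function.mem_support, e, mollifyKernel_sub b h1] at hz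
    rw [← b.tsupport_normed_eq (μ := volume)]
    exact subset_tsupport _ (right_ne_zero_of_mul hz)
  refine ⟨HasCompactSupport.of_support_subset_isCompact hSc hsub,
    (closure_minimal hsub hSc.isClosed).trans ?_⟩
  rintro _ ⟨y, hy, rfl⟩
  have := smul_add_smul_mem_interior h.star hx (Metric.closedBall_subset_ball hb hy) h0 h1
  rwa [add_comm] at this

/-- The derivative falls on the kernel, and the definition of the weak gradient with the kernel as
test function moves it to `v`; the factor `θ` is the inner derivative of the dilation. -/
lemma gradient_mollify (h : P.StarBall c r) (b : ContDiffBump c) (hb : b.rOut < r) {θ : ℝ}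
    (h0 : 0 ≤ θ) (h1 : θ < 1) {v : P.L2} {G : P.L2v} (hG : P.IsWeakGrad v G) {x : Plane}
    (hx : x ∈ P.carrier) :
    gradient (mollify b θ (P.extend v)) x = θ • mollify b θ (P.extend G) x := by
  have hGl : LocallyIntegrable (P.extend G) := (memLp_extend G).locallyIntegrable (by norm_num)
  have hvl : LocallyIntegrable (P.extend v) := (memLp_extend v).locallyIntegrable (by norm_num)
  refine ext_inner_right ℝ fun e => ?_
  rw [inner_gradient, (hasFDerivAt_mollify b h1 hvl).2 x e, real_inner_smul_left,
    mollify_eq_integral b h1]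
  congr 1
  have hkd := contDiff_mollifyKernel b θ
  obtain ⟨hc, hs⟩ := test_mollifyKernel h b hb h0 h1 hx
  set ψ : Plane → ℝ := fun z => mollifyKernel b θ (θ • x - z) with hψ
  have hψd : ContDiff ℝ ∞ ψ := hkd.comp (contDiff_const.sub contDiff_id)
  have hψ' : ∀ z, fderiv ℝ ψ z e = -fderiv ℝ (mollifyKernel b θ) (θ • x - z) e := by
    intro z
    have h2 := ((hkd.differentiable (by simp)) (θ • x - z)).hasFDerivAt.comp z
      ((hasFDerivAt_id z).const_sub (θ • x))
    have h3 : fderiv ℝ ψ z = _ := h2.fderiv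
    rw [h3]
    simp
  have hint : Integrable fun z => ψ z • P.extend G z :=
    (hasCompactSupport_mollifyKernel b h1).convolutionExists_right
      (ContinuousLinearMap.lsmul ℝ ℝ).flip hGl hkd.continuous (θ • x)
  have hw := hG ψ hψd hc hs e
  rw [real_inner_comm, ← integral_inner hint e]
  have e1 : ∫ z, fderiv ℝ (mollifyKernel b θ) (θ • x - z) e * P.extend v z =
      -∫ z, v z * fderiv ℝ ψ z e ∂P.μ := by
    rw [← integral_indicator isOpen_interior.measurableSet, ← integral_neg]
    refine integral_congr_ae (Eventually.of_forall fun z => ?_)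
    by_cases hz : z ∈ interior P.carrier
    · simp only [extend, Set.indicator_of_mem hz, hψ']; ring
    · simp only [extend, Set.indicator_of_notMem hz]; simp
  have e2 : ∫ z, inner ℝ e (ψ z • P.extend G z) = ∫ z, inner ℝ (G z) e * ψ z ∂P.μ := by
    rw [← integral_indicator isOpen_interior.measurableSet]
    refine integral_congr_ae (Eventually.of_forall fun z => ?_)
    by_cases hz : z ∈ interior P.carrier
    · simp only [extend, Set.indicator_of_mem hz, real_inner_smul_right, real_inner_comm e]; ring
    · simp only [extend, Set.indicator_of_notMem hz]; simp
  rw [e1, e2, hw, neg_neg]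

/-- Smooth functions are dense in `H¹(P)`. -/
theorem exists_tendsto_smooth (h : P.StarBall c r) {v : P.L2} (hv : v ∈ P.H1) :
    ∃ (φ : ℕ → Plane → ℝ) (hφ : ∀ k, ContDiff ℝ ∞ (φ k)),
      Tendsto (fun k => P.toL2 (φ k) (hφ k).continuous) atTop (𝓝 v) ∧
      Tendsto (fun k => P.toL2 (gradient (φ k)) (continuous_gradient (hφ k))) atTop
        (𝓝 (P.grad v)) := by
  have hr := h.pos
  set b : ContDiffBump c := ⟨r / 4, r / 2, by linarith, by linarith⟩ with hb
  have hbr : b.rOut < r := by change r / 2 < r; linarith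
  -- The shift by two gives `1/2 ≤ θ < 1` from `k = 0` on.
  set θ : ℕ → ℝ := fun k => 1 - 1 / ((k : ℝ) + 2) with hθ
  have h0 : ∀ k, 1 / 2 ≤ θ k := fun k => by
    have : (1 : ℝ) / ((k : ℝ) + 2) ≤ 1 / 2 :=
      one_div_le_one_div_of_le (by norm_num) (by linarith [k.cast_nonneg (α := ℝ)])
    simp only [hθ]; linarith
  have h1 : ∀ k, θ k < 1 := fun k => by
    have : (0 : ℝ) < 1 / ((k : ℝ) + 2) := by positivity
    simp only [hθ]; linarith
  have hlim : Tendsto θ atTop (𝓝 1) := by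
    have h2 : Tendsto (fun k : ℕ => (1 : ℝ) / ((k : ℝ) + 2)) atTop (𝓝 0) := by
      simp only [one_div]
      exact tendsto_inv_atTop_zero.comp
        (tendsto_atTop_add_const_right _ _ tendsto_natCast_atTop_atTop)
    simpa [hθ] using (tendsto_const_nhds (x := (1 : ℝ))).sub h2
  have hvl : LocallyIntegrable (P.extend v) := (memLp_extend v).locallyIntegrable (by norm_num)
  have hφ : ∀ k, ContDiff ℝ ∞ (mollify b (θ k) (P.extend v)) := fun k =>
    (hasFDerivAt_mollify b (h1 k) hvl).1
  refine ⟨fun k => mollify b (θ k) (P.extend v), hφ, ?_, ?_⟩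
  · exact (tendsto_toLp (fun k => memLp_of_continuous (hφ k).continuous) v).2
      (tendsto_mollify h b hbr.le v h0 h1 hlim)
  · have hm : ∀ k, MemLp (mollify b (θ k) (P.extend (P.grad v))) 2 P.μ := fun k =>
      MemLp.mono_measure Measure.restrict_le_self
        ⟨(stronglyMeasurable_mollify b (θ k)
          (stronglyMeasurable_extend (P.grad v))).aestronglyMeasurable,
          lt_of_le_of_lt (eLpNorm_mollify_le b (by linarith [h0 k])
            (stronglyMeasurable_extend (P.grad v)))
            (ENNReal.mul_lt_top ENNReal.ofReal_lt_top (memLp_extend (P.grad v)).2)⟩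
    have h2 := (tendsto_toLp hm (P.grad v)).2 (tendsto_mollify h b hbr.le (P.grad v) h0 h1 hlim)
    -- The gradients of the mollifications carry the additional factor `θ k`, which tends to one.
    have h3 := hlim.smul h2
    rw [one_smul] at h3
    refine h3.congr fun k => ?_
    refine Lp.ext ?_
    filter_upwards [Lp.coeFn_smul (θ k) ((hm k).toLp _), (hm k).coeFn_toLp,
      coeFn_toL2 (P := P) (continuous_gradient (hφ k)),
      ae_restrict_mem isOpen_interior.measurableSet] with x e1 e2 e3 hx
    rw [e1, Pi.smul_apply, e2, e3, gradient_mollify h b hbr (by linarith [h0 k]) (h1 k)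
      (grad_spec hv) (interior_subset hx)]

end Polygon

/-! ### Traces -/

namespace Polygon

variable {P : Polygon} {c : Plane} {r : ℝ}

/-- The space of square integrable functions on a parametrized edge. -/
abbrev EdgeL2 : Type := Lp ℝ 2 (volume.restrict (Set.Icc (0 : ℝ) 1))

lemma memLp_edge {f : ℝ → ℝ} (hf : Continuous f) :
    MemLp f 2 (volume.restrict (Set.Icc (0 : ℝ) 1)) := by
  obtain ⟨C, hC⟩ := (isCompact_Icc (a := (0 : ℝ)) (b := 1)).exists_bound_of_continuousOn
    hf.continuousOn
  refine MemLp.of_bound hf.aestronglyMeasurable C ?_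
  exact (ae_restrict_iff' measurableSet_Icc).2 (Eventually.of_forall hC)

variable (P) in
/-- Restriction of a continuous function to an edge. -/
def edgeRestrict (f : Plane → ℝ) (hf : Continuous f) (j : Fin P.n) : EdgeL2 :=
  (memLp_edge (hf.comp (continuous_edgePoint j))).toLp _

lemma coeFn_edgeRestrict {f : Plane → ℝ} (hf : Continuous f) (j : Fin P.n) :
    P.edgeRestrict f hf j =ᵐ[volume.restrict (Set.Icc (0 : ℝ) 1)]
      fun t => f (P.edgePoint j t) := MemLp.coeFn_toLp _

lemma edgeRestrict_sub {f g : Plane → ℝ} (hf : Continuous f) (hg : Continuous g) (j : Fin P.n) :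
    P.edgeRestrict (fun x => f x - g x) (hf.sub hg) j =
      P.edgeRestrict f hf j - P.edgeRestrict g hg j := MemLp.toLp_sub _ _

lemma edgeRestrict_add {f g : Plane → ℝ} (hf : Continuous f) (hg : Continuous g) (j : Fin P.n) :
    P.edgeRestrict (fun x => f x + g x) (hf.add hg) j =
      P.edgeRestrict f hf j + P.edgeRestrict g hg j := MemLp.toLp_add _ _

lemma edgeRestrict_smul (a : ℝ) {f : Plane → ℝ} (hf : Continuous f) (j : Fin P.n) :
    P.edgeRestrict (fun x => a • f x) (hf.const_smul a) j = a • P.edgeRestrict f hf j :=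
  MemLp.toLp_const_smul a (memLp_edge (hf.comp (continuous_edgePoint j)))

lemma integral_Icc_eq (f : ℝ → ℝ) :
    ∫ t in Set.Icc (0 : ℝ) 1, f t = ∫ t in (0 : ℝ)..1, f t := by
  rw [intervalIntegral.integral_of_le zero_le_one, integral_Icc_eq_integral_Ioc]

lemma norm_sq_edgeRestrict {f : Plane → ℝ} (hf : Continuous f) (j : Fin P.n) :
    ‖P.edgeRestrict f hf j‖ ^ 2 = ∫ t in (0 : ℝ)..1, f (P.edgePoint j t) ^ 2 := by
  rw [← real_inner_self_eq_norm_sq, L2.inner_def, ← integral_Icc_eq]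
  refine integral_congr_ae ?_
  filter_upwards [coeFn_edgeRestrict hf j] with t ht
  rw [ht, real_inner_self_eq_norm_sq, Real.norm_eq_abs, sq_abs]

lemma integral_norm_mul_norm_le {F G : Type*} [NormedAddCommGroup F] [InnerProductSpace ℝ F]
    [NormedAddCommGroup G] [InnerProductSpace ℝ G]
    {f : Plane → F} {g : Plane → G} (hf : Continuous f) (hg : Continuous g) :
    ∫ x, ‖f x‖ * ‖g x‖ ∂P.μ ≤ ‖P.toL2 f hf‖ * ‖P.toL2 g hg‖ := by
  have h1 := real_inner_le_norm (P.toL2 (fun x => ‖f x‖) hf.norm) (P.toL2 (fun x => ‖g x‖) hg.norm)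
  have hn : ∀ {F : Type _} [NormedAddCommGroup F] [InnerProductSpace ℝ F] {f : Plane → F}
      (hf : Continuous f), ‖P.toL2 (fun x => ‖f x‖) hf.norm‖ = ‖P.toL2 f hf‖ := by
    intro F _ _ f hf
    refine (pow_left_inj₀ (norm_nonneg _) (norm_nonneg _) two_ne_zero).1 ?_
    rw [norm_sq_toL2, norm_sq_toL2]
    simp only [norm_norm]
  have hn' : ‖P.toL2 (fun x => ‖g x‖) hg.norm‖ = ‖P.toL2 g hg‖ := by
    refine (pow_left_inj₀ (norm_nonneg _) (norm_nonneg _) two_ne_zero).1 ?_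
    rw [norm_sq_toL2, norm_sq_toL2]
    simp only [norm_norm]
  rw [hn hf, hn', inner_toL2] at h1
  refine le_trans (le_of_eq (integral_congr_ae ?_)) h1
  filter_upwards [coeFn_toL2 (P := P) hf.norm] with x hx
  rw [hx]
  simp [mul_comm]

lemma norm_sub_center_le (h : P.StarBall c r) {x : Plane} (hx : x ∈ P.carrier) :
    ‖x - c‖ ≤ P.h := by
  rw [← dist_eq_norm]
  exact dist_le_h hx (interior_subset h.mem_interior)

/-- The trace inequality with explicit constants: in the identity `integral_edge_sq` the vector `x -
c` has length at most `h_P`. -/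
lemma edgeRestrict_sq_le (h : P.StarBall c r) (j : Fin P.n) {φ : Plane → ℝ}
    (hφ : ContDiff ℝ ∞ φ) :
    |P.det c j| * ‖P.edgeRestrict φ hφ.continuous j‖ ^ 2 ≤
      2 * ‖P.toL2 φ hφ.continuous‖ ^ 2 + 2 * P.h * (‖P.toL2 φ hφ.continuous‖ *
        ‖P.toL2 (gradient φ) (continuous_gradient hφ)‖) := by
  have hφc := hφ.continuous
  have hg := continuous_gradient hφ
  have hφ' : Continuous (fderiv ℝ φ) := hφ.continuous_fderiv (by simp)
  have hh : 0 ≤ P.h := Metric.diam_nonneg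
  rw [norm_sq_edgeRestrict, integral_edge_sq h j hφ]
  have hc1 : Continuous fun x => 2 * φ x ^ 2 + 2 * φ x * fderiv ℝ φ x (x - c) := by fun_prop
  have hc2 : Continuous fun x => 2 * ‖φ x‖ ^ 2 + 2 * P.h * (‖φ x‖ * ‖gradient φ x‖) := by fun_prop
  calc ∫ x in P.tri c j, (2 * φ x ^ 2 + 2 * φ x * fderiv ℝ φ x (x - c))
      ≤ ∫ x in P.tri c j, (2 * ‖φ x‖ ^ 2 + 2 * P.h * (‖φ x‖ * ‖gradient φ x‖)) := by
        refine setIntegral_mono_on (IntegrableOn.mono_set (integrable_of_continuous hc1) (h.tri_subset j))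
          (IntegrableOn.mono_set (integrable_of_continuous hc2) (h.tri_subset j)) (measurableSet_tri h j) ?_
        intro x hx
        have hx' := interior_subset (h.tri_subset j hx)
        have h1 : φ x * fderiv ℝ φ x (x - c) ≤ ‖φ x‖ * (‖gradient φ x‖ * P.h) := by
          refine (le_abs_self _).trans ?_
          rw [abs_mul, norm_gradient]
          refine mul_le_mul_of_nonneg_left ?_ (abs_nonneg _)
          exact ((fderiv ℝ φ x).le_opNorm _).trans
            (mul_le_mul_of_nonneg_left (norm_sub_center_le h hx') (norm_nonneg _))
        rw [Real.norm_eq_abs, sq_abs]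
        rw [Real.norm_eq_abs] at h1
        linarith
    _ ≤ ∫ x, (2 * ‖φ x‖ ^ 2 + 2 * P.h * (‖φ x‖ * ‖gradient φ x‖)) ∂P.μ :=
        setIntegral_mono_set (integrable_of_continuous hc2)
          (Eventually.of_forall fun x => by positivity)
          (LE.le.eventuallyLE (h.tri_subset j))
    _ = 2 * ‖P.toL2 φ hφ.continuous‖ ^ 2 + 2 * P.h * ∫ x, ‖φ x‖ * ‖gradient φ x‖ ∂P.μ := by
        rw [norm_sq_toL2, integral_add (integrable_of_continuous (by fun_prop))
          (integrable_of_continuous (by fun_prop)), integral_const_mul, integral_const_mul]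
    _ ≤ _ := by
        gcongr
        exact integral_norm_mul_norm_le hφc hg

/-- The constant may depend on the polygon and the edge; it serves only the existence and uniqueness
of traces. -/
lemma edgeRestrict_le (h : P.StarBall c r) (j : Fin P.n) : ∃ C : ℝ, ∀ {φ : Plane → ℝ}
    (hφ : ContDiff ℝ ∞ φ), ‖P.edgeRestrict φ hφ.continuous j‖ ≤ C * (‖P.toL2 φ hφ.continuous‖ +
        ‖P.toL2 (gradient φ) (continuous_gradient hφ)‖) := by
  have hd := h.abs_det_pos j
  have hh : 0 ≤ P.h := Metric.diam_nonneg
  refine ⟨√(2 * (1 + P.h) / |P.det c j|), fun {φ} hφ => ?_⟩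
  have h1 := edgeRestrict_sq_le h j hφ
  set a := ‖P.toL2 φ hφ.continuous‖
  set b := ‖P.toL2 (gradient φ) (continuous_gradient hφ)‖
  have ha : 0 ≤ a := norm_nonneg _
  have hb : 0 ≤ b := norm_nonneg _
  rw [← Real.sqrt_sq (add_nonneg ha hb), ← Real.sqrt_mul (by positivity)]
  apply Real.le_sqrt_of_sq_le
  rw [div_mul_eq_mul_div, le_div_iff₀ hd, mul_comm]
  refine h1.trans ?_
  have e : 2 * (1 + P.h) * (a + b) ^ 2 - (2 * a ^ 2 + 2 * P.h * (a * b)) =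
    2 * (2 * (a * b) + b ^ 2) + 2 * P.h * (a ^ 2 + a * b + b ^ 2) := by ring
  have : 0 ≤ 2 * (2 * (a * b) + b ^ 2) + 2 * P.h * (a ^ 2 + a * b + b ^ 2) := by positivity
  linarith

/-- Restates the definition as convergence in the `L²` spaces, where completeness and limit rules
are available. -/
lemma isTrace_iff {v : P.L2} {τ : Fin P.n → EdgeL2} : P.IsTrace v τ ↔
    ∃ (φ : ℕ → Plane → ℝ) (hφ : ∀ k, ContDiff ℝ ∞ (φ k)),
      Tendsto (fun k => P.toL2 (φ k) (hφ k).continuous) atTop (𝓝 v) ∧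
      Tendsto (fun k => P.toL2 (gradient (φ k)) (continuous_gradient (hφ k))) atTop
        (𝓝 (P.grad v)) ∧
      ∀ j, Tendsto (fun k => P.edgeRestrict (φ k) (hφ k).continuous j) atTop (𝓝 (τ j)) := by
  refine exists_congr fun φ => ?_
  rw [← exists_prop]
  refine exists_congr fun hφ => and_congr ?_ (and_congr ?_ (forall_congr' fun j => ?_))
  · exact (tendsto_toLp (fun k => memLp_of_continuous (hφ k).continuous) v).symm
  · exact (tendsto_toLp (fun k => memLp_of_continuous (continuous_gradient (hφ k))) _).symm
  · exact (tendsto_toLp (fun k => memLp_edge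
      ((hφ k).continuous.comp (continuous_edgePoint j))) (τ j)).symm

lemma gradient_sub {φ ψ : Plane → ℝ} (hφ : ContDiff ℝ ∞ φ) (hψ : ContDiff ℝ ∞ ψ) :
    gradient (fun x => φ x - ψ x) = fun x => gradient φ x - gradient ψ x := by
  funext x
  rw [gradient, fderiv_fun_sub (hφ.differentiable (by simp) x) (hψ.differentiable (by simp) x),
    map_sub]
  rfl

lemma gradient_add {φ ψ : Plane → ℝ} (hφ : ContDiff ℝ ∞ φ) (hψ : ContDiff ℝ ∞ ψ) :
    gradient (fun x => φ x + ψ x) = fun x => gradient φ x + gradient ψ x := by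
  funext x
  rw [gradient, fderiv_fun_add (hφ.differentiable (by simp) x) (hψ.differentiable (by simp) x),
    map_add]
  rfl

lemma gradient_smul (a : ℝ) {φ : Plane → ℝ} (hφ : ContDiff ℝ ∞ φ) :
    gradient (fun x => a • φ x) = fun x => a • gradient φ x := by
  funext x
  rw [gradient, fderiv_fun_const_smul (hφ.differentiable (by simp) x), map_smul]
  rfl

lemma edgeRestrict_sub_le (h : P.StarBall c r) (j : Fin P.n) : ∃ C : ℝ, ∀ {φ ψ : Plane → ℝ}
    (hφ : ContDiff ℝ ∞ φ) (hψ : ContDiff ℝ ∞ ψ),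
    dist (P.edgeRestrict φ hφ.continuous j) (P.edgeRestrict ψ hψ.continuous j) ≤
      C * (dist (P.toL2 φ hφ.continuous) (P.toL2 ψ hψ.continuous) +
        dist (P.toL2 (gradient φ) (continuous_gradient hφ))
          (P.toL2 (gradient ψ) (continuous_gradient hψ))) := by
  obtain ⟨C, hC⟩ := edgeRestrict_le h j
  refine ⟨C, fun {φ ψ} hφ hψ => ?_⟩
  have h1 := hC (hφ.sub hψ)
  simp only [gradient_sub hφ hψ] at h1
  rw [dist_eq_norm, dist_eq_norm, dist_eq_norm, ← toL2_sub, ← toL2_sub, ← edgeRestrict_sub]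
  exact h1

lemma exists_isTrace (h : P.StarBall c r) {v : P.L2} (hv : v ∈ P.H1) : ∃ τ, P.IsTrace v τ := by
  obtain ⟨φ, hφ, h1, h2⟩ := exists_tendsto_smooth h hv
  have hlim : ∀ j, ∃ τ, Tendsto (fun k => P.edgeRestrict (φ k) (hφ k).continuous j) atTop
      (𝓝 τ) := by
    intro j
    obtain ⟨C, hC⟩ := edgeRestrict_sub_le h j
    refine cauchySeq_tendsto_of_complete (cauchySeq_iff_tendsto_dist_atTop_0.2 ?_)
    have h3 := ((cauchySeq_iff_tendsto_dist_atTop_0.1 h1.cauchySeq).add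
      (cauchySeq_iff_tendsto_dist_atTop_0.1 h2.cauchySeq)).const_mul C
    rw [add_zero, mul_zero] at h3
    exact squeeze_zero (fun _ => dist_nonneg) (fun n => hC (hφ n.1) (hφ n.2)) h3
  choose τ hτ using hlim
  exact ⟨τ, isTrace_iff.2 ⟨φ, hφ, h1, h2, hτ⟩⟩

lemma IsTrace.unique (h : P.StarBall c r) {v : P.L2} {τ τ' : Fin P.n → EdgeL2}
    (hτ : P.IsTrace v τ) (hτ' : P.IsTrace v τ') : τ = τ' := by
  obtain ⟨φ, hφ, h1, h2, h3⟩ := isTrace_iff.1 hτ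
  obtain ⟨ψ, hψ, h1', h2', h3'⟩ := isTrace_iff.1 hτ'
  funext j
  obtain ⟨C, hC⟩ := edgeRestrict_sub_le h j
  refine dist_le_zero.1 ?_
  have h4 := ((h1.dist h1').add (h2.dist h2')).const_mul C
  simp only [dist_self, add_zero, mul_zero] at h4
  exact le_of_tendsto_of_tendsto' ((h3 j).dist (h3' j)) h4 fun k => hC (hφ k) (hψ k)

lemma trace_spec (h : P.StarBall c r) {v : P.L2} (hv : v ∈ P.H1) : P.IsTrace v (P.trace v) :=
  Classical.epsilon_spec (exists_isTrace h hv)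

lemma trace_eq (h : P.StarBall c r) {v : P.L2} {τ : Fin P.n → EdgeL2} (hτ : P.IsTrace v τ) :
    P.trace v = τ :=
  IsTrace.unique h (Classical.epsilon_spec (p := fun τ => P.IsTrace v τ) ⟨τ, hτ⟩) hτ

lemma trace_toL2 (h : P.StarBall c r) {φ : Plane → ℝ} (hφ : ContDiff ℝ ∞ φ) :
    P.trace (P.toL2 φ hφ.continuous) = P.edgeRestrict φ hφ.continuous :=
  trace_eq h (isTrace_iff.2 ⟨fun _ => φ, fun _ => hφ, tendsto_const_nhds,
    by rw [grad_toL2 hφ]; exact tendsto_const_nhds, fun _ => tendsto_const_nhds⟩)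

lemma trace_add (h : P.StarBall c r) {v w : P.L2} (hv : v ∈ P.H1) (hw : w ∈ P.H1) :
    P.trace (v + w) = P.trace v + P.trace w := by
  obtain ⟨φ, hφ, h1, h2, h3⟩ := isTrace_iff.1 (trace_spec h hv)
  obtain ⟨ψ, hψ, h1', h2', h3'⟩ := isTrace_iff.1 (trace_spec h hw)
  refine trace_eq h (isTrace_iff.2 ⟨fun k x => φ k x + ψ k x, fun k => (hφ k).add (hψ k), ?_, ?_,
    fun j => ?_⟩)
  · simp only [fun k => toL2_add (P := P) (hφ k).continuous (hψ k).continuous]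
    exact h1.add h1'
  · simp only [fun k => gradient_add (hφ k) (hψ k), grad_add hv hw,
      fun k => toL2_add (P := P) (continuous_gradient (hφ k)) (continuous_gradient (hψ k))]
    exact h2.add h2'
  · simp only [fun k => edgeRestrict_add (hφ k).continuous (hψ k).continuous j]
    exact (h3 j).add (h3' j)

lemma trace_smul (h : P.StarBall c r) (a : ℝ) {v : P.L2} (hv : v ∈ P.H1) :
    P.trace (a • v) = a • P.trace v := by
  obtain ⟨φ, hφ, h1, h2, h3⟩ := isTrace_iff.1 (trace_spec h hv)
  refine trace_eq h (isTrace_iff.2 ⟨fun k x => a • φ k x, fun k => (hφ k).const_smul a, ?_, ?_,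
    fun j => ?_⟩)
  · simp only [fun k => toL2_smul (P := P) a (hφ k).continuous]
    exact h1.const_smul a
  · simp only [fun k => gradient_smul a (hφ k), grad_smul a hv,
      fun k => toL2_smul (P := P) a (continuous_gradient (hφ k))]
    exact h2.const_smul a
  · simp only [fun k => edgeRestrict_smul a (hφ k).continuous j]
    exact (h3 j).const_smul a

/-- The constant function one on an edge. -/
def edgeOne : EdgeL2 := (memLp_edge (continuous_const (y := (1 : ℝ)))).toLp _

lemma inner_edgeOne (τ : EdgeL2) : inner ℝ edgeOne τ = ∫ t in Set.Icc (0 : ℝ) 1, τ t := by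
  rw [L2.inner_def]
  refine integral_congr_ae ?_
  filter_upwards [(memLp_edge (continuous_const (y := (1 : ℝ)))).coeFn_toLp] with t ht
  rw [edgeOne, ht]
  simp

lemma norm_edgeOne : ‖edgeOne‖ = 1 := by
  have : ‖edgeOne‖ ^ 2 = 1 := by
    have e : edgeOne =ᵐ[volume.restrict (Set.Icc (0 : ℝ) 1)] fun _ => 1 :=
      (memLp_edge (continuous_const (y := (1 : ℝ)))).coeFn_toLp
    rw [← real_inner_self_eq_norm_sq, inner_edgeOne, integral_congr_ae e]
    simp
  exact (pow_eq_one_iff_of_nonneg (norm_nonneg _) two_ne_zero).1 this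

lemma dof_eq_inner (v : P.L2) (j : Fin P.n) : P.dof v j = inner ℝ edgeOne (P.trace v j) := by
  rw [dof, edgeIntegral, inv_mul_cancel_left₀ (edgeLength_pos j).ne', inner_edgeOne]

lemma edgeIntegral_eq (v : P.L2) (j : Fin P.n) :
    P.edgeIntegral v j = P.edgeLength j * P.dof v j := by
  rw [dof, mul_inv_cancel_left₀ (edgeLength_pos j).ne']

lemma dof_add (h : P.StarBall c r) {v w : P.L2} (hv : v ∈ P.H1) (hw : w ∈ P.H1) (j : Fin P.n) :
    P.dof (v + w) j = P.dof v j + P.dof w j := by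
  simp only [dof_eq_inner, trace_add h hv hw, Pi.add_apply, inner_add_right]

lemma dof_smul (h : P.StarBall c r) (a : ℝ) {v : P.L2} (hv : v ∈ P.H1) (j : Fin P.n) :
    P.dof (a • v) j = a * P.dof v j := by
  simp only [dof_eq_inner, trace_smul h a hv, Pi.smul_apply, inner_smul_right]

lemma dof_sub (h : P.StarBall c r) {v w : P.L2} (hv : v ∈ P.H1) (hw : w ∈ P.H1) (j : Fin P.n) :
    P.dof (v - w) j = P.dof v j - P.dof w j := by
  have := dof_add h hv (smul_mem_H1 (-1) hw) j
  rw [dof_smul h _ hw] at this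
  rw [sub_eq_add_neg, ← neg_one_smul ℝ w, this]
  ring

lemma inner_edgeOne_edgeRestrict {f : Plane → ℝ} (hf : Continuous f) (j : Fin P.n) :
    inner ℝ edgeOne (P.edgeRestrict f hf j) = ∫ t in (0 : ℝ)..1, f (P.edgePoint j t) := by
  rw [inner_edgeOne, integral_congr_ae (coeFn_edgeRestrict hf j), integral_Icc_eq]

lemma dof_toL2 (h : P.StarBall c r) {φ : Plane → ℝ} (hφ : ContDiff ℝ ∞ φ) (j : Fin P.n) :
    P.dof (P.toL2 φ hφ.continuous) j = ∫ t in (0 : ℝ)..1, φ (P.edgePoint j t) := by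
  rw [dof_eq_inner, trace_toL2 h hφ, inner_edgeOne_edgeRestrict]

/-- Approximation of a function in `H¹(P)` by smooth functions, with convergence of the degrees of
freedom. -/
theorem exists_smooth_approx (h : P.StarBall c r) {v : P.L2} (hv : v ∈ P.H1) :
    ∃ (φ : ℕ → Plane → ℝ) (hφ : ∀ k, ContDiff ℝ ∞ (φ k)),
      Tendsto (fun k => P.toL2 (φ k) (hφ k).continuous) atTop (𝓝 v) ∧
      Tendsto (fun k => P.toL2 (gradient (φ k)) (continuous_gradient (hφ k))) atTop
        (𝓝 (P.grad v)) ∧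
      ∀ j, Tendsto (fun k => ∫ t in (0 : ℝ)..1, φ k (P.edgePoint j t)) atTop
        (𝓝 (P.dof v j)) := by
  obtain ⟨φ, hφ, h1, h2, h3⟩ := isTrace_iff.1 (trace_spec h hv)
  refine ⟨φ, hφ, h1, h2, fun j => ?_⟩
  simp only [← inner_edgeOne_edgeRestrict (hφ _).continuous j, dof_eq_inner]
  exact tendsto_const_nhds.inner (h3 j)

/-- The edge mean is an inner product with a unit vector, so the trace inequality bounds it for
smooth functions, and both sides pass to the limit. -/
lemma dof_sq_le (h : P.StarBall c r) {v : P.L2} (hv : v ∈ P.H1) (j : Fin P.n) :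
    |P.det c j| * P.dof v j ^ 2 ≤ 2 * ‖v‖ ^ 2 + 2 * P.h * (‖v‖ * ‖P.grad v‖) := by
  obtain ⟨φ, hφ, h1, h2, h3⟩ := exists_smooth_approx h hv
  refine le_of_tendsto_of_tendsto' (((h3 j).pow 2).const_mul _)
    (((h1.norm.pow 2).const_mul 2).add ((h1.norm.mul h2.norm).const_mul (2 * P.h))) fun k => ?_
  refine le_trans ?_ (edgeRestrict_sq_le h j (hφ k))
  refine mul_le_mul_of_nonneg_left ?_ (abs_nonneg _)
  rw [← inner_edgeOne_edgeRestrict (hφ k).continuous, ← sq_abs]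
  refine pow_le_pow_left₀ (abs_nonneg _) ?_ 2
  refine (abs_real_inner_le_norm _ _).trans ?_
  rw [norm_edgeOne, one_mul]

/-- Green's formula for functions in `H¹(P)` and constant vector fields. -/
theorem exists_green (h : P.StarBall c r) : ∃ g : Plane → Fin P.n → ℝ, ∀ v ∈ P.H1, ∀ e : Plane,
    inner ℝ (P.toL2 (fun _ => e) continuous_const) (P.grad v) =
      ∑ j, g e j * P.edgeIntegral v j := by
  obtain ⟨g, hg⟩ := exists_integral_fderiv_eq h
  refine ⟨fun e j => g e j * (P.edgeLength j)⁻¹, fun v hv e => ?_⟩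
  obtain ⟨φ, hφ, h1, h2, h3⟩ := exists_smooth_approx h hv
  refine tendsto_nhds_unique (tendsto_const_nhds.inner h2) ?_
  have h4 : Tendsto (fun k => ∑ j, g e j * ∫ t in (0 : ℝ)..1, φ k (P.edgePoint j t)) atTop
      (𝓝 (∑ j, g e j * P.dof v j)) := tendsto_finsetSum _ fun j _ => (h3 j).const_mul _
  have e1 : ∀ j, g e j * (P.edgeLength j)⁻¹ * P.edgeIntegral v j = g e j * P.dof v j :=
    fun j => by rw [dof, mul_assoc]
  simp only [e1]
  refine h4.congr fun k => ?_
  rw [← hg (φ k) (hφ k) e, inner_toL2]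
  refine integral_congr_ae ?_
  filter_upwards [coeFn_toL2 (P := P) (continuous_const (y := e))] with x hx
  rw [hx, real_inner_comm, inner_gradient]

end Polygon

/-! ### The Poincaré–Friedrichs inequality -/

namespace Polygon

variable {P : Polygon} {c : Plane} {r : ℝ}

/-- The area of the unit disc. -/
def discArea : ℝ := volume.real (Metric.ball (0 : Plane) 1)

lemma discArea_pos : 0 < discArea :=
  ENNReal.toReal_pos (Metric.measure_ball_pos volume _ one_pos).ne' measure_ball_lt_top.ne

lemma ofReal_discArea : ENNReal.ofReal discArea = volume (Metric.ball (0 : Plane) 1) :=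
  ENNReal.ofReal_toReal measure_ball_lt_top.ne

lemma volume_ball_eq (x : Plane) {s : ℝ} (hs : 0 ≤ s) :
    volume (Metric.ball x s) = ENNReal.ofReal (discArea * s ^ 2) := by
  rw [Measure.addHaar_ball _ _ hs, finrank_euclideanSpace, Fintype.card_fin, ← ofReal_discArea,
    ← ENNReal.ofReal_mul (by positivity), mul_comm]

lemma h_nonneg : 0 ≤ P.h := Metric.diam_nonneg

lemma volume_interior_le (h : P.StarBall c r) :
    volume (interior P.carrier) ≤ ENNReal.ofReal (discArea * P.h ^ 2) := by
  have h1 : interior P.carrier ⊆ Metric.closedBall c P.h := fun x hx => by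
    rw [Metric.mem_closedBall, dist_eq_norm]
    exact norm_sub_center_le h (interior_subset hx)
  refine (measure_mono h1).trans_eq ?_
  rw [Measure.addHaar_closedBall _ _ h_nonneg, finrank_euclideanSpace, Fintype.card_fin,
    ← ofReal_discArea, ← ENNReal.ofReal_mul (by have := h_nonneg (P := P); positivity), mul_comm]

lemma volume_ball_le (h : P.StarBall c r) :
    volume (Metric.ball c r) ≤ volume (interior P.carrier) :=
  measure_mono (ball_subset_interior_of_starConvex h.star carrier_nonempty)

/-- Fundamental theorem of calculus and Cauchy–Schwarz on the segment from `y` to `x`, which stays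
in the interior. The indicator allows later substitutions over the whole plane. -/
lemma enorm_sub_sq_le (h : P.StarBall c r) {φ : Plane → ℝ} (hφ : ContDiff ℝ ∞ φ)
    {x y : Plane} (hx : x ∈ interior P.carrier) (hy : y ∈ Metric.ball c r) :
    ‖φ x - φ y‖ₑ ^ 2 ≤ ENNReal.ofReal (P.h ^ 2) * ∫⁻ t in Set.Icc (0 : ℝ) 1,
      (interior P.carrier).indicator (fun z => ‖fderiv ℝ φ z‖ₑ ^ 2) ((1 - t) • y + t • x) := by
  have hφ' : Continuous (fderiv ℝ φ) := hφ.continuous_fderiv (by simp)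
  have hyU : y ∈ interior P.carrier :=
    ball_subset_interior_of_starConvex h.star carrier_nonempty hy
  have : IsProbabilityMeasure (volume.restrict (Set.Icc (0 : ℝ) 1)) := ⟨by simp⟩
  have hd : ∀ t : ℝ, HasDerivAt (fun t : ℝ => φ ((1 - t) • y + t • x))
      (fderiv ℝ φ ((1 - t) • y + t • x) (x - y)) t := by
    intro t
    have h1 : HasDerivAt (fun t : ℝ => (1 - t) • y + t • x) (x - y) t := by
      have := (((hasDerivAt_id t).const_sub 1).smul_const y).add ((hasDerivAt_id t).smul_const x)
      refine this.congr_deriv ?_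
      module
    exact ((hφ.differentiable (by simp)) _).hasFDerivAt.comp_hasDerivAt t h1
  have hftc : φ x - φ y = ∫ t in Set.Icc (0 : ℝ) 1, fderiv ℝ φ ((1 - t) • y + t • x) (x - y) := by
    rw [integral_Icc_eq, intervalIntegral.integral_eq_sub_of_hasDerivAt (fun t _ => hd t)]
    · simp
    · exact (by fun_prop : Continuous fun t : ℝ =>
        fderiv ℝ φ ((1 - t) • y + t • x) (x - y)).intervalIntegrable _ _
  rw [hftc]
  refine (enorm_integral_sq_le _ (by fun_prop : Continuous fun t : ℝ =>
    fderiv ℝ φ ((1 - t) • y + t • x) (x - y)).aestronglyMeasurable).trans ?_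
  rw [← lintegral_const_mul' _ _ ENNReal.ofReal_ne_top]
  refine setLIntegral_mono' measurableSet_Icc fun t ht => ?_
  have hz : (1 - t) • y + t • x ∈ interior P.carrier := by
    rcases ht.2.eq_or_lt with rfl | h1
    · simpa using hx
    · exact smul_add_smul_mem_interior h.star (interior_subset hx) hy ht.1 h1
  rw [Set.indicator_of_mem hz, mul_comm]
  have h2 : ‖fderiv ℝ φ ((1 - t) • y + t • x) (x - y)‖ₑ ≤
      ‖fderiv ℝ φ ((1 - t) • y + t • x)‖ₑ * ENNReal.ofReal P.h := by
    refine ((fderiv ℝ φ _).le_opENorm _).trans ?_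
    gcongr
    rw [← ofReal_norm, ← dist_eq_norm]
    exact ENNReal.ofReal_le_ofReal (dist_le_h (interior_subset hx) (interior_subset hyU))
  calc _ ≤ (‖fderiv ℝ φ ((1 - t) • y + t • x)‖ₑ * ENNReal.ofReal P.h) ^ 2 := by gcongr
    _ = _ := by rw [mul_pow, ENNReal.ofReal_pow h_nonneg]

/-- For `t ≤ 1/2` the substitution is made in `y`, with Jacobian factor `(1 - t)⁻²`, and for `t ≥
1/2` in `x`, with factor `t⁻²`. Both factors are at most four. -/
lemma lintegral_segment_le (h : P.StarBall c r) {F : Plane → ℝ≥0∞} (hF : Measurable F) :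
    ∫⁻ x in interior P.carrier, ∫⁻ y in Metric.ball c r, ∫⁻ t in Set.Icc (0 : ℝ) 1,
      F ((1 - t) • y + t • x) ≤ 4 * volume (interior P.carrier) * ∫⁻ z, F z := by
  have hm3 : Measurable fun p : Plane × Plane × ℝ => F ((1 - p.2.2) • p.2.1 + p.2.2 • p.1) :=
    hF.comp (by fun_prop)
  have hswap : ∫⁻ x in interior P.carrier, ∫⁻ y in Metric.ball c r, ∫⁻ t in Set.Icc (0 : ℝ) 1,
      F ((1 - t) • y + t • x) = ∫⁻ t in Set.Icc (0 : ℝ) 1, ∫⁻ x in interior P.carrier,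
        ∫⁻ y in Metric.ball c r, F ((1 - t) • y + t • x) := by
    have h1 : ∀ x, ∫⁻ y in Metric.ball c r, ∫⁻ t in Set.Icc (0 : ℝ) 1, F ((1 - t) • y + t • x) =
        ∫⁻ t in Set.Icc (0 : ℝ) 1, ∫⁻ y in Metric.ball c r, F ((1 - t) • y + t • x) := fun x =>
      lintegral_lintegral_swap (f := fun y t => F ((1 - t) • y + t • x))
        (hF.comp (by fun_prop)).aemeasurable
    simp only [h1]
    refine lintegral_lintegral_swap
      (f := fun x t => ∫⁻ y in Metric.ball c r, F ((1 - t) • y + t • x)) ?_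
    have : Measurable fun q : (Plane × ℝ) × Plane => F ((1 - q.1.2) • q.2 + q.1.2 • q.1.1) :=
      hF.comp (by fun_prop)
    exact this.lintegral_prod_right'.aemeasurable
  have hinv : ∀ s : ℝ, 1 / 2 ≤ s → ENNReal.ofReal (s ^ 2)⁻¹ ≤ 4 := by
    intro s hs
    rw [← ENNReal.ofReal_ofNat]
    apply ENNReal.ofReal_le_ofReal
    rw [inv_le_comm₀ (by positivity) (by norm_num)]
    nlinarith
  rw [hswap]
  have hb : ∀ t ∈ Set.Icc (0 : ℝ) 1, ∫⁻ x in interior P.carrier,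
      ∫⁻ y in Metric.ball c r, F ((1 - t) • y + t • x) ≤
        4 * volume (interior P.carrier) * ∫⁻ z, F z := by
    intro t ht
    rcases le_total t (1 / 2) with h1 | h1
    · calc _ ≤ ∫⁻ _ in interior P.carrier, 4 * ∫⁻ z, F z := by
            refine lintegral_mono fun x => ?_
            refine (setLIntegral_le_lintegral _ _).trans ?_
            rw [lintegral_comp_affine (by linarith) (t • x) F hF]
            gcongr
            exact hinv _ (by linarith)
        _ = _ := by rw [setLIntegral_const]; ring
    · rw [lintegral_lintegral_swap (f := fun x y => F ((1 - t) • y + t • x))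
        (hF.comp (by fun_prop)).aemeasurable]
      calc _ ≤ ∫⁻ _ in Metric.ball c r, 4 * ∫⁻ z, F z := by
            refine lintegral_mono fun y => ?_
            refine (setLIntegral_le_lintegral _ _).trans ?_
            simp only [add_comm ((1 - t) • y)]
            rw [lintegral_comp_affine (by linarith) ((1 - t) • y) F hF]
            gcongr
            exact hinv _ h1
        _ = 4 * volume (Metric.ball c r) * ∫⁻ z, F z := by rw [setLIntegral_const]; ring
        _ ≤ _ := by
          gcongr
          exact ball_subset_interior_of_starConvex h.star carrier_nonempty
  calc _ ≤ ∫⁻ _ in Set.Icc (0 : ℝ) 1, 4 * volume (interior P.carrier) * ∫⁻ z, F z :=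
        setLIntegral_mono' measurableSet_Icc hb
    _ = _ := by rw [setLIntegral_const]; simp

lemma enorm_toL2_sq {F : Type*} [NormedAddCommGroup F] {f : Plane → F} (hf : Continuous f) :
    ‖P.toL2 f hf‖ₑ ^ 2 = ∫⁻ x, ‖f x‖ₑ ^ 2 ∂P.μ := by
  rw [← eLpNorm_two_sq, Lp.enorm_def, eLpNorm_congr_ae (coeFn_toL2 hf)]

/-- The Poincaré inequality for smooth functions on a polygon that is star-shaped with respect to
a ball. -/
lemma exists_poincare_smooth (h : P.StarBall c r) {φ : Plane → ℝ} (hφ : ContDiff ℝ ∞ φ) :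
    ∃ m : ℝ, ‖P.toL2 (fun x => φ x - m) (hφ.continuous.sub continuous_const)‖ ≤
      2 * P.h ^ 2 / r * ‖P.toL2 (gradient φ) (continuous_gradient hφ)‖ := by
  have hr := h.pos
  have hh := h_nonneg (P := P)
  set B := Metric.ball c r with hB
  -- The constant `m` is the mean of `φ` over the ball, not over the polygon, so that every segment
  -- used has one endpoint in the ball.
  set ν : Measure Plane := (volume B)⁻¹ • volume.restrict B with hν
  have hB0 : volume B ≠ 0 := (Metric.measure_ball_pos volume _ hr).ne'
  have hBt : volume B ≠ ⊤ := measure_ball_lt_top.ne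
  have hprob : IsProbabilityMeasure ν := ⟨by
    rw [hν, Measure.smul_apply, Measure.restrict_apply_univ, smul_eq_mul,
      ENNReal.inv_mul_cancel hB0 hBt]⟩
  have hφc := hφ.continuous
  have hφ' : Continuous (fderiv ℝ φ) := hφ.continuous_fderiv (by simp)
  set F : Plane → ℝ≥0∞ := (interior P.carrier).indicator fun z => ‖fderiv ℝ φ z‖ₑ ^ 2 with hF
  have hFm : Measurable F :=
    (by fun_prop : Measurable fun z => ‖fderiv ℝ φ z‖ₑ ^ 2).indicator
      isOpen_interior.measurableSet
  have hFint : ∫⁻ z, F z = ‖P.toL2 (gradient φ) (continuous_gradient hφ)‖ₑ ^ 2 := by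
    rw [enorm_toL2_sq, hF, lintegral_indicator isOpen_interior.measurableSet]
    refine lintegral_congr fun x => ?_
    rw [← ofReal_norm, ← ofReal_norm, norm_gradient]
  have hint : Integrable φ ν :=
    (Integrable.smul_measure (μ := volume.restrict B)
      ((hφc.continuousOn.integrableOn_compact (isCompact_closedBall c r)).mono_set
        Metric.ball_subset_closedBall) (ENNReal.inv_ne_top.2 hB0))
  refine ⟨∫ y, φ y ∂ν, ?_⟩
  set m := ∫ y, φ y ∂ν
  have hpt : ∀ x, ‖φ x - m‖ₑ ^ 2 ≤ ∫⁻ y, ‖φ x - φ y‖ₑ ^ 2 ∂ν := by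
    intro x
    have e : φ x - m = ∫ y, (φ x - φ y) ∂ν := by
      rw [integral_sub (integrable_const _) hint]
      simp [m]
    rw [e]
    exact enorm_integral_sq_le ν
      (by fun_prop : Continuous fun y => φ x - φ y).aestronglyMeasurable
  have hmain : ‖P.toL2 (fun x => φ x - m) (hφ.continuous.sub continuous_const)‖ₑ ^ 2 ≤
      (volume B)⁻¹ * (ENNReal.ofReal (P.h ^ 2) *
        (4 * volume (interior P.carrier) * ∫⁻ z, F z)) := by
    rw [enorm_toL2_sq]
    calc ∫⁻ x, ‖φ x - m‖ₑ ^ 2 ∂P.μ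
        ≤ ∫⁻ x in interior P.carrier, (volume B)⁻¹ * (ENNReal.ofReal (P.h ^ 2) * ∫⁻ y in B,
            ∫⁻ t in Set.Icc (0 : ℝ) 1, F ((1 - t) • y + t • x)) := by
          refine setLIntegral_mono' isOpen_interior.measurableSet fun x hx => ?_
          refine (hpt x).trans ?_
          rw [hν, lintegral_smul_measure, smul_eq_mul]
          gcongr
          rw [← lintegral_const_mul' _ _ ENNReal.ofReal_ne_top]
          exact setLIntegral_mono' measurableSet_ball fun y hy => enorm_sub_sq_le h hφ hx hy
      _ ≤ _ := by
          rw [lintegral_const_mul' _ _ (ENNReal.inv_ne_top.2 hB0),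
            lintegral_const_mul' _ _ ENNReal.ofReal_ne_top]
          gcongr
          exact lintegral_segment_le h hFm
  have hfin : ‖P.toL2 (fun x => φ x - m) (hφ.continuous.sub continuous_const)‖ₑ ^ 2 ≤
      ENNReal.ofReal ((2 * P.h ^ 2 / r) ^ 2) * ∫⁻ z, F z := by
    refine hmain.trans ?_
    rw [← mul_assoc, ← mul_assoc]
    gcongr
    -- With `κ` the area of the unit disc, the factor is at most `(κ r²)⁻¹ · h² · 4 κ h² = (2 h² /
    -- r)²`.
    calc (volume B)⁻¹ * ENNReal.ofReal (P.h ^ 2) * (4 * volume (interior P.carrier))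
        ≤ (ENNReal.ofReal (discArea * r ^ 2))⁻¹ * ENNReal.ofReal (P.h ^ 2) *
            (ENNReal.ofReal 4 * ENNReal.ofReal (discArea * P.h ^ 2)) := by
          rw [hB, volume_ball_eq c hr.le]
          gcongr
          · simp
          · exact volume_interior_le h
      _ = _ := by
          have := discArea_pos
          rw [← ENNReal.ofReal_inv_of_pos (by positivity), ← ENNReal.ofReal_mul (by positivity),
            ← ENNReal.ofReal_mul (by positivity), ← ENNReal.ofReal_mul (by positivity)]
          congr 1
          field_simp
          ring
  rw [hFint, ← ofReal_norm, ← ofReal_norm, ← ENNReal.ofReal_pow (norm_nonneg _),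
    ← ENNReal.ofReal_pow (norm_nonneg _), ← ENNReal.ofReal_mul (by positivity),
    ENNReal.ofReal_le_ofReal_iff (by positivity), ← mul_pow] at hfin
  exact (pow_le_pow_iff_left₀ (norm_nonneg _) (by positivity) two_ne_zero).1 hfin

end Polygon

/-! ### Mesh-regular polygons and the Poincaré–Friedrichs inequality with constants depending only
on `ρ`. -/

namespace Polygon

/-- A polygon which is star-shaped with respect to a ball of radius `ρ h_P` and has edges of length
at least `ρ h_P`. -/
structure Regular (P : Polygon) (ρ : ℝ) (c : Plane) : Prop where
  pos : 0 < ρ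
  star : P.StarBall c (ρ * P.h)
  edge : ∀ j, ρ * P.h ≤ P.edgeLength j

variable {P : Polygon} {c : Plane} {ρ : ℝ}

lemma h_pos : 0 < P.h := by
  refine lt_of_lt_of_le ?_ (dist_le_h (node_mem (P := P) 0) (node_mem (finRotate P.n 0)))
  exact edgeLength_pos 0

lemma MeshRegular.exists_regular (hρ : 0 < ρ) (h : P.MeshRegular ρ) : ∃ c, P.Regular ρ c := by
  obtain ⟨⟨c, r, hr, hs⟩, he⟩ := h
  exact ⟨c, hρ, ⟨mul_pos hρ h_pos, fun y hy => hs y (Metric.ball_subset_ball hr hy)⟩, he⟩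

namespace Regular

lemma sq_le_abs_det (h : P.Regular ρ c) (j : Fin P.n) : (ρ * P.h) ^ 2 ≤ |P.det c j| := by
  refine le_trans ?_ (h.star.le_abs_det j)
  rw [sq]
  exact mul_le_mul_of_nonneg_left (h.edge j) h.star.pos.le

lemma measureReal_le (h : P.Regular ρ c) : P.μ.real Set.univ ≤ discArea * P.h ^ 2 := by
  have := discArea_pos
  rw [measureReal_def, Measure.restrict_apply_univ]
  exact ENNReal.toReal_le_of_le_ofReal (by positivity) (volume_interior_le h.star)

lemma sqrt_measure_le (h : P.Regular ρ c) :
    P.μ.real Set.univ ^ (1 / 2 : ℝ) ≤ √discArea * P.h := by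
  have := discArea_pos
  rw [← Real.sqrt_eq_rpow]
  refine (Real.sqrt_le_sqrt h.measureReal_le).trans_eq ?_
  rw [Real.sqrt_mul discArea_pos.le, Real.sqrt_sq h_nonneg]

lemma norm_const_le (h : P.Regular ρ c) {F : Type*} [NormedAddCommGroup F] (a : F) :
    ‖P.toL2 (fun _ => a) continuous_const‖ ≤ √discArea * P.h * ‖a‖ :=
  (norm_toL2_le continuous_const (norm_nonneg a) fun _ _ => le_rfl).trans
    (mul_le_mul_of_nonneg_right h.sqrt_measure_le (norm_nonneg a))

end Regular

/-- The constant of the Poincaré–Friedrichs inequality. -/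
def constPF (ρ : ℝ) : ℝ := 2 / ρ + √discArea * √(8 / ρ ^ 4 + 4 / ρ ^ 3)

lemma constPF_pos (hρ : 0 < ρ) : 0 < constPF ρ := by unfold constPF; positivity

namespace Regular

/-- The Poincaré inequality controls `φ - m`, the trace inequality then controls the distance of `m`
to any convex combination of edge means, and the constant `m` is estimated by its modulus. The
combination stays on the right since smooth approximations satisfy the constraint only in the limit.
-/
lemma norm_le_smooth (h : P.Regular ρ c) {φ : Plane → ℝ} (hφ : ContDiff ℝ ∞ φ)
    {w : Fin P.n → ℝ} (hw : ∀ j, 0 ≤ w j) (hw1 : ∑ j, w j = 1) :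
    ‖P.toL2 φ hφ.continuous‖ ≤
      P.h * (constPF ρ * ‖P.toL2 (gradient φ) (continuous_gradient hφ)‖ +
        √discArea * |∑ j, w j * ∫ t in (0 : ℝ)..1, φ (P.edgePoint j t)|) := by
  have hρ := h.pos
  have hh := h_pos (P := P)
  obtain ⟨m, hm⟩ := exists_poincare_smooth h.star hφ
  set G := ‖P.toL2 (gradient φ) (continuous_gradient hφ)‖ with hG
  have hG0 : 0 ≤ G := norm_nonneg _
  have hφm : ContDiff ℝ ∞ fun x => φ x - m := hφ.sub contDiff_const
  set a := ‖P.toL2 (fun x => φ x - m) hφm.continuous‖ with ha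
  have ha0 : 0 ≤ a := norm_nonneg _
  have ha1 : a ≤ 2 * P.h / ρ * G := by
    refine hm.trans_eq ?_
    field_simp
  have hgm : gradient (fun x => φ x - m) = gradient φ := by
    funext x
    rw [gradient, fderiv_sub_const, ← gradient]
  -- From the trace inequality with `|det| ≥ (ρ h)²` and `‖φ - m‖ ≤ (2 h / ρ) G`: the squared edge
  -- mean is at most `(ρ h)⁻² (8 h² / ρ² + 4 h² / ρ) G²`.
  set A := √(8 / ρ ^ 4 + 4 / ρ ^ 3) with hA
  have hA2 : A ^ 2 = 8 / ρ ^ 4 + 4 / ρ ^ 3 := Real.sq_sqrt (by positivity)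
  have hA0 : 0 ≤ A := Real.sqrt_nonneg _
  have hdof : ∀ j, |(∫ t in (0 : ℝ)..1, φ (P.edgePoint j t)) - m| ≤ A * G := by
    intro j
    have h1 := dof_sq_le h.star (toL2_mem_H1 (P := P) hφm) j
    rw [dof_toL2 h.star hφm, grad_toL2 hφm] at h1
    simp only [hgm] at h1
    have hsub : ∫ t in (0 : ℝ)..1, (φ (P.edgePoint j t) - m) =
        (∫ t in (0 : ℝ)..1, φ (P.edgePoint j t)) - m := by
      rw [intervalIntegral.integral_sub (f := fun t => φ (P.edgePoint j t))
        ((hφ.continuous.comp (continuous_edgePoint j)).intervalIntegrable _ _)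
        intervalIntegrable_const, intervalIntegral.integral_const, sub_zero, one_smul]
    rw [← hG, ← ha, hsub] at h1
    have h2 : (ρ * P.h) ^ 2 * ((∫ t in (0 : ℝ)..1, φ (P.edgePoint j t)) - m) ^ 2 ≤
        2 * (2 * P.h / ρ * G) ^ 2 + 2 * P.h * (2 * P.h / ρ * G * G) := by
      refine (mul_le_mul_of_nonneg_right (h.sq_le_abs_det j) (sq_nonneg _)).trans (h1.trans ?_)
      gcongr
    have h3 : ((∫ t in (0 : ℝ)..1, φ (P.edgePoint j t)) - m) ^ 2 ≤ (A * G) ^ 2 := by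
      rw [mul_comm, ← le_div_iff₀ (by positivity)] at h2
      refine h2.trans_eq ?_
      rw [mul_pow A G, hA2]
      field_simp
      ring
    exact abs_le_of_sq_le_sq h3 (by positivity)
  set s := ∑ j, w j * ∫ t in (0 : ℝ)..1, φ (P.edgePoint j t) with hs
  have hsm : |s - m| ≤ A * G := by
    have e : s - m = ∑ j, w j * ((∫ t in (0 : ℝ)..1, φ (P.edgePoint j t)) - m) := by
      simp only [mul_sub, Finset.sum_sub_distrib]
      rw [← Finset.sum_mul, hw1, one_mul]
    rw [e]
    calc _ ≤ ∑ j, w j * (A * G) := by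
          refine (Finset.abs_sum_le_sum_abs _ _).trans (Finset.sum_le_sum fun j _ => ?_)
          rw [abs_mul, abs_of_nonneg (hw j)]
          exact mul_le_mul_of_nonneg_left (hdof j) (hw j)
      _ = A * G := by rw [← Finset.sum_mul, hw1, one_mul]
  have hm1 : |m| ≤ A * G + |s| := by
    calc |m| = |s - (s - m)| := by rw [sub_sub_cancel]
      _ ≤ |s| + |s - m| := abs_sub _ _
      _ ≤ _ := by linarith
  have hsplit : P.toL2 φ hφ.continuous = P.toL2 (fun x => φ x - m) hφm.continuous +
      P.toL2 (fun _ => m) continuous_const := by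
    rw [← toL2_add]
    simp only [sub_add_cancel]
  rw [hsplit]
  refine (norm_add_le _ _).trans ?_
  have h5 := h.norm_const_le m
  rw [Real.norm_eq_abs] at h5
  calc _ ≤ 2 * P.h / ρ * G + √discArea * P.h * (A * G + |s|) :=
        add_le_add ha1 (h5.trans (by gcongr))
    _ = _ := by rw [constPF, ← hA]; ring

/-- The Poincaré–Friedrichs inequality. -/
theorem norm_le (h : P.Regular ρ c) {v : P.L2} (hv : v ∈ P.H1) {w : Fin P.n → ℝ}
    (hw : ∀ j, 0 ≤ w j) (hw1 : ∑ j, w j = 1) (h0 : ∑ j, w j * P.dof v j = 0) :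
    ‖v‖ ≤ constPF ρ * P.h * ‖P.grad v‖ := by
  obtain ⟨φ, hφ, h1, h2, h3⟩ := exists_smooth_approx h.star hv
  have h4 : Tendsto (fun k => ∑ j, w j * ∫ t in (0 : ℝ)..1, φ k (P.edgePoint j t)) atTop
      (𝓝 (∑ j, w j * P.dof v j)) := tendsto_finsetSum _ fun j _ => (h3 j).const_mul _
  have h5 := le_of_tendsto_of_tendsto' h1.norm
    (((h2.norm.const_mul (constPF ρ)).add (h4.abs.const_mul (√discArea))).const_mul P.h)
    fun k => h.norm_le_smooth (hφ k) hw hw1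
  rw [h0, abs_zero, mul_zero, add_zero] at h5
  linarith

/-- The Poincaré–Friedrichs inequality for functions with vanishing integral over a set of
edges. -/
theorem norm_le_of_sum_edgeIntegral (h : P.Regular ρ c) {v : P.L2} (hv : v ∈ P.H1)
    {J : Finset (Fin P.n)} (hJ : J.Nonempty) (h0 : ∑ j ∈ J, P.edgeIntegral v j = 0) :
    ‖v‖ ≤ constPF ρ * P.h * P.semi1 v := by
  classical
  set L := ∑ j ∈ J, P.edgeLength j with hL
  have hLpos : 0 < L := Finset.sum_pos (fun j _ => edgeLength_pos j) hJ
  -- Length-proportional weights on `J` turn the sum of edge integrals into a convex combination of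
  -- edge means.
  refine h.norm_le hv (w := fun j => if j ∈ J then P.edgeLength j / L else 0) (fun j => ?_) ?_ ?_
  · split_ifs
    · exact div_nonneg (edgeLength_pos j).le hLpos.le
    · exact le_rfl
  · rw [Finset.sum_ite_mem, Finset.univ_inter, ← Finset.sum_div, div_self hLpos.ne']
  · simp only [ite_mul, zero_mul]
    rw [Finset.sum_ite_mem, Finset.univ_inter]
    simp only [edgeIntegral_eq] at h0
    simp only [div_mul_eq_mul_div]
    rw [← Finset.sum_div, h0, zero_div]

lemma norm_le_of_dof_eq_zero (h : P.Regular ρ c) {v : P.L2} (hv : v ∈ P.H1) {j : Fin P.n}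
    (h0 : P.dof v j = 0) : ‖v‖ ≤ constPF ρ * P.h * ‖P.grad v‖ :=
  h.norm_le_of_sum_edgeIntegral hv (Finset.singleton_nonempty j)
    (by rw [Finset.sum_singleton, edgeIntegral_eq, h0, mul_zero])

end Regular

end Polygon

/-! ### Affine functions -/

lemma norm_sub_starProjection_le {E : Type*} [NormedAddCommGroup E] [InnerProductSpace ℝ E]
    (U : Submodule ℝ E) [U.HasOrthogonalProjection] (x : E) {y : E} (hy : y ∈ U) :
    ‖x - U.starProjection x‖ ≤ ‖x - y‖ := by
  rw [Submodule.starProjection_minimal]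
  exact ciInf_le ⟨0, by rintro _ ⟨z, rfl⟩; exact norm_nonneg _⟩ (⟨y, hy⟩ : U)

namespace Polygon

variable {P : Polygon} {c : Plane} {ρ r : ℝ}

/-- The affine function `x ↦ a + b · x`. -/
def affineFun (p : ℝ × Plane) (x : Plane) : ℝ := p.1 + inner ℝ p.2 x

lemma contDiff_affineFun (p : ℝ × Plane) : ContDiff ℝ ∞ (affineFun p) :=
  contDiff_const.add (contDiff_const.inner ℝ contDiff_id)

lemma gradient_affineFun (p : ℝ × Plane) : gradient (affineFun p) = fun _ => p.2 := by
  funext x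
  refine ext_inner_right ℝ fun e => ?_
  rw [inner_gradient]
  have : HasFDerivAt (affineFun p) (innerSL ℝ p.2) x :=
    ((innerSL ℝ p.2).hasFDerivAt).const_add p.1
  rw [this.fderiv]
  simp

lemma affine_eq_toL2 (p : ℝ × Plane) :
    P.affine p = P.toL2 (affineFun p) (contDiff_affineFun p).continuous := rfl

lemma affine_mem_P1 (p : ℝ × Plane) : P.affine p ∈ P.P1 := LinearMap.mem_range_self _ p

lemma affine_mem_H1 (p : ℝ × Plane) : P.affine p ∈ P.H1 := toL2_mem_H1 (contDiff_affineFun p)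

lemma P1_le_H1 {q : P.L2} (hq : q ∈ P.P1) : q ∈ P.H1 := by
  obtain ⟨p, rfl⟩ := hq
  exact affine_mem_H1 p

variable (P) in
/-- The constant vector field. -/
def constField (b : Plane) : P.L2v := P.toL2 (fun _ => b) continuous_const

lemma grad_affine (p : ℝ × Plane) : P.grad (P.affine p) = P.constField p.2 := by
  rw [affine_eq_toL2, grad_toL2 (contDiff_affineFun p)]
  simp only [gradient_affineFun]
  rfl

lemma mem_P0v {G : P.L2v} : G ∈ P.P0v ↔ ∃ b, P.constField b = G := Iff.rfl

lemma constField_mem (b : Plane) : P.constField b ∈ P.P0v := mem_P0v.2 ⟨b, rfl⟩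

lemma exists_Pi0v_eq (G : P.L2v) : ∃ b, P.Pi0v G = P.constField b := by
  obtain ⟨b, hb⟩ := mem_P0v.1 (P.P0v.starProjection_apply_mem G)
  exact ⟨b, hb.symm⟩

lemma inner_sub_Pi0v (G : P.L2v) (b : Plane) : inner ℝ (G - P.Pi0v G) (P.constField b) = 0 :=
  P.P0v.starProjection_inner_eq_zero _ _ (constField_mem b)

lemma norm_sub_Pi0v_le (G : P.L2v) (b : Plane) : ‖G - P.Pi0v G‖ ≤ ‖G - P.constField b‖ :=
  norm_sub_starProjection_le P.P0v G (constField_mem b)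

lemma norm_sub_Pi0v_le_norm (G : P.L2v) : ‖G - P.Pi0v G‖ ≤ ‖G‖ := by
  have := norm_sub_starProjection_le P.P0v G P.P0v.zero_mem
  rwa [sub_zero] at this

lemma dof_affine_const (h : P.StarBall c r) (a : ℝ) (j : Fin P.n) :
    P.dof (P.affine (a, 0)) j = a := by
  rw [affine_eq_toL2, dof_toL2 h (contDiff_affineFun _)]
  simp [affineFun]

/-- A size of an affine function that is comparable with its norms. -/
def affineSize (c : Plane) (s : ℝ) (p : ℝ × Plane) : ℝ := |affineFun p c| + ‖p.2‖ * s

lemma affineFun_eq (c : Plane) (p : ℝ × Plane) (x : Plane) :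
    affineFun p x = affineFun p c + inner ℝ p.2 (x - c) := by
  simp only [affineFun, inner_sub_right]; ring

/-- Moving the centre by `2 s` along the gradient, in the direction in which the modulus grows, adds
`2 s ‖p.2‖`; on a ball of radius `s` at most half of this gain is lost. -/
lemma exists_ball_le_affineFun (c : Plane) {s : ℝ} (hs : 0 ≤ s) (p : ℝ × Plane) :
    ∃ y : Plane, dist y c ≤ 2 * s ∧ ∀ x ∈ Metric.ball y s, affineSize c s p ≤ |affineFun p x| := by
  obtain ⟨σ, hσ, hσα⟩ : ∃ σ : ℝ, |σ| = 1 ∧ σ * affineFun p c = |affineFun p c| := by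
    rcases le_total 0 (affineFun p c) with h | h
    · exact ⟨1, abs_one, by rw [one_mul, abs_of_nonneg h]⟩
    · exact ⟨-1, by rw [abs_neg, abs_one], by rw [neg_one_mul, abs_of_nonpos h]⟩
  have hσ2 : σ * σ = 1 := by rw [← abs_mul_abs_self, hσ, one_mul]
  -- Only an inequality, because for a vanishing gradient the inverse is zero and the centre does
  -- not move.
  have hb : ‖p.2‖⁻¹ * ‖p.2‖ ≤ 1 := inv_mul_le_one
  have hb2 : ‖p.2‖⁻¹ * (‖p.2‖ * ‖p.2‖) = ‖p.2‖ := by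
    rcases eq_or_ne ‖p.2‖ 0 with h0 | h0
    · simp [h0]
    · field_simp
  refine ⟨c + (σ * (2 * s) * ‖p.2‖⁻¹) • p.2, ?_, fun x hx => ?_⟩
  · rw [dist_eq_norm, add_sub_cancel_left, norm_smul, Real.norm_eq_abs, abs_mul, abs_mul, hσ,
      abs_of_nonneg (by positivity), abs_of_nonneg (by positivity)]
    calc _ = 2 * s * (‖p.2‖⁻¹ * ‖p.2‖) := by ring
      _ ≤ 2 * s * 1 := by gcongr
      _ = _ := mul_one _
  · set y := c + (σ * (2 * s) * ‖p.2‖⁻¹) • p.2 with hy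
    have h1 : inner ℝ p.2 (x - c) = inner ℝ p.2 (x - y) + σ * (2 * s) * ‖p.2‖ := by
      have : x - c = (x - y) + (σ * (2 * s) * ‖p.2‖⁻¹) • p.2 := by rw [hy]; abel
      rw [this, inner_add_right, real_inner_smul_right, real_inner_self_eq_norm_mul_norm,
        mul_assoc _ ‖p.2‖⁻¹, hb2]
    have h2 : |inner ℝ p.2 (x - y)| ≤ ‖p.2‖ * s := by
      refine (abs_real_inner_le_norm _ _).trans ?_
      refine mul_le_mul_of_nonneg_left ?_ (norm_nonneg _)
      rw [← dist_eq_norm]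
      exact (Metric.mem_ball.1 hx).le
    have h3 : σ * affineFun p x = |affineFun p c| + σ * inner ℝ p.2 (x - y) + 2 * s * ‖p.2‖ := by
      rw [affineFun_eq c p x, h1, mul_add, hσα]
      linear_combination (2 * s * ‖p.2‖) * hσ2
    have h4 : |σ * inner ℝ p.2 (x - y)| ≤ ‖p.2‖ * s := by rw [abs_mul, hσ, one_mul]; exact h2
    have h5 : |affineFun p x| = |σ * affineFun p x| := by rw [abs_mul, hσ, one_mul]
    rw [h5, h3, affineSize]
    refine le_trans ?_ (le_abs_self _)
    linarith [neg_abs_le (σ * inner ℝ p.2 (x - y))]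

namespace Regular

lemma affineSize_nonneg (h : P.Regular ρ c) (p : ℝ × Plane) :
    0 ≤ affineSize c (ρ * P.h / 4) p := by
  have := h.star.pos
  unfold affineSize; positivity

lemma abs_affineFun_le (h : P.Regular ρ c) (p : ℝ × Plane) {x : Plane} (hx : x ∈ P.carrier) :
    |affineFun p x| ≤ (1 + 4 / ρ) * affineSize c (ρ * P.h / 4) p := by
  have hρ := h.pos
  have hh := h_pos (P := P)
  have h1 : |inner ℝ p.2 (x - c)| ≤ ‖p.2‖ * P.h :=
    (abs_real_inner_le_norm _ _).trans
      (mul_le_mul_of_nonneg_left (norm_sub_center_le h.star hx) (norm_nonneg _))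
  have h2 : |affineFun p x| ≤ |affineFun p c| + ‖p.2‖ * P.h := by
    rw [affineFun_eq c p x]
    exact (abs_add_le _ _).trans (by linarith)
  refine h2.trans ?_
  have e : (1 + 4 / ρ) * affineSize c (ρ * P.h / 4) p = |affineFun p c| + ‖p.2‖ * P.h +
      (4 / ρ * |affineFun p c| + ‖p.2‖ * (ρ * P.h / 4)) := by
    unfold affineSize; field_simp; ring
  rw [e]
  have : 0 ≤ 4 / ρ * |affineFun p c| + ‖p.2‖ * (ρ * P.h / 4) := by positivity
  linarith

lemma norm_affine_le (h : P.Regular ρ c) (p : ℝ × Plane) :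
    ‖P.affine p‖ ≤ √discArea * P.h * ((1 + 4 / ρ) * affineSize c (ρ * P.h / 4) p) := by
  have hρ := h.pos
  have hs := h.affineSize_nonneg p
  have hn : 0 ≤ (1 + 4 / ρ) * affineSize c (ρ * P.h / 4) p := by positivity
  refine (norm_toL2_le (contDiff_affineFun p).continuous hn
    fun x hx => h.abs_affineFun_le p (interior_subset hx)).trans ?_
  exact mul_le_mul_of_nonneg_right h.sqrt_measure_le hn

/-- The radius `ρ h / 4` plus the shift `ρ h / 2` fits into three quarters of the star ball, the
region where the later cut-off equals one. -/
lemma exists_ball_affine (h : P.Regular ρ c) (p : ℝ × Plane) :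
    ∃ y : Plane, Metric.ball y (ρ * P.h / 4) ⊆ Metric.closedBall c (3 / 4 * (ρ * P.h)) ∧
      Metric.ball y (ρ * P.h / 4) ⊆ interior P.carrier ∧
      ∀ x ∈ Metric.ball y (ρ * P.h / 4), affineSize c (ρ * P.h / 4) p ≤ |affineFun p x| := by
  have hr := h.star.pos
  obtain ⟨y, hy, hx⟩ := exists_ball_le_affineFun c (s := ρ * P.h / 4) (by positivity) p
  have hsub : Metric.ball y (ρ * P.h / 4) ⊆ Metric.closedBall c (3 / 4 * (ρ * P.h)) :=
    Metric.ball_subset_closedBall.trans (Metric.closedBall_subset_closedBall' (by linarith))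
  exact ⟨y, hsub, (hsub.trans (Metric.closedBall_subset_ball (by linarith))).trans
    (ball_subset_interior_of_starConvex h.star.star carrier_nonempty), hx⟩

/-- Lower bound for weighted integrals of the square of an affine function. -/
lemma le_integral_affineFun (h : P.Regular ρ c) (p : ℝ × Plane) {β : Plane → ℝ}
    (hβ : Continuous β) (h0 : ∀ x, 0 ≤ β x)
    (h1 : ∀ x ∈ Metric.closedBall c (3 / 4 * (ρ * P.h)), β x = 1) :
    discArea * (ρ * P.h / 4) ^ 2 * affineSize c (ρ * P.h / 4) p ^ 2 ≤
      ∫ x, β x * affineFun p x ^ 2 ∂P.μ := by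
  have hr := h.star.pos
  have hs := h.affineSize_nonneg p
  obtain ⟨y, hsub, hint, hx⟩ := h.exists_ball_affine p
  have hcont : Continuous fun x => β x * affineFun p x ^ 2 :=
    hβ.mul ((contDiff_affineFun p).continuous.pow 2)
  have hio := integrable_of_continuous (P := P) hcont
  calc discArea * (ρ * P.h / 4) ^ 2 * affineSize c (ρ * P.h / 4) p ^ 2
      = ∫ _ in Metric.ball y (ρ * P.h / 4), affineSize c (ρ * P.h / 4) p ^ 2 := by
        rw [setIntegral_const, measureReal_def, volume_ball_eq y (by positivity),
          ENNReal.toReal_ofReal (by have := discArea_pos; positivity), smul_eq_mul]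
    _ ≤ ∫ x in Metric.ball y (ρ * P.h / 4), β x * affineFun p x ^ 2 := by
        refine setIntegral_mono_on (integrableOn_const measure_ball_lt_top.ne)
          (IntegrableOn.mono_set hio hint) measurableSet_ball fun x hxB => ?_
        rw [h1 x (hsub hxB), one_mul, ← sq_abs (affineFun p x)]
        exact pow_le_pow_left₀ hs (hx x hxB) 2
    _ ≤ _ := setIntegral_mono_set hio
        (Eventually.of_forall fun x => mul_nonneg (h0 x) (sq_nonneg _))
        (LE.le.eventuallyLE hint)

lemma affineSize_le (h : P.Regular ρ c) (p : ℝ × Plane) :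
    √discArea * (ρ * P.h / 4) * affineSize c (ρ * P.h / 4) p ≤ ‖P.affine p‖ := by
  have hr := h.star.pos
  have hs := h.affineSize_nonneg p
  have h1 := h.le_integral_affineFun p (β := fun _ => 1) continuous_const
    (fun _ => zero_le_one) (fun _ _ => rfl)
  have h2 : ∫ x, 1 * affineFun p x ^ 2 ∂P.μ = ‖P.affine p‖ ^ 2 := by
    rw [affine_eq_toL2, norm_sq_toL2]
    simp
  rw [h2] at h1
  refine (pow_le_pow_iff_left₀ (by positivity) (norm_nonneg _) two_ne_zero).1 ?_
  rw [mul_pow, mul_pow, Real.sq_sqrt discArea_pos.le]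
  exact h1

/-- The inverse estimate for affine functions. -/
lemma norm_grad_affine_le (h : P.Regular ρ c) {q : P.L2} (hq : q ∈ P.P1) :
    P.h * ‖P.grad q‖ ≤ 16 / ρ ^ 2 * ‖q‖ := by
  have hρ := h.pos
  have hh := h_pos (P := P)
  obtain ⟨p, rfl⟩ := hq
  change P.h * ‖P.grad (P.affine p)‖ ≤ 16 / ρ ^ 2 * ‖P.affine p‖
  rw [grad_affine]
  have h1 := h.norm_const_le p.2
  have h2 := h.affineSize_le p
  have h3 : ‖p.2‖ * (ρ * P.h / 4) ≤ affineSize c (ρ * P.h / 4) p :=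
    le_add_of_nonneg_left (abs_nonneg _)
  calc P.h * ‖P.constField p.2‖ ≤ P.h * (√discArea * P.h * ‖p.2‖) := by gcongr; exact h1
    _ = 16 / ρ ^ 2 * (√discArea * (ρ * P.h / 4) * (‖p.2‖ * (ρ * P.h / 4))) := by
        field_simp; ring
    _ ≤ 16 / ρ ^ 2 * (√discArea * (ρ * P.h / 4) * affineSize c (ρ * P.h / 4) p) := by gcongr
    _ ≤ _ := by gcongr

/-- The error of the projection onto affine functions is controlled by the deviation of the gradient
from its mean. -/
lemma norm_sub_Pi1_le (h : P.Regular ρ c) {f : P.L2} (hf : f ∈ P.H1) :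
    ‖f - P.Pi1 f‖ + P.h * P.semi1 (f - P.Pi1 f) ≤
      (constPF ρ + 1 + 32 / ρ ^ 2 * constPF ρ) * P.h * ‖P.grad f - P.Pi0v (P.grad f)‖ := by
  have hρ := h.pos
  have hh := h_pos (P := P)
  have hC := constPF_pos hρ
  obtain ⟨b, hb⟩ := exists_Pi0v_eq (P.grad f)
  -- The comparison function has the mean gradient as slope and a constant chosen so that the mean
  -- of the difference over edge `0` vanishes. Its distance to `Π₁ f` is affine, so the inverse
  -- estimate bounds the gradient of the latter.
  set a := P.dof (f - P.affine (0, b)) 0 with ha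
  have hp : P.affine (a, b) = P.affine (a, 0) + P.affine (0, b) := by
    rw [← map_add]; simp
  have hfp : f - P.affine (a, b) ∈ P.H1 := sub_mem_H1 hf (affine_mem_H1 _)
  have hdof : P.dof (f - P.affine (a, b)) 0 = 0 := by
    rw [hp, add_comm, ← sub_sub, dof_sub h.star (sub_mem_H1 hf (affine_mem_H1 _))
      (affine_mem_H1 _), dof_affine_const h.star, ← ha, sub_self]
  have hgrad : P.grad (f - P.affine (a, b)) = P.grad f - P.Pi0v (P.grad f) := by
    rw [grad_sub hf (affine_mem_H1 _), grad_affine, hb]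
  have h1 := h.norm_le_of_dof_eq_zero hfp hdof
  rw [hgrad] at h1
  set δ := ‖P.grad f - P.Pi0v (P.grad f)‖ with hδ
  have h2 : ‖f - P.Pi1 f‖ ≤ ‖f - P.affine (a, b)‖ :=
    norm_sub_starProjection_le P.P1 f (affine_mem_P1 _)
  have hPi : P.Pi1 f ∈ P.P1 := P.P1.starProjection_apply_mem f
  have hq : P.affine (a, b) - P.Pi1 f ∈ P.P1 := P.P1.sub_mem (affine_mem_P1 _) hPi
  have h3 : ‖P.affine (a, b) - P.Pi1 f‖ ≤ 2 * ‖f - P.affine (a, b)‖ := by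
    have e : P.affine (a, b) - P.Pi1 f = (f - P.Pi1 f) - (f - P.affine (a, b)) := by abel
    rw [e]
    exact (norm_sub_le _ _).trans (by linarith)
  have h4 := h.norm_grad_affine_le hq
  have h5 : P.h * P.semi1 (f - P.Pi1 f) ≤ P.h * δ + 16 / ρ ^ 2 * (2 * ‖f - P.affine (a, b)‖) := by
    have e : f - P.Pi1 f = (f - P.affine (a, b)) + (P.affine (a, b) - P.Pi1 f) := by abel
    rw [semi1, e, grad_add hfp (P1_le_H1 hq), hgrad]
    calc _ ≤ P.h * (δ + ‖P.grad (P.affine (a, b) - P.Pi1 f)‖) := by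
          gcongr; exact norm_add_le _ _
      _ ≤ P.h * δ + 16 / ρ ^ 2 * ‖P.affine (a, b) - P.Pi1 f‖ := by rw [mul_add]; gcongr
      _ ≤ _ := by gcongr
  calc _ ≤ constPF ρ * P.h * δ + (P.h * δ + 16 / ρ ^ 2 * (2 * (constPF ρ * P.h * δ))) := by
        refine add_le_add (h2.trans h1) (h5.trans ?_)
        gcongr
    _ = _ := by ring

end Regular

end Polygon

/-! ### Approximation by affine functions -/

namespace Polygon

variable {P : Polygon} {c : Plane} {ρ r : ℝ}

lemma enorm_sq_eq {F : Type*} [NormedAddCommGroup F] (v : Lp F 2 P.μ) :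
    ‖v‖ₑ ^ 2 = ∫⁻ x, ‖v x‖ₑ ^ 2 ∂P.μ := by
  rw [← eLpNorm_two_sq, Lp.enorm_def]

lemma ae_mem_interior : ∀ᵐ x ∂P.μ, x ∈ interior P.carrier :=
  ae_restrict_mem isOpen_interior.measurableSet

lemma le_sq_mul_of_enorm_sq_le {F : Type*} [NormedAddCommGroup F] {v : F} {X : ℝ} (hX : 0 ≤ X)
    {I : ℝ≥0∞} (h : ‖v‖ₑ ^ 2 ≤ ENNReal.ofReal (X ^ 2) * I) :
    ‖v‖ₑ ≤ ENNReal.ofReal X * I ^ (1 / 2 : ℝ) := by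
  have e : I = (I ^ (1 / 2 : ℝ)) ^ 2 := by
    rw [← ENNReal.rpow_natCast, ← ENNReal.rpow_mul]; norm_num
  rw [e, ENNReal.ofReal_pow hX, ← mul_pow] at h
  exact (ENNReal.pow_le_pow_left_iff two_ne_zero).1 h

lemma le_mul_toReal {F : Type*} [NormedAddCommGroup F] {v : F} {X : ℝ} (hX : 0 ≤ X)
    {S : ℝ≥0∞} (hS : S ≠ ⊤) (h : ‖v‖ₑ ≤ ENNReal.ofReal X * S) : ‖v‖ ≤ X * S.toReal := by
  have h1 := ENNReal.toReal_mono (ENNReal.mul_ne_top ENNReal.ofReal_ne_top hS) h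
  rwa [toReal_enorm, ENNReal.toReal_mul, ENNReal.toReal_ofReal hX] at h1

/-- The constant of the fractional Poincaré inequality. -/
def constFrac (ρ : ℝ) : ℝ := (√discArea * ρ)⁻¹

lemma constFrac_nonneg (hρ : 0 < ρ) : 0 ≤ constFrac ρ := by unfold constFrac; positivity

lemma Regular.volume_inv_le (h : P.Regular ρ c) :
    (P.μ Set.univ)⁻¹ ≤ ENNReal.ofReal (discArea * (ρ * P.h) ^ 2)⁻¹ := by
  have := discArea_pos
  have hr := h.star.pos
  rw [ENNReal.ofReal_inv_of_pos (by positivity), ENNReal.inv_le_inv, ← volume_ball_eq c hr.le,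
    Measure.restrict_apply_univ]
  exact volume_ball_le h.star

/-- The fractional Poincaré inequality for vector fields. -/
lemma Regular.exists_fractional (h : P.Regular ρ c) (G : P.L2v) {s : ℝ}
    (hs : 0 ≤ s) : ∃ b : Plane,
    ‖G - P.constField b‖ₑ ^ 2 ≤ ENNReal.ofReal ((constFrac ρ * P.h ^ s) ^ 2) *
      ∫⁻ x, ∫⁻ y, ENNReal.ofReal (‖G x - G y‖ ^ 2 / ‖x - y‖ ^ (2 * (1 + s))) ∂P.μ ∂P.μ := by
  have hρ := h.pos
  have hh := h_pos (P := P)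
  have hr := h.star.pos
  have hκ := discArea_pos
  have hU0 : P.μ Set.univ ≠ 0 := by
    rw [Measure.restrict_apply_univ]
    exact (lt_of_lt_of_le (Metric.measure_ball_pos volume c hr) (volume_ball_le h.star)).ne'
  set ν : Measure Plane := (P.μ Set.univ)⁻¹ • P.μ with hν
  have hprob : IsProbabilityMeasure ν := ⟨by
    rw [hν, Measure.smul_apply, smul_eq_mul, ENNReal.inv_mul_cancel hU0 (measure_ne_top _ _)]⟩
  have hint : Integrable G ν :=
    ((Lp.memLp G).integrable (by norm_num)).smul_measure (ENNReal.inv_ne_top.2 hU0)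
  refine ⟨∫ y, G y ∂ν, ?_⟩
  set b := ∫ y, G y ∂ν
  have hpt : ∀ x, ‖G x - b‖ₑ ^ 2 ≤ ∫⁻ y, ‖G x - G y‖ₑ ^ 2 ∂ν := by
    intro x
    have e : G x - b = ∫ y, (G x - G y) ∂ν := by
      rw [integral_sub (integrable_const _) hint]
      simp [b]
    rw [e]
    exact enorm_integral_sq_le ν
      (stronglyMeasurable_const.sub (Lp.stronglyMeasurable G)).aestronglyMeasurable
  -- Since `‖x - y‖ ≤ h`, the singular weight may be inserted at the price of `h ^ (2 (1 + s))`.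
  have hxy : ∀ x ∈ interior P.carrier, ∀ y ∈ interior P.carrier, ‖G x - G y‖ₑ ^ 2 ≤
      ENNReal.ofReal (P.h ^ (2 * (1 + s))) *
        ENNReal.ofReal (‖G x - G y‖ ^ 2 / ‖x - y‖ ^ (2 * (1 + s))) := by
    intro x hx y hy
    rw [← ofReal_norm, ← ENNReal.ofReal_pow (norm_nonneg _), ← ENNReal.ofReal_mul (by positivity)]
    apply ENNReal.ofReal_le_ofReal
    rcases eq_or_ne x y with rfl | hne
    · simp
    · have hpos : 0 < ‖x - y‖ := norm_pos_iff.2 (sub_ne_zero.2 hne)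
      rw [← mul_div_assoc, le_div_iff₀ (by positivity), mul_comm]
      refine mul_le_mul_of_nonneg_right ?_ (by positivity)
      refine Real.rpow_le_rpow hpos.le ?_ (by linarith)
      rw [← dist_eq_norm]
      exact dist_le_h (interior_subset hx) (interior_subset hy)
  have hpow : (discArea * (ρ * P.h) ^ 2)⁻¹ * P.h ^ (2 * (1 + s)) =
      (constFrac ρ * P.h ^ s) ^ 2 := by
    have e : P.h ^ (2 * (1 + s)) = (P.h * P.h ^ s) ^ 2 := by
      rw [mul_comm 2, Real.rpow_mul hh.le, Real.rpow_add hh, Real.rpow_one, Real.rpow_two]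
    have h2 : (√discArea)⁻¹ ^ 2 = discArea⁻¹ := by rw [inv_pow, Real.sq_sqrt hκ.le]
    have h3 : constFrac ρ * P.h ^ s = (√discArea)⁻¹ * (ρ⁻¹ * P.h ^ s) := by
      rw [constFrac, mul_inv, mul_assoc]
    rw [e, h3, mul_pow _ (ρ⁻¹ * P.h ^ s), h2]
    field_simp
  calc ‖G - P.constField b‖ₑ ^ 2 = ∫⁻ x, ‖G x - b‖ₑ ^ 2 ∂P.μ := by
        rw [enorm_sq_eq]
        refine lintegral_congr_ae ?_
        filter_upwards [Lp.coeFn_sub G (P.constField b),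
          coeFn_toL2 (P := P) (continuous_const (y := b))] with x h1 h2
        rw [h1, Pi.sub_apply, constField, h2]
    _ ≤ ∫⁻ x, (P.μ Set.univ)⁻¹ * (ENNReal.ofReal (P.h ^ (2 * (1 + s))) * ∫⁻ y,
          ENNReal.ofReal (‖G x - G y‖ ^ 2 / ‖x - y‖ ^ (2 * (1 + s))) ∂P.μ) ∂P.μ := by
        refine lintegral_mono_ae ?_
        filter_upwards [ae_mem_interior] with x hx
        refine (hpt x).trans ?_
        rw [hν, lintegral_smul_measure, smul_eq_mul]
        gcongr
        rw [← lintegral_const_mul' _ _ ENNReal.ofReal_ne_top]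
        refine lintegral_mono_ae ?_
        filter_upwards [ae_mem_interior] with y hy
        exact hxy x hx y hy
    _ = (P.μ Set.univ)⁻¹ * ENNReal.ofReal (P.h ^ (2 * (1 + s))) * ∫⁻ x, ∫⁻ y,
          ENNReal.ofReal (‖G x - G y‖ ^ 2 / ‖x - y‖ ^ (2 * (1 + s))) ∂P.μ ∂P.μ := by
        rw [lintegral_const_mul' _ _ (ENNReal.inv_ne_top.2 hU0),
          lintegral_const_mul' _ _ ENNReal.ofReal_ne_top, mul_assoc]
    _ ≤ _ := by
        gcongr
        rw [← hpow, ENNReal.ofReal_mul (by positivity)]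
        gcongr
        exact h.volume_inv_le

lemma ae_eq_of_integral_test {f g : Plane → ℝ} (hf : Integrable f P.μ) (hg : Integrable g P.μ)
    (H : ∀ ψ : Plane → ℝ, ContDiff ℝ ∞ ψ → HasCompactSupport ψ → tsupport ψ ⊆ interior P.carrier →
      ∫ x, f x * ψ x ∂P.μ = ∫ x, g x * ψ x ∂P.μ) : f =ᵐ[P.μ] g := by
  have h1 : ∀ᵐ x, x ∈ interior P.carrier → f x - g x = 0 := by
    refine isOpen_interior.ae_eq_zero_of_integral_contDiff_smul_eq_zero
      (IntegrableOn.locallyIntegrableOn (hf.sub hg)) fun ψ hψ hc hs => ?_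
    obtain ⟨C, hC⟩ := hψ.continuous.bounded_above_of_compact_support hc
    have hm : ∀ {f : Plane → ℝ}, Integrable f P.μ → Integrable (fun x => f x * ψ x) P.μ :=
      fun hf => hf.mul_bdd hψ.continuous.aestronglyMeasurable (Eventually.of_forall hC)
    rw [← setIntegral_eq_integral_of_forall_compl_eq_zero (s := interior P.carrier)]
    · simp only [smul_eq_mul, mul_comm (ψ _), sub_mul]
      rw [integral_sub (hm hf) (hm hg), H ψ hψ hc hs, sub_self]
    · intro x hx
      rw [image_eq_zero_of_notMem_tsupport fun hx' => hx (hs hx'), zero_smul]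
  refine (ae_restrict_iff' isOpen_interior.measurableSet).2 ?_
  filter_upwards [h1] with x hx hxU
  exact sub_eq_zero.1 (hx hxU)

lemma integrable_apply (G : P.L2v) (i : Fin 2) : Integrable (fun x => G x i) P.μ := by
  have h1 : MemLp (fun x => inner ℝ (EuclideanSpace.single i (1 : ℝ)) (G x)) 2 P.μ :=
    (Lp.memLp G).const_inner _
  have h2 := h1.integrable (by norm_num)
  refine h2.congr (Eventually.of_forall fun x => ?_)
  simp [EuclideanSpace.inner_single_left]

/-- Mixed weak derivatives commute. -/
lemma weak_mixed_deriv {f : P.L2} (hf : f ∈ P.H1) {D : Fin 2 → P.L2v}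
    (hD : ∀ i, P.IsWeakGrad (fun x => P.grad f x i) (D i)) :
    (fun x => D 0 x 1) =ᵐ[P.μ] fun x => D 1 x 0 := by
  refine ae_eq_of_integral_test (integrable_apply _ _) (integrable_apply _ _)
    fun ψ hψ hc hs => ?_
  set e : Fin 2 → Plane := fun i => EuclideanSpace.single i (1 : ℝ) with he
  have hine : ∀ (v : Plane) (i : Fin 2), inner ℝ v (e i) = v i := fun v i => by
    simp [he, EuclideanSpace.inner_single_right]
  have hdψ : ∀ e : Plane, ContDiff ℝ ∞ fun x => fderiv ℝ ψ x e := fun e =>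
    (hψ.fderiv_right (m := ∞) (by simp)).clm_apply contDiff_const
  have hdc : ∀ e : Plane, HasCompactSupport fun x => fderiv ℝ ψ x e := fun e =>
    hc.fderiv_apply ℝ e
  have hds : ∀ e : Plane, tsupport (fun x => fderiv ℝ ψ x e) ⊆ interior P.carrier := fun e =>
    (closure_mono fun x hx => by
      rw [Function.mem_support] at hx ⊢
      intro h0
      exact hx (by rw [h0]; rfl)).trans ((tsupport_fderiv_subset ℝ).trans hs)
  -- Both weak derivatives are moved to the smooth test function, whose second derivative is
  -- symmetric.
  have key : ∀ i j, ∫ x, D i x j * ψ x ∂P.μ =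
      ∫ x, f x * fderiv ℝ (fun x => fderiv ℝ ψ x (e j)) x (e i) ∂P.μ := by
    intro i j
    have h1 := hD i ψ hψ hc hs (e j)
    have h2 := grad_spec hf _ (hdψ (e j)) (hdc (e j)) (hds (e j)) (e i)
    simp only [hine] at h1 h2
    rw [h2, h1, neg_neg]
  rw [key, key]
  refine integral_congr_ae (Eventually.of_forall fun x => ?_)
  have hsymm : IsSymmSndFDerivAt ℝ ψ x :=
    hψ.contDiffAt.isSymmSndFDerivAt (by simp; exact WithTop.coe_le_coe.2 (le_top : (2 : ℕ∞) ≤ ⊤))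
  have hd : ∀ a b : Plane, fderiv ℝ (fun x => fderiv ℝ ψ x a) x b =
      fderiv ℝ (fderiv ℝ ψ) x b a := by
    intro a b
    have h1 : DifferentiableAt ℝ (fderiv ℝ ψ) x :=
      (hψ.fderiv_right (m := ∞) (by simp)).differentiable (by simp) x
    rw [fderiv_clm_apply h1 (differentiableAt_const a)]
    simp
  simp only [hd, hsymm (e 0) (e 1)]

/-- The constant of the estimate of the deviation of the gradient from its mean. -/
def constGrad (ρ : ℝ) : ℝ := 1 + constFrac ρ + 2 * constPF ρ

lemma constGrad_pos (hρ : 0 < ρ) : 0 < constGrad ρ := by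
  have := constPF_pos hρ
  have := constFrac_nonneg hρ
  unfold constGrad; positivity

namespace Regular

/-- The Poincaré–Friedrichs inequality for the two components of the gradient, each an `H¹` function
by assumption, and the best approximation property of `Π₀`. -/
lemma norm_sub_Pi0v_le_second (h : P.Regular ρ c) {f : P.L2} (hf : f ∈ P.H1)
    {D : Fin 2 → P.L2v} (hD : ∀ i, P.IsWeakGrad (fun x => P.grad f x i) (D i)) :
    ‖P.grad f - P.Pi0v (P.grad f)‖ₑ ≤ ENNReal.ofReal (2 * constPF ρ * P.h) *
      (∫⁻ x, ENNReal.ofReal ((D 0 x 0) ^ 2 + (D 0 x 1) ^ 2 + (D 1 x 1) ^ 2) ∂P.μ) ^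
        (1 / 2 : ℝ) := by
  have hρ := h.pos
  have hh := h_pos (P := P)
  have hC := constPF_pos hρ
  set G := P.grad f with hG
  have hmem : ∀ i : Fin 2, MemLp (fun x => G x i) 2 P.μ := fun i => by
    have h1 : MemLp (fun x => inner ℝ (EuclideanSpace.single i (1 : ℝ)) (G x)) 2 P.μ :=
      (Lp.memLp G).const_inner _
    simpa [EuclideanSpace.inner_single_left] using h1
  set γ : Fin 2 → P.L2 := fun i => (hmem i).toLp _ with hγ
  have hγc : ∀ i, γ i =ᵐ[P.μ] fun x => G x i := fun i => (hmem i).coeFn_toLp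
  have hγD : ∀ i, P.IsWeakGrad (γ i) (D i) := by
    intro i ψ hψ hc hs e
    rw [← hD i ψ hψ hc hs e]
    refine integral_congr_ae ?_
    filter_upwards [hγc i] with x hx
    rw [hx]
  -- Subtracting the mean over edge `0` makes the Poincaré–Friedrichs inequality applicable.
  set m : Fin 2 → ℝ := fun i => P.dof (γ i) 0 with hm
  have hPF : ∀ i, ‖γ i - P.affine (m i, 0)‖ ≤ constPF ρ * P.h * ‖D i‖ := by
    intro i
    have hmem1 := (hγD i).mem
    have h1 := h.norm_le_of_dof_eq_zero (j := 0)
      (sub_mem_H1 hmem1 (affine_mem_H1 (m i, 0)))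
      (by rw [dof_sub h.star hmem1 (affine_mem_H1 _), dof_affine_const h.star, sub_self])
    have h2 : P.constField 0 = 0 := by
      refine Lp.ext ?_
      filter_upwards [coeFn_toL2 (P := P) (continuous_const (y := (0 : Plane))),
        Lp.coeFn_zero Plane 2 P.μ] with x e1 e2
      rw [constField, e1, e2, Pi.zero_apply]
    rwa [grad_sub hmem1 (affine_mem_H1 _), grad_affine, (hγD i).grad_eq, h2, sub_zero] at h1
  have hPFe : ∀ i, ‖γ i - P.affine (m i, 0)‖ₑ ^ 2 ≤
      ENNReal.ofReal ((constPF ρ * P.h) ^ 2) * ∫⁻ x, ENNReal.ofReal (D i x 0 ^ 2 + D i x 1 ^ 2)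
        ∂P.μ := by
    intro i
    have e1 : ∫⁻ x, ENNReal.ofReal (D i x 0 ^ 2 + D i x 1 ^ 2) ∂P.μ = ‖D i‖ₑ ^ 2 := by
      rw [enorm_sq_eq]
      refine lintegral_congr fun x => ?_
      rw [← norm_sq_plane, ← ofReal_norm, ENNReal.ofReal_pow (norm_nonneg _)]
    rw [e1, ENNReal.ofReal_pow (by positivity), ← mul_pow, ← ofReal_norm, ← ofReal_norm,
      ← ENNReal.ofReal_mul (by positivity)]
    gcongr
    exact hPF i
  set b : Plane := !₂[m 0, m 1] with hb
  have hsplit : ‖G - P.constField b‖ₑ ^ 2 =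
      ‖γ 0 - P.affine (m 0, 0)‖ₑ ^ 2 + ‖γ 1 - P.affine (m 1, 0)‖ₑ ^ 2 := by
    rw [enorm_sq_eq, enorm_sq_eq, enorm_sq_eq, ← lintegral_add_left
      ((Lp.stronglyMeasurable _).enorm.pow_const 2)]
    refine lintegral_congr_ae ?_
    filter_upwards [Lp.coeFn_sub G (P.constField b),
      coeFn_toL2 (P := P) (continuous_const (y := b)),
      Lp.coeFn_sub (γ 0) (P.affine (m 0, 0)), Lp.coeFn_sub (γ 1) (P.affine (m 1, 0)),
      hγc 0, hγc 1, coeFn_toL2 (P := P) (contDiff_affineFun (m 0, 0)).continuous,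
      coeFn_toL2 (P := P) (contDiff_affineFun (m 1, 0)).continuous] with x e1 e2 e3 e4 e5 e6 e7 e8
    rw [e1, e3, e4, Pi.sub_apply, Pi.sub_apply, Pi.sub_apply, e5, e6, affine_eq_toL2,
      affine_eq_toL2, e7, e8, constField, e2, ← ofReal_norm, ← ofReal_norm, ← ofReal_norm,
      ← ENNReal.ofReal_pow (norm_nonneg _), ← ENNReal.ofReal_pow (norm_nonneg _),
      ← ENNReal.ofReal_pow (norm_nonneg _), ← ENNReal.ofReal_add (by positivity) (by positivity),
      norm_sq_plane]
    simp [affineFun, hb]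
  refine le_sq_mul_of_enorm_sq_le (by positivity) ?_
  calc ‖G - P.Pi0v G‖ₑ ^ 2 ≤ ‖G - P.constField b‖ₑ ^ 2 := by
        rw [← ofReal_norm, ← ofReal_norm]
        gcongr
        exact norm_sub_Pi0v_le G b
    _ ≤ ENNReal.ofReal ((constPF ρ * P.h) ^ 2) *
          ∫⁻ x, ENNReal.ofReal (D 0 x 0 ^ 2 + D 0 x 1 ^ 2 + (D 1 x 0 ^ 2 + D 1 x 1 ^ 2)) ∂P.μ := by
        rw [hsplit]
        refine (add_le_add (hPFe 0) (hPFe 1)).trans_eq ?_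
        rw [← mul_add, ← lintegral_add_left']
        · congr 1
          refine lintegral_congr fun x => ?_
          rw [← ENNReal.ofReal_add (by positivity) (by positivity)]
        · exact ((((integrable_apply (D 0) 0).aestronglyMeasurable.aemeasurable).pow_const 2).add
            ((integrable_apply (D 0) 1).aestronglyMeasurable.aemeasurable.pow_const
              2)).ennreal_ofReal
    -- The seminorm counts the mixed derivative once, the two gradients together count it twice. The
    -- resulting factor two is absorbed by `2 ≤ 2²` in the last step.
    _ ≤ ENNReal.ofReal ((constPF ρ * P.h) ^ 2) * ∫⁻ x, ENNReal.ofReal 2 *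
          ENNReal.ofReal (D 0 x 0 ^ 2 + D 0 x 1 ^ 2 + D 1 x 1 ^ 2) ∂P.μ := by
        refine mul_le_mul' le_rfl (lintegral_mono_ae ?_)
        filter_upwards [weak_mixed_deriv hf hD] with x hx
        rw [← ENNReal.ofReal_mul (by norm_num), ← hx]
        apply ENNReal.ofReal_le_ofReal
        nlinarith [sq_nonneg (D 0 x 0), sq_nonneg (D 1 x 1)]
    _ ≤ _ := by
        rw [lintegral_const_mul' _ _ ENNReal.ofReal_ne_top, ← mul_assoc,
          ← ENNReal.ofReal_mul (by positivity)]
        gcongr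
        nlinarith [sq_nonneg (constPF ρ * P.h)]

/-- The deviation of the gradient from its mean is controlled by the Sobolev seminorms. -/
lemma norm_sub_Pi0v_le_seminorm (h : P.Regular ρ c) {s : ℝ} (hs0 : 0 ≤ s) (hs1 : s ≤ 1)
    {f : P.L2} (hf : f ∈ P.HOneAdd s) : ‖P.grad f - P.Pi0v (P.grad f)‖ ≤
      constGrad ρ * P.h ^ s * (P.sobolevSeminorm s f).toReal := by
  have hρ := h.pos
  have hh := h_pos (P := P)
  have hC := constPF_pos hρ
  have hF := constFrac_nonneg hρ
  have hhs : 0 < P.h ^ s := Real.rpow_pos_of_pos hh s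
  obtain ⟨hf1, hfin⟩ := hf
  -- The constant is a sum of nonnegative terms, one for each of the cases `s = 0`, `0 < s < 1` and
  -- `s = 1`; each case needs only its own term.
  have hmono : ∀ {X : ℝ}, X ≤ constGrad ρ →
      ‖P.grad f - P.Pi0v (P.grad f)‖ ≤ X * P.h ^ s * (P.sobolevSeminorm s f).toReal →
      ‖P.grad f - P.Pi0v (P.grad f)‖ ≤ constGrad ρ * P.h ^ s *
        (P.sobolevSeminorm s f).toReal := fun hX h1 => h1.trans (by gcongr)
  by_cases h0 : s = 0
  · refine hmono (X := 1) (by unfold constGrad; linarith) ?_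
    subst h0
    rw [Real.rpow_zero, mul_one, one_mul, sobolevSeminorm, if_pos rfl, semi1,
      ENNReal.toReal_ofReal (norm_nonneg _)]
    exact norm_sub_Pi0v_le_norm _
  by_cases h1 : s = 1
  · refine hmono (X := 2 * constPF ρ) (by unfold constGrad; linarith) ?_
    subst h1
    rw [Real.rpow_one]
    refine le_mul_toReal (by positivity) hfin.ne ?_
    -- The factor is divided out to expose the infimum over `D`, below which it suffices to argue
    -- for each `D`.
    have hX : ENNReal.ofReal (2 * constPF ρ * P.h) ≠ 0 := by
      rw [ne_eq, ENNReal.ofReal_eq_zero, not_le]; positivity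
    rw [mul_comm, ← ENNReal.div_le_iff hX ENNReal.ofReal_ne_top, sobolevSeminorm,
      if_neg one_ne_zero, if_pos rfl]
    refine le_iInf₂ fun D hD => ?_
    rw [ENNReal.div_le_iff hX ENNReal.ofReal_ne_top, mul_comm]
    exact h.norm_sub_Pi0v_le_second hf1 hD
  · refine hmono (X := constFrac ρ) (by unfold constGrad; linarith) ?_
    refine le_mul_toReal (by positivity) hfin.ne ?_
    obtain ⟨b, hb⟩ := h.exists_fractional (P.grad f) hs0
    rw [sobolevSeminorm, if_neg h0, if_neg h1]
    refine le_trans ?_ (le_sq_mul_of_enorm_sq_le (by positivity) hb)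
    rw [← ofReal_norm, ← ofReal_norm]
    exact ENNReal.ofReal_le_ofReal (norm_sub_Pi0v_le _ b)

end Regular

/-- The constant for the approximation by affine functions. -/
def constApx (ρ : ℝ) : ℝ := (constPF ρ + 1 + 32 / ρ ^ 2 * constPF ρ) * constGrad ρ

lemma constApx_pos (hρ : 0 < ρ) : 0 < constApx ρ := by
  have := constPF_pos hρ
  have := constGrad_pos hρ
  unfold constApx; positivity

/-- The proof of (c) produces `constGrad`, whereas its constant is expressed through `constApx`. -/
lemma constGrad_le_constApx (hρ : 0 < ρ) : constGrad ρ ≤ constApx ρ := by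
  have := constPF_pos hρ
  have := constGrad_pos hρ
  unfold constApx
  refine le_mul_of_one_le_left this.le ?_
  have : 0 ≤ 32 / ρ ^ 2 * constPF ρ := by positivity
  linarith

/-- Approximation by affine functions. -/
theorem Regular.approx (h : P.Regular ρ c) {s : ℝ} (hs0 : 0 ≤ s) (hs1 : s ≤ 1) {f : P.L2}
    (hf : f ∈ P.HOneAdd s) : ‖f - P.Pi1 f‖ + P.h * P.semi1 (f - P.Pi1 f) ≤
      constApx ρ * P.h ^ (1 + s) * (P.sobolevSeminorm s f).toReal := by
  have hρ := h.pos
  have hh := h_pos (P := P)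
  have hC := constPF_pos hρ
  refine (h.norm_sub_Pi1_le hf.1).trans ?_
  calc _ ≤ (constPF ρ + 1 + 32 / ρ ^ 2 * constPF ρ) * P.h *
        (constGrad ρ * P.h ^ s * (P.sobolevSeminorm s f).toReal) := by
        gcongr
        exact h.norm_sub_Pi0v_le_seminorm hs0 hs1 hf
    _ = _ := by
        rw [Real.rpow_add hh, Real.rpow_one, constApx]
        ring

end Polygon

/-! ### Cut-off functions and the inverse estimate for affine weak Laplacians. -/

namespace Polygon

variable {P : Polygon} {c : Plane} {r ρ : ℝ}

/-- A smooth cut-off function that equals one on three quarters of a ball. -/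
lemma exists_bubble : ∃ C : ℝ, 0 ≤ C ∧ ∀ (c : Plane) (s : ℝ), 0 < s → ∃ β : Plane → ℝ,
    ContDiff ℝ ∞ β ∧ HasCompactSupport β ∧ tsupport β ⊆ Metric.ball c s ∧ (∀ x, 0 ≤ β x) ∧
      (∀ x, β x ≤ 1) ∧ (∀ x ∈ Metric.closedBall c (3 / 4 * s), β x = 1) ∧
      ∀ x, ‖fderiv ℝ β x‖ ≤ C / s := by
  -- The plateau radius matches the balls of `exists_ball_affine`; the outer radius is below one so
  -- that the closed support stays in the open ball.
  let B : ContDiffBump (0 : Plane) := ⟨3 / 4, 7 / 8, by norm_num, by norm_num⟩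
  have hB : ContDiff ℝ ∞ B := B.contDiff
  obtain ⟨C, hC⟩ := (B.hasCompactSupport.fderiv ℝ).exists_bound_of_continuous
    (hB.continuous_fderiv (by simp))
  refine ⟨C, (norm_nonneg _).trans (hC 0), fun c s hs => ?_⟩
  have hs' := inv_pos.2 hs
  have hscale : ∀ x, ‖s⁻¹ • (x - c)‖ = s⁻¹ * ‖x - c‖ := fun x => by
    rw [norm_smul, Real.norm_of_nonneg hs'.le]
  have hzero : ∀ x, x ∉ Metric.closedBall c (7 / 8 * s) → B (s⁻¹ • (x - c)) = 0 := by
    intro x hx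
    rw [mem_closedBall_iff_norm, not_le] at hx
    refine B.zero_of_le_dist ?_
    rw [dist_zero_right, hscale]
    change 7 / 8 ≤ _
    rw [inv_mul_eq_div, le_div_iff₀ hs]
    exact hx.le
  have hts : tsupport (fun x => B (s⁻¹ • (x - c))) ⊆ Metric.closedBall c (7 / 8 * s) :=
    closure_minimal (fun x hx => by
      by_contra hxc
      exact hx (hzero x hxc)) Metric.isClosed_closedBall
  refine ⟨fun x => B (s⁻¹ • (x - c)), hB.comp (by fun_prop),
    HasCompactSupport.intro (isCompact_closedBall c (7 / 8 * s)) hzero,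
    hts.trans (Metric.closedBall_subset_ball (by linarith)), fun x => B.nonneg,
    fun x => B.le_one, fun x hx => ?_, fun x => ?_⟩
  · rw [mem_closedBall_iff_norm] at hx
    refine B.one_of_mem_closedBall ?_
    rw [mem_closedBall_zero_iff, hscale]
    change _ ≤ 3 / 4
    rw [inv_mul_eq_div, div_le_iff₀ hs]
    exact hx
  · have hd : HasFDerivAt (fun x : Plane => s⁻¹ • (x - c))
        (s⁻¹ • ContinuousLinearMap.id ℝ Plane) x :=
      ((hasFDerivAt_id x).sub_const c).const_smul s⁻¹
    have hcomp := ((hB.differentiable (by simp) (s⁻¹ • (x - c))).hasFDerivAt).comp x hd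
    have e : fderiv ℝ (fun x => B (s⁻¹ • (x - c))) x = s⁻¹ • fderiv ℝ B (s⁻¹ • (x - c)) := by
      rw [show (fun x => B (s⁻¹ • (x - c))) = (B ∘ fun x => s⁻¹ • (x - c)) from rfl, hcomp.fderiv]
      ext v
      simp
    rw [e, norm_smul, Real.norm_of_nonneg hs'.le, inv_mul_eq_div]
    exact div_le_div_of_nonneg_right (hC _) hs.le

/-- The estimate of an affine weak Laplacian by the gradient. -/
lemma exists_norm_laplacian_le (hρ : 0 < ρ) : ∃ C : ℝ, 0 < C ∧ ∀ (P : Polygon) (c : Plane),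
    P.Regular ρ c → ∀ w : P.L2, ∀ q ∈ P.P1, P.IsWeakLaplacian w q →
      P.h * ‖q‖ ≤ C * ‖P.grad w‖ := by
  obtain ⟨C, hC, hbub⟩ := exists_bubble
  -- `K A / h` bounds the gradient of the cut-off times the affine function: the terms stem from `4
  -- A / (ρ h)` for the slope and from `C / (ρ h)` for the derivative of the cut-off.
  set K : ℝ := (4 + (1 + 4 / ρ) * C) / ρ with hK
  have hKpos : 0 < K := by positivity
  refine ⟨(1 + 4 / ρ) * (16 * K / ρ ^ 2), by positivity, fun P c h w q hq hw => ?_⟩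
  have hh := h_pos (P := P)
  obtain ⟨p, rfl⟩ := hq
  change P.h * ‖P.affine p‖ ≤ _
  obtain ⟨β, hβ, hβc, hβs, hβ0, hβ1, hβone, hβd⟩ := hbub c (ρ * P.h) h.star.pos
  set A := affineSize c (ρ * P.h / 4) p with hA
  have hA0 : 0 ≤ A := h.affineSize_nonneg p
  have hκ := discArea_pos
  have hφ : ContDiff ℝ ∞ fun x => β x * affineFun p x := hβ.mul (contDiff_affineFun p)
  have hts : tsupport (fun x => β x * affineFun p x) ⊆ interior P.carrier :=
    (tsupport_mul_subset_left (f := β)).trans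
      (hβs.trans (ball_subset_interior_of_starConvex h.star.star carrier_nonempty))
  -- The test function is the cut-off times the Laplacian itself. One side becomes a weighted square
  -- integral of size `h² A²`, the other is at most `‖∇w‖` times a multiple of `A`.
  have h1 := hw _ hφ hβc.mul_right hts
  have h2 := h.le_integral_affineFun p hβ.continuous hβ0 hβone
  have e1 : ∫ x, P.affine p x * (β x * affineFun p x) ∂P.μ =
      ∫ x, β x * affineFun p x ^ 2 ∂P.μ := by
    refine integral_congr_ae ?_
    filter_upwards [coeFn_toL2 (P := P) (contDiff_affineFun p).continuous] with x hx
    rw [affine_eq_toL2, hx]; ring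
  have e2 : ∫ x, fderiv ℝ (fun x => β x * affineFun p x) x (P.grad w x) ∂P.μ =
      inner ℝ (P.toL2 (gradient fun x => β x * affineFun p x) (continuous_gradient hφ))
        (P.grad w) := by
    rw [toL2_inner]
    simp only [inner_gradient]
  change ∫ x, fderiv ℝ (fun x => β x * affineFun p x) x (P.grad w x) ∂P.μ =
    -∫ x, P.affine p x * (β x * affineFun p x) ∂P.μ at h1
  rw [e1, e2] at h1
  have h3 : ‖P.toL2 (gradient fun x => β x * affineFun p x) (continuous_gradient hφ)‖ ≤
      √discArea * P.h * (K * A / P.h) := by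
    have hn : 0 ≤ K * A / P.h := by positivity
    refine (norm_toL2_le _ hn fun x hx => ?_).trans
      (mul_le_mul_of_nonneg_right h.sqrt_measure_le hn)
    rw [norm_gradient, fderiv_fun_mul (hβ.differentiable (by simp) x)
      ((contDiff_affineFun p).differentiable (by simp) x)]
    have hb : ‖p.2‖ ≤ 4 * A / (ρ * P.h) := by
      rw [le_div_iff₀ (by positivity)]
      have : ‖p.2‖ * (ρ * P.h / 4) ≤ A := le_add_of_nonneg_left (abs_nonneg _)
      linarith
    have hfd : ‖fderiv ℝ (affineFun p) x‖ = ‖p.2‖ := by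
      rw [← norm_gradient, gradient_affineFun]
    calc _ ≤ ‖β x • fderiv ℝ (affineFun p) x‖ + ‖affineFun p x • fderiv ℝ β x‖ := norm_add_le _ _
      _ ≤ 1 * (4 * A / (ρ * P.h)) + (1 + 4 / ρ) * A * (C / (ρ * P.h)) := by
          rw [norm_smul, norm_smul, hfd, Real.norm_of_nonneg (hβ0 x), Real.norm_eq_abs]
          have := h.abs_affineFun_le p (interior_subset hx)
          have := hβ1 x
          have := hβd x
          gcongr
      _ = K * A / P.h := by rw [hK]; field_simp
  have h4 : discArea * (ρ * P.h / 4) ^ 2 * A ^ 2 ≤ √discArea * (K * A) * ‖P.grad w‖ := by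
    calc _ ≤ ∫ x, β x * affineFun p x ^ 2 ∂P.μ := h2
      _ ≤ ‖P.toL2 (gradient fun x => β x * affineFun p x) (continuous_gradient hφ)‖ *
          ‖P.grad w‖ := by
          have := neg_le_of_abs_le (abs_real_inner_le_norm
            (P.toL2 (gradient fun x => β x * affineFun p x) (continuous_gradient hφ)) (P.grad w))
          linarith
      _ ≤ √discArea * P.h * (K * A / P.h) * ‖P.grad w‖ := by gcongr
      _ = _ := by field_simp
  have h5 : √discArea * (P.h ^ 2 * A) ≤ 16 * K / ρ ^ 2 * ‖P.grad w‖ := by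
    -- One factor `A` is cancelled, hence the separate case `A = 0`.
    rcases hA0.eq_or_lt with h0 | h0
    · rw [← h0]; simp only [mul_zero]; positivity
    · have hsq : √discArea * √discArea = discArea := Real.mul_self_sqrt hκ.le
      have hs0 : 0 < √discArea := Real.sqrt_pos.2 hκ
      refine le_of_mul_le_mul_left ?_ (show 0 < √discArea * A * (ρ ^ 2 / 16) by positivity)
      calc _ = discArea * (ρ * P.h / 4) ^ 2 * A ^ 2 := by
            linear_combination (A ^ 2 * ρ ^ 2 / 16 * P.h ^ 2) * hsq
        _ ≤ _ := h4
        _ = _ := by field_simp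
  calc P.h * ‖P.affine p‖ ≤ P.h * (√discArea * P.h * ((1 + 4 / ρ) * A)) := by
        gcongr; exact h.norm_affine_le p
    _ = (1 + 4 / ρ) * (√discArea * (P.h ^ 2 * A)) := by ring
    _ ≤ (1 + 4 / ρ) * (16 * K / ρ ^ 2 * ‖P.grad w‖) := by gcongr
    _ = _ := by ring

end Polygon

/-! ### The Ritz projection and the structure of the virtual element space. -/

namespace Polygon

variable {P : Polygon} {c : Plane} {r ρ : ℝ}

lemma dof_test (h : P.StarBall c r) {φ : Plane → ℝ} (hφ : ContDiff ℝ ∞ φ)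
    (hs : tsupport φ ⊆ interior P.carrier) (j : Fin P.n) :
    P.dof (P.toL2 φ hφ.continuous) j = 0 := by
  rw [dof_toL2 h hφ]
  refine (intervalIntegral.integral_congr fun t ht => ?_).trans intervalIntegral.integral_zero
  rw [Set.uIcc_of_le zero_le_one] at ht
  refine image_eq_zero_of_notMem_tsupport fun hx => ?_
  exact (edgePoint_mem_frontier j ht).2 (hs hx)

/-- Test functions vanish on the edges, so the boundary sum drops out. The condition on the
Laplacian in `VhHat` is thus implied by the one on the normal derivative. -/
lemma IsNormalDeriv.isWeakLaplacian (h : P.StarBall c r) {v q : P.L2} {g : Fin P.n → ℝ}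
    (hv : P.IsNormalDeriv v q g) : P.IsWeakLaplacian v q := by
  intro φ hφ _ hs
  have h1 := hv _ (toL2_mem_H1 hφ)
  simp only [edgeIntegral_eq, dof_test h hφ hs, mul_zero, Finset.sum_const_zero] at h1
  rw [grad_toL2 hφ, inner_toL2, inner_toL2] at h1
  have e1 : ∫ x, fderiv ℝ φ x (P.grad v x) ∂P.μ =
      ∫ x, inner ℝ (P.grad v x) (gradient φ x) ∂P.μ := by
    refine integral_congr_ae (Eventually.of_forall fun x => ?_)
    simp only [← inner_gradient, real_inner_comm]
  have e2 : ∫ x, q x * φ x ∂P.μ = ∫ x, inner ℝ (q x) (φ x) ∂P.μ := by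
    refine integral_congr_ae (Eventually.of_forall fun x => ?_)
    simp [mul_comm]
  rw [e1, e2]
  linarith

lemma IsNormalDeriv.add {v w q s : P.L2} {g k : Fin P.n → ℝ} (hv : v ∈ P.H1) (hw : w ∈ P.H1)
    (h1 : P.IsNormalDeriv v q g) (h2 : P.IsNormalDeriv w s k) :
    P.IsNormalDeriv (v + w) (q + s) (g + k) := by
  intro φ hφ
  simp only [grad_add hv hw, inner_add_left, Pi.add_apply, add_mul, Finset.sum_add_distrib]
  linarith [h1 φ hφ, h2 φ hφ]

lemma IsNormalDeriv.smul {v q : P.L2} {g : Fin P.n → ℝ} (a : ℝ) (hv : v ∈ P.H1)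
    (h1 : P.IsNormalDeriv v q g) : P.IsNormalDeriv (a • v) (a • q) (a • g) := by
  intro φ hφ
  simp only [grad_smul a hv, real_inner_smul_left, Pi.smul_apply, smul_eq_mul, mul_assoc,
    ← Finset.mul_sum]
  rw [← mul_add, h1 φ hφ]

lemma mem_VhHat_iff (h : P.StarBall c r) {v : P.L2} :
    v ∈ P.VhHat ↔ v ∈ P.H1 ∧ ∃ q ∈ P.P1, ∃ g, P.IsNormalDeriv v q g :=
  ⟨fun ⟨hv, q, hq, _, g, hg⟩ => ⟨hv, q, hq, g, hg⟩,
    fun ⟨hv, q, hq, g, hg⟩ => ⟨hv, q, hq, hg.isWeakLaplacian h, g, hg⟩⟩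

lemma Pi1_mem (v : P.L2) : P.Pi1 v ∈ P.P1 := P.P1.starProjection_apply_mem v

lemma inner_sub_Pi1 (v : P.L2) {q : P.L2} (hq : q ∈ P.P1) : inner ℝ (v - P.Pi1 v) q = 0 :=
  P.P1.starProjection_inner_eq_zero v q hq

lemma Pi1_eq {v p : P.L2} (hp : p ∈ P.P1) (h : ∀ q ∈ P.P1, inner ℝ (v - p) q = 0) :
    P.Pi1 v = p := Submodule.eq_starProjection_of_mem_of_inner_eq_zero hp h

lemma edgeIntegral_add (h : P.StarBall c r) {v w : P.L2} (hv : v ∈ P.H1) (hw : w ∈ P.H1)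
    (j : Fin P.n) : P.edgeIntegral (v + w) j = P.edgeIntegral v j + P.edgeIntegral w j := by
  rw [edgeIntegral_eq, edgeIntegral_eq, edgeIntegral_eq, dof_add h hv hw, mul_add]

lemma edgeIntegral_sub (h : P.StarBall c r) {v w : P.L2} (hv : v ∈ P.H1) (hw : w ∈ P.H1)
    (j : Fin P.n) : P.edgeIntegral (v - w) j = P.edgeIntegral v j - P.edgeIntegral w j := by
  rw [edgeIntegral_eq, edgeIntegral_eq, edgeIntegral_eq, dof_sub h hv hw, mul_sub]

lemma edgeIntegral_smul (h : P.StarBall c r) (a : ℝ) {v : P.L2} (hv : v ∈ P.H1)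
    (j : Fin P.n) : P.edgeIntegral (a • v) j = a * P.edgeIntegral v j := by
  rw [edgeIntegral_eq, edgeIntegral_eq, dof_smul h a hv, mul_left_comm]

lemma IsRitzProjection.add (h : P.StarBall c r) {v w p s : P.L2} (hv : v ∈ P.H1) (hw : w ∈ P.H1)
    (h1 : P.IsRitzProjection v p) (h2 : P.IsRitzProjection w s) :
    P.IsRitzProjection (v + w) (p + s) := by
  have hp := P1_le_H1 h1.1
  have hs := P1_le_H1 h2.1
  refine ⟨P.P1.add_mem h1.1 h2.1, fun χ hχ => ?_, ?_⟩
  · have e : P.grad (p + s) - P.grad (v + w) =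
        (P.grad p - P.grad v) + (P.grad s - P.grad w) := by
      rw [grad_add hp hs, grad_add hv hw]; abel
    rw [e, inner_add_left, h1.2.1 χ hχ, h2.2.1 χ hχ, add_zero]
  · simp only [edgeIntegral_add h hp hs, edgeIntegral_add h hv hw, Finset.sum_add_distrib,
      h1.2.2, h2.2.2]

lemma IsRitzProjection.smul (h : P.StarBall c r) (a : ℝ) {v p : P.L2} (hv : v ∈ P.H1)
    (h1 : P.IsRitzProjection v p) : P.IsRitzProjection (a • v) (a • p) := by
  have hp := P1_le_H1 h1.1
  refine ⟨P.P1.smul_mem a h1.1, fun χ hχ => ?_, ?_⟩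
  · rw [grad_smul a hp, grad_smul a hv, ← smul_sub, real_inner_smul_left, h1.2.1 χ hχ, mul_zero]
  · simp only [edgeIntegral_smul h a hp, edgeIntegral_smul h a hv, ← Finset.mul_sum, h1.2.2]

lemma isRitzProjection_self {p : P.L2} (hp : p ∈ P.P1) : P.IsRitzProjection p p :=
  ⟨hp, fun χ _ => by rw [sub_self, inner_zero_left], rfl⟩

/-- The gradients of affine functions are exactly the constant fields, so the Ritz condition is the
orthogonality that characterizes `Π₀`. -/
lemma IsRitzProjection.grad_eq {v p : P.L2} (h : P.IsRitzProjection v p) :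
    P.grad p = P.Pi0v (P.grad v) := by
  obtain ⟨⟨p, rfl⟩, h2, -⟩ := h
  change ∀ χ ∈ P.P1, inner ℝ (P.grad (P.affine p) - P.grad v) (P.grad χ) = 0 at h2
  rw [grad_affine] at h2 ⊢
  refine (Submodule.eq_starProjection_of_mem_of_inner_eq_zero (constField_mem _)
    fun w hw => ?_).symm
  obtain ⟨e, rfl⟩ := mem_P0v.1 hw
  have h3 := h2 _ (affine_mem_P1 (0, e))
  rw [grad_affine] at h3
  rw [← neg_sub, inner_neg_left, h3, neg_zero]

/-- The Ritz projection is computable from the degrees of freedom: the boundary integral obviously,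
and the products of the gradient with constant fields by Green's formula. -/
lemma IsRitzProjection.of_dof_eq (h : P.StarBall c r) {v w p : P.L2} (hv : v ∈ P.H1)
    (hw : w ∈ P.H1) (hvw : ∀ j, P.dof v j = P.dof w j) (h1 : P.IsRitzProjection v p) :
    P.IsRitzProjection w p := by
  have he : ∀ j, P.edgeIntegral v j = P.edgeIntegral w j := fun j => by
    rw [edgeIntegral_eq, edgeIntegral_eq, hvw]
  refine ⟨h1.1, fun χ hχ => ?_, by simp only [h1.2.2, he]⟩
  rw [← h1.2.1 χ hχ, inner_sub_left, inner_sub_left]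
  obtain ⟨χ, rfl⟩ := hχ
  change _ - inner ℝ _ (P.grad (P.affine χ)) = _ - inner ℝ _ (P.grad (P.affine χ))
  obtain ⟨g, hg⟩ := exists_green h
  rw [grad_affine, real_inner_comm (P.constField χ.2) (P.grad w),
    real_inner_comm (P.constField χ.2) (P.grad v)]
  congr 1
  exact (hg w hw χ.2).trans ((Finset.sum_congr rfl fun j _ => by rw [he]).trans
    (hg v hv χ.2).symm)

/-- The slope is the mean gradient, and the additive constant is fitted to the boundary integral. -/
lemma exists_isRitzProjection (h : P.StarBall c r) {v : P.L2} (hv : v ∈ P.H1) :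
    ∃ p, P.IsRitzProjection v p := by
  obtain ⟨b, hb⟩ := exists_Pi0v_eq (P.grad v)
  have hL : 0 < ∑ j, P.edgeLength j :=
    Finset.sum_pos (fun j _ => edgeLength_pos j) Finset.univ_nonempty
  have hvb := sub_mem_H1 hv (affine_mem_H1 (P := P) (0, b))
  set a := (∑ j, P.edgeLength j)⁻¹ * ∑ j, P.edgeIntegral (v - P.affine (0, b)) j with ha
  have hp : P.affine (a, b) = P.affine (a, 0) + P.affine (0, b) := by
    rw [← map_add]; simp
  have hva : v = (v - P.affine (0, b)) + P.affine (0, b) := by abel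
  refine ⟨P.affine (a, b), affine_mem_P1 _, fun χ hχ => ?_, ?_⟩
  · obtain ⟨χ, rfl⟩ := hχ
    rw [grad_affine, grad_affine, ← hb, ← neg_sub, inner_neg_left, inner_sub_Pi0v, neg_zero]
  · conv_rhs => rw [hva]
    simp only [hp, edgeIntegral_add h (affine_mem_H1 _) (affine_mem_H1 _),
      edgeIntegral_add h hvb (affine_mem_H1 _), Finset.sum_add_distrib, add_left_inj]
    simp only [edgeIntegral_eq (P.affine (a, 0)), dof_affine_const h, ← Finset.sum_mul]
    rw [ha, mul_inv_cancel_left₀ hL.ne']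

lemma grad_zero : P.grad (0 : P.L2) = 0 := P.gradL.map_zero

/-- Orthogonality to the affine functions forces the Ritz projection to be `Π₁ v`, which removes the
auxiliary `p` from the definition. -/
lemma mem_Vh_iff (h : P.StarBall c r) {v : P.L2} : v ∈ P.Vh ↔
    v ∈ P.H1 ∧ (∃ q ∈ P.P1, ∃ g, P.IsNormalDeriv v q g) ∧ P.IsRitzProjection v (P.Pi1 v) := by
  rw [← and_assoc, ← mem_VhHat_iff h]
  refine ⟨fun ⟨h1, p, hp, h2⟩ => ⟨h1, ?_⟩, fun ⟨h1, h2⟩ => ⟨h1, _, h2, fun q hq =>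
    inner_sub_Pi1 v hq⟩⟩
  rwa [Pi1_eq hp.1 h2]

/-- The local virtual element space as a submodule. -/
def VhSub (h : P.StarBall c r) : Submodule ℝ P.L2 where
  carrier := P.Vh
  add_mem' {v w} hv hw := by
    obtain ⟨hv, ⟨q, hq, g, hg⟩, hp⟩ := (mem_Vh_iff h).1 hv
    obtain ⟨hw, ⟨s, hs, k, hk⟩, hp'⟩ := (mem_Vh_iff h).1 hw
    refine (mem_Vh_iff h).2 ⟨add_mem_H1 hv hw, ⟨q + s, P.P1.add_mem hq hs, _, hg.add hv hw hk⟩, ?_⟩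
    rw [Pi1, map_add]
    exact hp.add h hv hw hp'
  zero_mem' := by
    refine (mem_Vh_iff h).2 ⟨P.H1Sub.zero_mem, ⟨0, P.P1.zero_mem, 0, fun φ _ => ?_⟩, ?_⟩
    · simp [grad_zero]
    · rw [Pi1, map_zero]
      exact isRitzProjection_self P.P1.zero_mem
  smul_mem' a v hv := by
    obtain ⟨hv, ⟨q, hq, g, hg⟩, hp⟩ := (mem_Vh_iff h).1 hv
    refine (mem_Vh_iff h).2 ⟨smul_mem_H1 a hv, ⟨a • q, P.P1.smul_mem a hq, _, hg.smul a hv⟩, ?_⟩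
    rw [Pi1, map_smul]
    exact hp.smul h a hv

/-- The Laplacian is zero, Green's formula provides the edgewise constant normal derivative, and
both projections fix affine functions. -/
lemma affine_mem_Vh (h : P.StarBall c r) {p : P.L2} (hp : p ∈ P.P1) : p ∈ P.Vh := by
  have hp' := P1_le_H1 hp
  refine (mem_Vh_iff h).2 ⟨hp', ⟨0, P.P1.zero_mem, ?_⟩, ?_⟩
  · obtain ⟨p, rfl⟩ := hp
    obtain ⟨g, hg⟩ := exists_green h
    refine ⟨g p.2, fun φ hφ => ?_⟩
    rw [grad_affine, inner_zero_left, add_zero]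
    exact hg φ hφ p.2
  · rw [Pi1_eq hp fun q _ => by rw [sub_self, inner_zero_left]]
    exact isRitzProjection_self hp

/-- The energy identity: the normal derivative formula is tested with `v` and with `w`, and the
boundary sums agree because they see only edge integrals. -/
lemma norm_grad_sq_of_isNormalDeriv {v q : P.L2} {g : Fin P.n → ℝ} (hv : v ∈ P.H1)
    (hg : P.IsNormalDeriv v q g) {w : P.L2} (hw : w ∈ P.H1) (hvw : ∀ j, P.dof v j = P.dof w j) :
    ‖P.grad v‖ ^ 2 = inner ℝ (P.grad v) (P.grad w) + inner ℝ q (w - v) := by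
  have h1 := hg v hv
  have h2 := hg w hw
  have he : ∀ j, P.edgeIntegral v j = P.edgeIntegral w j := fun j => by
    rw [edgeIntegral_eq, edgeIntegral_eq, hvw]
  simp only [he] at h1
  rw [inner_sub_right, ← real_inner_self_eq_norm_sq]
  linarith

namespace Regular

/-- Both gradients equal `Π₀ ∇v`, and the difference has vanishing boundary integral, so
Poincaré–Friedrichs applies with all edges. -/
lemma isRitzProjection_unique (h : P.Regular ρ c) {v p p' : P.L2} (hp : P.IsRitzProjection v p)
    (hp' : P.IsRitzProjection v p') : p = p' := by
  have h1 := P1_le_H1 hp.1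
  have h2 := P1_le_H1 hp'.1
  have h3 : ∑ j, P.edgeIntegral (p - p') j = 0 := by
    simp only [edgeIntegral_sub h.star h1 h2, Finset.sum_sub_distrib, hp.2.2, hp'.2.2, sub_self]
  have h4 := h.norm_le_of_sum_edgeIntegral (sub_mem_H1 h1 h2) Finset.univ_nonempty h3
  rw [semi1, grad_sub h1 h2, hp.grad_eq, hp'.grad_eq, sub_self, norm_zero, mul_zero] at h4
  exact sub_eq_zero.1 (norm_le_zero_iff.1 h4)

/-- The degrees of freedom determine the functions of the virtual element space. -/
lemma eq_of_dof_eq (h : P.Regular ρ c) {v w : P.L2} (hv : v ∈ P.Vh) (hw : w ∈ P.Vh)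
    (hvw : ∀ j, P.dof v j = P.dof w j) : v = w := by
  have hv1 := ((mem_Vh_iff h.star).1 hv).1
  have hw1 := ((mem_Vh_iff h.star).1 hw).1
  have hd : v - w ∈ P.Vh := (VhSub h.star).sub_mem hv hw
  obtain ⟨hu, ⟨q, hq, g, hg⟩, hp⟩ := (mem_Vh_iff h.star).1 hd
  have h0 : ∀ j, P.dof (v - w) j = P.dof (0 : P.L2) j := fun j => by
    rw [← sub_self w, dof_sub h.star hv1 hw1, dof_sub h.star hw1 hw1, hvw]
  have hz : (0 : P.L2) ∈ P.H1 := P.H1Sub.zero_mem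
  -- Vanishing degrees of freedom give zero Ritz projection, which in `V_h` is `Π₁`. Hence the
  -- difference is orthogonal to its affine Laplacian, and the energy identity with `0` shows that
  -- its gradient vanishes.
  have h1 : P.Pi1 (v - w) = 0 := h.isRitzProjection_unique (hp.of_dof_eq h.star hu hz h0)
    (isRitzProjection_self P.P1.zero_mem)
  have h2 := norm_grad_sq_of_isNormalDeriv hu hg hz h0
  have h3 := inner_sub_Pi1 (v - w) hq
  rw [h1, sub_zero, real_inner_comm] at h3
  rw [grad_zero, inner_zero_right, zero_sub, inner_neg_right, h3, neg_zero, add_zero,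
    sq_eq_zero_iff] at h2
  have h4 : P.dof (v - w) 0 = 0 := by
    rw [dof_sub h.star hv1 hw1, hvw, sub_self]
  have h5 := h.norm_le_of_dof_eq_zero hu h4
  rw [h2, mul_zero] at h5
  exact sub_eq_zero.1 (norm_le_zero_iff.1 h5)

end Regular

end Polygon

/-! ### Existence of virtual element functions with prescribed degrees of freedom. -/

namespace Polygon

variable {P : Polygon} {c : Plane} {r ρ : ℝ}

/-- A bump at the midpoint of the edge, which has positive distance to the union of the other edges,
normalized by its edge mean. -/
lemma exists_edge_bump (h : P.StarBall c r) (j : Fin P.n) :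
    ∃ v ∈ P.H1, ∀ k, P.dof v k = if k = j then 1 else 0 := by
  have hmid : (1 / 2 : ℝ) ∈ Set.Ioo (0 : ℝ) 1 := by norm_num
  set F : Set Plane := ⋃ k : {k // k ≠ j}, P.edgePoint k '' Set.Icc 0 1 with hF
  have hFc : IsClosed F := isClosed_iUnion_of_finite fun k =>
    (isCompact_Icc.image (continuous_edgePoint k.1)).isClosed
  have hm : P.edgePoint j (1 / 2) ∈ Fᶜ := by
    intro hm
    obtain ⟨⟨k, hk⟩, t, ht, he⟩ := Set.mem_iUnion.1 hm
    exact edgePoint_ne_edgePoint hk.symm hmid ht he.symm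
  obtain ⟨ε, hε, hball⟩ := Metric.isOpen_iff.1 hFc.isOpen_compl _ hm
  let B : ContDiffBump (P.edgePoint j (1 / 2)) := ⟨ε / 2, ε, by positivity, by linarith⟩
  have hB : ContDiff ℝ ∞ B := B.contDiff
  have hcont : ∀ k, Continuous fun t => B (P.edgePoint k t) := fun k =>
    hB.continuous.comp (continuous_edgePoint k)
  set a := ∫ t in (0 : ℝ)..1, B (P.edgePoint j t) with ha
  have hapos : 0 < a := by
    refine intervalIntegral.integral_pos zero_lt_one (hcont j).continuousOn
      (fun t _ => B.nonneg) ⟨1 / 2, ⟨hmid.1.le, hmid.2.le⟩, ?_⟩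
    rw [B.one_of_mem_closedBall (Metric.mem_closedBall_self B.rIn_pos.le)]
    exact zero_lt_one
  refine ⟨a⁻¹ • P.toL2 B hB.continuous, smul_mem_H1 _ (toL2_mem_H1 hB), fun k => ?_⟩
  rw [dof_smul h _ (toL2_mem_H1 hB), dof_toL2 h hB]
  split_ifs with hk
  · subst hk
    exact inv_mul_cancel₀ hapos.ne'
  · have h0 : ∫ t in (0 : ℝ)..1, B (P.edgePoint k t) = 0 := by
      refine (intervalIntegral.integral_congr fun t ht => ?_).trans
        intervalIntegral.integral_zero
      rw [Set.uIcc_of_le zero_le_one] at ht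
      refine B.zero_of_le_dist ?_
      by_contra hlt
      exact hball (Metric.mem_ball.2 (not_le.1 hlt)) (Set.mem_iUnion.2 ⟨⟨k, hk⟩, t, ht, rfl⟩)
    rw [h0, mul_zero]

/-- The degrees of freedom as linear functionals on `H¹`. -/
def dofL (h : P.StarBall c r) (j : Fin P.n) : P.H1Sub →ₗ[ℝ] ℝ where
  toFun v := P.dof v j
  map_add' v w := dof_add h v.2 w.2 j
  map_smul' a v := dof_smul h a v.2 j

lemma dof_sum_smul (h : P.StarBall c r) {ψ : Fin P.n → P.L2} (hψ : ∀ j, ψ j ∈ P.H1)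
    (hδ : ∀ j k, P.dof (ψ j) k = if k = j then 1 else 0) (d : Fin P.n → ℝ) (k : Fin P.n) :
    P.dof (∑ j, d j • ψ j) k = d k := by
  have e : (∑ j, d j • ψ j : P.L2) = ((∑ j, d j • (⟨ψ j, hψ j⟩ : P.H1Sub) : P.H1Sub) : P.L2) := by
    simp
  have h1 : P.dof (∑ j, d j • ψ j) k = dofL h k (∑ j, d j • (⟨ψ j, hψ j⟩ : P.H1Sub)) := by
    rw [e]; rfl
  rw [h1, map_sum]
  have h2 : ∀ j, dofL h k (d j • (⟨ψ j, hψ j⟩ : P.H1Sub)) = if k = j then d j else 0 := fun j => by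
    rw [map_smul]
    change d j • P.dof (ψ j) k = _
    rw [hδ]; simp
  simp only [h2, Finset.sum_ite_eq, Finset.mem_univ, if_true]

lemma exists_dof_eq (h : P.StarBall c r) (d : Fin P.n → ℝ) : ∃ v ∈ P.H1, ∀ j, P.dof v j = d j := by
  choose ψ hψ hδ using exists_edge_bump h
  exact ⟨_, P.H1Sub.sum_mem fun j _ => P.H1Sub.smul_mem _ (hψ j), dof_sum_smul h hψ hδ d⟩

namespace Regular

/-- Functions with vanishing traces and prescribed projection onto the affine functions. -/
lemma exists_Pi1_eq (h : P.Regular ρ c) {m : P.L2} (hm : m ∈ P.P1) :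
    ∃ v ∈ P.H1, (∀ j, P.dof v j = 0) ∧ P.Pi1 v = m := by
  have hr := h.star.pos
  obtain ⟨C, -, hbub⟩ := exists_bubble
  obtain ⟨β, hβ, -, hβs, hβ0, -, hβone, -⟩ := hbub c (ρ * P.h) hr
  have hφ : ∀ p, ContDiff ℝ ∞ fun x => β x * affineFun p x := fun p =>
    hβ.mul (contDiff_affineFun p)
  have hts : ∀ p, tsupport (fun x => β x * affineFun p x) ⊆ interior P.carrier := fun p =>
    (tsupport_mul_subset_left (f := β)).trans
      (hβs.trans (ball_subset_interior_of_starConvex h.star.star carrier_nonempty))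
  let bub : (ℝ × Plane) →ₗ[ℝ] P.L2 :=
    { toFun := fun p => P.toL2 (fun x => β x * affineFun p x) (hφ p).continuous
      map_add' := fun p q => by
        rw [← toL2_add]
        congr 1
        ext x
        simp only [affineFun, Prod.fst_add, Prod.snd_add, inner_add_left]
        ring
      map_smul' := fun a p => by
        rw [RingHom.id_apply, ← toL2_smul]
        congr 1
        ext x
        simp only [affineFun, Prod.smul_fst, Prod.smul_snd, real_inner_smul_left, smul_eq_mul]
        ring }
  -- The form `∫ β p q` weighted by the cut-off is positive definite on affine functions, so `T` is
  -- injective and, in finite dimension, onto: all affine moments are attained by bubbles.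
  let T : (ℝ × Plane) →ₗ[ℝ] Module.Dual ℝ (ℝ × Plane) := (innerₗ P.L2).compl₁₂ bub P.affine
  have hT : ∀ p q, T p q = inner ℝ (bub p) (P.affine q) := fun p q => rfl
  have hinj : Function.Injective T := by
    refine (injective_iff_map_eq_zero T).2 fun p hp => ?_
    have h1 : T p p = 0 := by rw [hp]; rfl
    have h2 : T p p = ∫ x, β x * affineFun p x ^ 2 ∂P.μ := by
      rw [hT, affine_eq_toL2]
      change inner ℝ (P.toL2 (fun x => β x * affineFun p x) (hφ p).continuous) _ = _
      rw [toL2_inner]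
      refine integral_congr_ae ?_
      filter_upwards [coeFn_toL2 (P := P) (contDiff_affineFun p).continuous] with x hx
      rw [hx]
      simp only [RCLike.inner_apply, conj_trivial]
      ring
    have h3 := h.le_integral_affineFun p hβ.continuous hβ0 hβone
    rw [← h2, h1] at h3
    have hκ := discArea_pos
    have h4 : affineSize c (ρ * P.h / 4) p = 0 := by
      by_contra hne
      have : 0 < affineSize c (ρ * P.h / 4) p := lt_of_le_of_ne (h.affineSize_nonneg p) (Ne.symm hne)
      have : 0 < discArea * (ρ * P.h / 4) ^ 2 * affineSize c (ρ * P.h / 4) p ^ 2 := by positivity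
      linarith
    unfold affineSize at h4
    have h5 : 0 ≤ ‖p.2‖ * (ρ * P.h / 4) := by positivity
    have h6 : ‖p.2‖ * (ρ * P.h / 4) = 0 := by linarith [abs_nonneg (affineFun p c)]
    have h7 : p.2 = 0 := by
      rcases mul_eq_zero.1 h6 with h | h
      · exact norm_eq_zero.1 h
      · linarith
    have h8 : affineFun p c = 0 := abs_eq_zero.1 (by linarith)
    rw [affineFun, h7, inner_zero_left, add_zero] at h8
    exact Prod.ext h8 h7
  have hsurj := (LinearMap.injective_iff_surjective_of_finrank_eq_finrank
    (Subspace.dual_finrank_eq (K := ℝ) (V := ℝ × Plane)).symm).1 hinj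
  obtain ⟨p, hp⟩ := hsurj ((innerₗ P.L2 m).comp P.affine)
  refine ⟨bub p, toL2_mem_H1 (hφ p), dof_test h.star (hφ p) (hts p), Pi1_eq hm ?_⟩
  rintro _ ⟨q, rfl⟩
  rw [inner_sub_left, ← hT, hp]
  exact sub_self _

/-- The gradients of the functions with vanishing degrees of freedom that are orthogonal to the
affine functions form a closed subspace. -/
lemma exists_closed_gradient (h : P.Regular ρ c) : ∃ K : Submodule ℝ P.L2v,
    IsClosed (K : Set P.L2v) ∧ ∀ G, G ∈ K ↔ ∃ φ ∈ P.H1, (∀ j, P.dof φ j = 0) ∧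
      (∀ q ∈ P.P1, inner ℝ φ q = 0) ∧ P.grad φ = G := by
  let N : Submodule ℝ P.H1Sub := (⨅ j, LinearMap.ker (dofL h.star j)) ⊓
    P.P1ᗮ.comap P.H1Sub.subtype
  have hN : ∀ φ : P.H1Sub, φ ∈ N ↔ (∀ j, P.dof φ j = 0) ∧ ∀ q ∈ P.P1, inner ℝ (φ : P.L2) q = 0 := by
    intro φ
    simp only [N, Submodule.mem_inf, Submodule.mem_iInf, LinearMap.mem_ker, Submodule.mem_comap,
      Submodule.mem_orthogonal', Submodule.subtype_apply]
    rfl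
  have hmem : ∀ G, G ∈ N.map P.gradL ↔ ∃ φ ∈ P.H1, (∀ j, P.dof φ j = 0) ∧
      (∀ q ∈ P.P1, inner ℝ φ q = 0) ∧ P.grad φ = G := by
    intro G
    constructor
    · rintro ⟨φ, hφ, rfl⟩
      exact ⟨φ, φ.2, ((hN φ).1 hφ).1, ((hN φ).1 hφ).2, rfl⟩
    · rintro ⟨φ, hφ, h1, h2, rfl⟩
      exact ⟨⟨φ, hφ⟩, (hN _).2 ⟨h1, h2⟩, rfl⟩
  refine ⟨N.map P.gradL, IsSeqClosed.isClosed fun G G' hG hlim => ?_, hmem⟩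
  choose φ hφ hdof horth hgrad using fun k => (hmem _).1 (hG k)
  -- Because the degrees of freedom vanish, Poincaré–Friedrichs upgrades convergence of the
  -- gradients to convergence of the functions.
  have hd : ∀ k l, dist (φ k) (φ l) ≤ constPF ρ * P.h * dist (G k) (G l) := fun k l => by
    rw [dist_eq_norm, dist_eq_norm, ← hgrad, ← hgrad, ← grad_sub (hφ k) (hφ l)]
    exact h.norm_le_of_dof_eq_zero (j := 0) (sub_mem_H1 (hφ k) (hφ l))
      (by rw [dof_sub h.star (hφ k) (hφ l), hdof, hdof, sub_zero])
  have hcau : CauchySeq φ := by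
    rw [cauchySeq_iff_tendsto_dist_atTop_0]
    have h1 := (cauchySeq_iff_tendsto_dist_atTop_0.1 hlim.cauchySeq).const_mul (constPF ρ * P.h)
    rw [mul_zero] at h1
    exact squeeze_zero (fun _ => dist_nonneg) (fun n => hd n.1 n.2) h1
  obtain ⟨φ', hφ'⟩ := cauchySeq_tendsto_of_complete hcau
  have hw : P.IsWeakGrad φ' G' := IsWeakGrad.of_tendsto
    (fun k => by rw [← hgrad k]; exact grad_spec (hφ k)) hφ' hlim
  refine (hmem _).2 ⟨φ', hw.mem, fun j => ?_, fun q hq => ?_, hw.grad_eq⟩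
  -- The degree of freedom of the limit equals that of `φ' - φ k`, which the trace inequality forces
  -- to zero.
  · have h1 : ∀ k, |P.det c j| * P.dof φ' j ^ 2 ≤
        2 * ‖φ' - φ k‖ ^ 2 + 2 * P.h * (‖φ' - φ k‖ * ‖G' - G k‖) := fun k => by
      have h2 := dof_sq_le h.star (sub_mem_H1 hw.mem (hφ k)) j
      rwa [dof_sub h.star hw.mem (hφ k), hdof, sub_zero, grad_sub hw.mem (hφ k), hgrad,
        hw.grad_eq] at h2
    have h3 : Tendsto (fun k => ‖φ' - φ k‖) atTop (𝓝 0) := by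
      simpa using ((tendsto_const_nhds (x := φ')).sub hφ').norm
    have h4 : Tendsto (fun k => ‖G' - G k‖) atTop (𝓝 0) := by
      simpa using ((tendsto_const_nhds (x := G')).sub hlim).norm
    have h5 := ((h3.pow 2).const_mul 2).add ((h3.mul h4).const_mul (2 * P.h))
    simp only [ne_eq, OfNat.ofNat_ne_zero, not_false_eq_true, zero_pow, mul_zero, add_zero] at h5
    have h6 := ge_of_tendsto' h5 h1
    have h7 := h.star.abs_det_pos j
    by_contra hne
    have : 0 < |P.det c j| * P.dof φ' j ^ 2 := by positivity
    linarith
  · have h1 : Tendsto (fun k => inner ℝ (φ k) q) atTop (𝓝 (inner ℝ φ' q)) :=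
      hφ'.inner tendsto_const_nhds
    simp only [horth _ q hq] at h1
    exact tendsto_nhds_unique h1 tendsto_const_nhds

/-- Functions with gradient orthogonal to the gradients of the functions with vanishing degrees of
freedom and affine moments have an affine Laplacian and edgewise constant normal derivatives. -/
lemma exists_isNormalDeriv (h : P.Regular ρ c) {w : P.L2}
    (hw : ∀ φ ∈ P.H1, (∀ j, P.dof φ j = 0) → (∀ q ∈ P.P1, inner ℝ φ q = 0) →
      inner ℝ (P.grad w) (P.grad φ) = 0) : ∃ q ∈ P.P1, ∃ g, P.IsNormalDeriv w q g := by
  let b := Module.finBasis ℝ P.P1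
  let L : Fin P.n ⊕ Fin (Module.finrank ℝ P.P1) → P.H1Sub →ₗ[ℝ] ℝ :=
    Sum.elim (dofL h.star) fun i => (innerₗ P.L2 (b i : P.L2)).comp P.H1Sub.subtype
  let K : P.H1Sub →ₗ[ℝ] ℝ := (innerₗ P.L2v (P.grad w)).comp P.gradL
  -- A functional that vanishes on the common kernel of finitely many others is a linear combination
  -- of them. The coefficients at the degrees of freedom, divided by the edge lengths, are the
  -- normal derivatives; those at the affine moments give minus the Laplacian.
  have hker : ⨅ i, LinearMap.ker (L i) ≤ LinearMap.ker K := by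
    intro φ hφ
    rw [Submodule.mem_iInf] at hφ
    refine hw φ φ.2 (fun j => hφ (Sum.inl j)) fun q hq => ?_
    have h1 : (∑ i, b.repr ⟨q, hq⟩ i • (b i : P.L2)) = q := by
      have h3 := congrArg P.P1.subtype (b.sum_repr ⟨q, hq⟩)
      rw [map_sum] at h3
      exact h3
    rw [← h1, inner_sum]
    refine Finset.sum_eq_zero fun i _ => ?_
    have h2 : inner ℝ (b i : P.L2) (φ : P.L2) = 0 := hφ (Sum.inr i)
    rw [real_inner_smul_right, real_inner_comm, h2, mul_zero]
  obtain ⟨a, ha⟩ := (Submodule.mem_span_range_iff_exists_fun ℝ).1 (mem_span_of_iInf_ker_le_ker hker)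
  refine ⟨-∑ i, a (Sum.inr i) • (b i : P.L2), P.P1.neg_mem (P.P1.sum_mem fun i _ =>
    P.P1.smul_mem _ (b i).2), fun j => a (Sum.inl j) * (P.edgeLength j)⁻¹, fun φ hφ => ?_⟩
  have h1 : K ⟨φ, hφ⟩ = _ := (congrArg (fun f => f ⟨φ, hφ⟩) ha).symm
  simp only [Fintype.sum_sum_type, LinearMap.add_apply, LinearMap.sum_apply,
    LinearMap.smul_apply, smul_eq_mul] at h1
  change inner ℝ (P.grad w) (P.grad φ) = ∑ j, a (Sum.inl j) * P.dof φ j +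
    ∑ i, a (Sum.inr i) * inner ℝ (b i : P.L2) φ at h1
  simp only [h1, inner_neg_left, sum_inner, real_inner_smul_left, add_neg_cancel_right,
    edgeIntegral_eq]
  refine Finset.sum_congr rfl fun j _ => ?_
  rw [mul_assoc, inv_mul_cancel_left₀ (edgeLength_pos j).ne']

/-- The virtual element space contains functions with arbitrary degrees of freedom. -/
lemma exists_mem_Vh (h : P.Regular ρ c) (d : Fin P.n → ℝ) :
    ∃ w ∈ P.Vh, ∀ j, P.dof w j = d j := by
  obtain ⟨u, hu, hud⟩ := exists_dof_eq h.star d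
  obtain ⟨p, hp⟩ := exists_isRitzProjection h.star hu
  -- The bubble `z` leaves the degrees of freedom alone and moves the `L²` projection of `u` to its
  -- Ritz projection.
  obtain ⟨z, hz, hzd, hzp⟩ := h.exists_Pi1_eq (P.P1.sub_mem hp.1 (Pi1_mem u))
  obtain ⟨K, hK, hmem⟩ := h.exists_closed_gradient
  have : CompleteSpace K := hK.completeSpace_coe
  have huz := add_mem_H1 hu hz
  -- Subtracting `k` minimizes the gradient norm without touching degrees of freedom or affine
  -- moments.
  obtain ⟨k, hk, hkd, hko, hkg⟩ := (hmem _).1 (K.starProjection_apply_mem (P.grad (u + z)))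
  have hw := sub_mem_H1 huz hk
  have hdof : ∀ j, P.dof (u + z - k) j = P.dof u j := fun j => by
    rw [dof_sub h.star huz hk, dof_add h.star hu hz, hzd, hkd, add_zero, sub_zero]
  have hPi : P.Pi1 (u + z - k) = p := by
    have h1 : P.Pi1 k = 0 := Pi1_eq P.P1.zero_mem fun q hq => by rw [sub_zero, hko q hq]
    have h2 : P.Pi1 (u + z - k) = P.Pi1 u + P.Pi1 z - P.Pi1 k := by
      simp only [Pi1, map_add, map_sub]
    rw [h2, h1, hzp, sub_zero, add_sub_cancel]
  refine ⟨u + z - k, (mem_Vh_iff h.star).2 ⟨hw, h.exists_isNormalDeriv fun φ hφ h1 h2 => ?_, ?_⟩,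
    fun j => (hdof j).trans (hud j)⟩
  · rw [grad_sub huz hk, hkg]
    exact K.starProjection_inner_eq_zero _ _ ((hmem _).2 ⟨φ, hφ, h1, h2, rfl⟩)
  · rw [hPi]
    exact hp.of_dof_eq h.star hu hw fun j => (hdof j).symm

end Regular

end Polygon

/-! ### The interpolation operator: stability and error estimates. -/

namespace Polygon

variable {P : Polygon} {c : Plane} {ρ : ℝ}

namespace Regular

lemma nodalBasis_spec (h : P.Regular ρ c) (j : Fin P.n) :
    P.nodalBasis j ∈ P.Vh ∧ ∀ k, P.dof (P.nodalBasis j) k = if k = j then 1 else 0 :=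
  Classical.epsilon_spec (p := fun ψ => ψ ∈ P.Vh ∧ ∀ k, P.dof ψ k = if k = j then 1 else 0)
    (h.exists_mem_Vh fun k => if k = j then 1 else 0)

lemma Ih_mem (h : P.Regular ρ c) (v : P.L2) : P.Ih v ∈ P.Vh :=
  (VhSub h.star).sum_mem fun j _ => (VhSub h.star).smul_mem _ (h.nodalBasis_spec j).1

lemma Ih_mem_H1 (h : P.Regular ρ c) (v : P.L2) : P.Ih v ∈ P.H1 :=
  ((mem_Vh_iff h.star).1 (h.Ih_mem v)).1

lemma dof_Ih (h : P.Regular ρ c) (v : P.L2) (j : Fin P.n) : P.dof (P.Ih v) j = P.dof v j :=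
  dof_sum_smul h.star (fun j => ((mem_Vh_iff h.star).1 (h.nodalBasis_spec j).1).1)
    (fun j => (h.nodalBasis_spec j).2) (P.dof v) j

lemma eq_Ih_iff (h : P.Regular ρ c) {v w : P.L2} :
    (w ∈ P.Vh ∧ ∀ j, P.dof w j = P.dof v j) ↔ w = P.Ih v := by
  refine ⟨fun ⟨hw, hd⟩ => h.eq_of_dof_eq hw (h.Ih_mem v) fun j => (hd j).trans (h.dof_Ih v j).symm,
    ?_⟩
  rintro rfl
  exact ⟨h.Ih_mem v, h.dof_Ih v⟩

/-- Affine functions belong to `V_h`, so unisolvence shows that the interpolation reproduces them.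
-/
lemma Ih_sub_affine (h : P.Regular ρ c) {v p : P.L2} (hv : v ∈ P.H1) (hp : p ∈ P.P1) :
    P.Ih (v - p) = P.Ih v - p := by
  refine (h.eq_Ih_iff.1 ⟨(VhSub h.star).sub_mem (h.Ih_mem v) (affine_mem_Vh h.star hp),
    fun j => ?_⟩).symm
  rw [dof_sub h.star (h.Ih_mem_H1 v) (P1_le_H1 hp), dof_sub h.star hv (P1_le_H1 hp), h.dof_Ih]

/-- The interpolant has the Ritz projection `Π₁ I_h v`, and `v` has the same degrees of freedom,
hence the same Ritz projection. -/
lemma isRitzProjection_Ih (h : P.Regular ρ c) {v : P.L2} (hv : v ∈ P.H1) :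
    P.IsRitzProjection v (P.Pi1 (P.Ih v)) :=
  ((mem_Vh_iff h.star).1 (h.Ih_mem v)).2.2.of_dof_eq h.star (h.Ih_mem_H1 v) hv (h.dof_Ih v)

lemma grad_sub_ritz {v p : P.L2} (hv : v ∈ P.H1) (hp : P.IsRitzProjection v p) :
    P.grad (v - p) = P.grad v - P.Pi0v (P.grad v) := by
  rw [grad_sub hv (P1_le_H1 hp.1), hp.grad_eq]

lemma norm_sub_ritz_le (h : P.Regular ρ c) {v p : P.L2} (hv : v ∈ P.H1)
    (hp : P.IsRitzProjection v p) :
    ‖v - p‖ ≤ constPF ρ * P.h * ‖P.grad v - P.Pi0v (P.grad v)‖ := by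
  rw [← grad_sub_ritz hv hp]
  refine h.norm_le_of_sum_edgeIntegral (sub_mem_H1 hv (P1_le_H1 hp.1)) Finset.univ_nonempty ?_
  simp only [edgeIntegral_sub h.star hv (P1_le_H1 hp.1), Finset.sum_sub_distrib, hp.2.2, sub_self]

/-- Stability of the interpolation. -/
lemma semi1_Ih_le (h : P.Regular ρ c) {C : ℝ} (hC : 0 < C) (hinv : ∀ w : P.L2, ∀ q ∈ P.P1,
    P.IsWeakLaplacian w q → P.h * ‖q‖ ≤ C * ‖P.grad w‖) {v : P.L2} (hv : v ∈ P.H1) :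
    P.semi1 (P.Ih v) ≤ (1 + C * constPF ρ) * P.semi1 v := by
  have hPF := constPF_pos h.pos
  obtain ⟨hw, ⟨q, hq, g, hg⟩, -⟩ := (mem_Vh_iff h.star).1 (h.Ih_mem v)
  have hp := h.isRitzProjection_Ih hv
  have h1 := norm_grad_sq_of_isNormalDeriv hw hg hv (h.dof_Ih v)
  -- The replacement is essential: a bound for `v - I_h v` itself would bring back `‖∇I_h v‖` with a
  -- factor that need not be small, whereas `v - Π₁ I_h v` is controlled by `∇v` alone.
  have h2 : inner ℝ q (v - P.Ih v) = inner ℝ q (v - P.Pi1 (P.Ih v)) := by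
    have h3 := inner_sub_Pi1 (P.Ih v) hq
    rw [real_inner_comm] at h3
    rw [← sub_eq_zero, ← inner_sub_right, sub_sub_sub_cancel_left, ← neg_sub, inner_neg_right, h3,
      neg_zero]
  have h3 := hinv _ q hq (hg.isWeakLaplacian h.star)
  have h4 := (h.norm_sub_ritz_le hv hp).trans
    (mul_le_mul_of_nonneg_left (norm_sub_Pi0v_le_norm (P.grad v))
      (mul_nonneg hPF.le (h_pos (P := P)).le))
  have h5 : inner ℝ q (v - P.Pi1 (P.Ih v)) ≤
      C * constPF ρ * ‖P.grad (P.Ih v)‖ * ‖P.grad v‖ := by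
    calc _ ≤ ‖q‖ * ‖v - P.Pi1 (P.Ih v)‖ := real_inner_le_norm _ _
      _ ≤ ‖q‖ * (constPF ρ * P.h * ‖P.grad v‖) := by gcongr
      _ = P.h * ‖q‖ * (constPF ρ * ‖P.grad v‖) := by ring
      _ ≤ C * ‖P.grad (P.Ih v)‖ * (constPF ρ * ‖P.grad v‖) := by gcongr
      _ = _ := by ring
  have h6 := real_inner_le_norm (P.grad (P.Ih v)) (P.grad v)
  unfold semi1
  -- Every term of the bound contains `‖∇I_h v‖`, which is divided out when positive.
  rcases (norm_nonneg (P.grad (P.Ih v))).eq_or_lt with h0 | h0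
  · rw [← h0]; positivity
  · refine le_of_mul_le_mul_left ?_ h0
    rw [h2] at h1
    linarith

/-- Subtracting the Ritz projection does not change the interpolation error, and its gradient is `Π₀
∇v`; the stability estimate is applied to the difference. -/
lemma semi1_sub_Ih_le (h : P.Regular ρ c) {C : ℝ}
    (hC : ∀ v ∈ P.H1, P.semi1 (P.Ih v) ≤ C * P.semi1 v) {v : P.L2} (hv : v ∈ P.H1) :
    P.semi1 (v - P.Ih v) ≤ (1 + C) * ‖P.grad v - P.Pi0v (P.grad v)‖ := by
  have hp := h.isRitzProjection_Ih hv
  have hvp := sub_mem_H1 hv (P1_le_H1 hp.1)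
  have e : v - P.Ih v = (v - P.Pi1 (P.Ih v)) - P.Ih (v - P.Pi1 (P.Ih v)) := by
    rw [h.Ih_sub_affine hv hp.1, sub_sub_sub_cancel_right]
  rw [e, semi1, grad_sub hvp (h.Ih_mem_H1 _), add_mul, one_mul, ← grad_sub_ritz hv hp]
  exact (norm_sub_le _ _).trans (add_le_add le_rfl (hC _ hvp))

/-- The error is that of the Ritz projection of `v`: its gradient is `(1 - Π₀)∇v`, and its boundary
integral vanishes. -/
lemma norm_add_semi1_sub_Pi1_Ih_le (h : P.Regular ρ c) {v : P.L2} (hv : v ∈ P.H1) :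
    P.h⁻¹ * ‖v - P.Pi1 (P.Ih v)‖ + P.semi1 (v - P.Pi1 (P.Ih v)) ≤
      (1 + constPF ρ) * ‖P.grad v - P.Pi0v (P.grad v)‖ := by
  have hp := h.isRitzProjection_Ih hv
  have hh := h_pos (P := P)
  have h1 := h.norm_sub_ritz_le hv hp
  rw [semi1, grad_sub_ritz hv hp, add_mul, one_mul, add_comm]
  refine add_le_add le_rfl ?_
  rw [inv_mul_le_iff₀ hh]
  linarith

/-- All edge means of `v - I_h v` vanish, so its `L²` norm is bounded through Poincaré–Friedrichs by
its gradient, to which (b) and the seminorm bound for `(1 - Π₀)∇v` apply. -/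
lemma norm_add_semi1_sub_Ih_le (h : P.Regular ρ c) {C : ℝ} (hC0 : 0 ≤ C)
    (hC : ∀ v ∈ P.H1, P.semi1 (P.Ih v) ≤ C * P.semi1 v) {σ : ℝ} (hσ0 : 0 ≤ σ) (hσ1 : σ ≤ 1)
    {v : P.L2} (hv : v ∈ P.HOneAdd σ) :
    ‖v - P.Ih v‖ + P.h * P.semi1 (v - P.Ih v) ≤ constApx ρ * (1 + C) * (1 + constPF ρ) *
      P.h ^ (1 + σ) * (P.sobolevSeminorm σ v).toReal := by
  have hPF := constPF_pos h.pos
  have hh := h_pos (P := P)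
  have hvw := sub_mem_H1 hv.1 (h.Ih_mem_H1 v)
  have h1 := h.norm_le_of_dof_eq_zero (j := 0) hvw
    (by rw [dof_sub h.star hv.1 (h.Ih_mem_H1 v), h.dof_Ih, sub_self])
  have h2 := h.semi1_sub_Ih_le hC hv.1
  have h3 := h.norm_sub_Pi0v_le_seminorm hσ0 hσ1 hv
  have h4 := constGrad_le_constApx h.pos
  have hhσ : 0 < P.h ^ σ := Real.rpow_pos_of_pos hh σ
  rw [Real.rpow_add hh, Real.rpow_one]
  calc ‖v - P.Ih v‖ + P.h * P.semi1 (v - P.Ih v)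
      ≤ constPF ρ * P.h * P.semi1 (v - P.Ih v) + P.h * P.semi1 (v - P.Ih v) := by
        gcongr; exact h1
    _ = (1 + constPF ρ) * P.h * P.semi1 (v - P.Ih v) := by ring
    _ ≤ (1 + constPF ρ) * P.h * ((1 + C) * (constApx ρ * P.h ^ σ *
          (P.sobolevSeminorm σ v).toReal)) := by
        gcongr
        refine h2.trans ?_
        gcongr
        refine h3.trans ?_
        gcongr
    _ = _ := by ring

end Regular

end Polygon

end VEM

end

theorem mainTheorem8 (ρ : ℝ) (hρ : 0 < ρ) :
    ∃ C_PF C_apx C_Itn : ℝ, 0 < C_PF ∧ 0 < C_apx ∧ 0 < C_Itn ∧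
      -- `C_PF` is a Poincaré–Friedrichs constant
      (∀ P : VEM.Polygon, P.MeshRegular ρ → ∀ f ∈ P.H1, ∀ J : Finset (Fin P.n), J.Nonempty →
        ∑ j ∈ J, P.edgeIntegral f j = 0 → ‖f‖ ≤ C_PF * P.h * P.semi1 f) ∧
      -- `C_apx` is a constant for the approximation by affine functions
      (∀ P : VEM.Polygon, P.MeshRegular ρ → ∀ s : ℝ, 0 ≤ s → s ≤ 1 → ∀ f ∈ P.HOneAdd s,
        ‖f - P.Pi1 f‖ + P.h * P.semi1 (f - P.Pi1 f)
          ≤ C_apx * P.h ^ (1 + s) * (P.sobolevSeminorm s f).toReal) ∧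
      ∀ P : VEM.Polygon, P.MeshRegular ρ →
        (∀ v ∈ P.H1,
          -- `I_h v` is the unique element of `V_h(P)` with the degrees of freedom of `v`
          (∀ w : P.L2, (w ∈ P.Vh ∧ ∀ j, P.dof w j = P.dof v j) ↔ w = P.Ih v) ∧
          -- (a)
          P.semi1 (P.Ih v) ≤ C_Itn * P.semi1 v ∧
          -- (b)
          P.semi1 (v - P.Ih v) ≤ (1 + C_Itn) * ‖P.grad v - P.Pi0v (P.grad v)‖ ∧
          P.h⁻¹ * ‖v - P.Pi1 (P.Ih v)‖ + P.semi1 (v - P.Pi1 (P.Ih v))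
            ≤ (1 + C_PF) * ‖P.grad v - P.Pi0v (P.grad v)‖) ∧
        -- (c)
        ∀ σ : ℝ, 0 < σ → σ ≤ 1 → ∀ v ∈ P.HOneAdd σ,
          ‖v - P.Ih v‖ + P.h * P.semi1 (v - P.Ih v)
            ≤ C_apx * (1 + C_Itn) * (1 + C_PF) * P.h ^ (1 + σ) *
              (P.sobolevSeminorm σ v).toReal := by
  obtain ⟨C, hC, hinv⟩ := VEM.Polygon.exists_norm_laplacian_le hρ
  have hPF := VEM.Polygon.constPF_pos hρ
  have hstab : ∀ (P : VEM.Polygon) (c : VEM.Plane), P.Regular ρ c → ∀ v ∈ P.H1,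
      P.semi1 (P.Ih v) ≤ (1 + C * VEM.Polygon.constPF ρ) * P.semi1 v := fun P c h v hv =>
    h.semi1_Ih_le hC (hinv P c h) hv
  refine ⟨VEM.Polygon.constPF ρ, VEM.Polygon.constApx ρ, 1 + C * VEM.Polygon.constPF ρ, hPF,
    VEM.Polygon.constApx_pos hρ, by positivity, fun P hP f hf J hJ h0 => ?_,
    fun P hP s hs0 hs1 f hf => ?_, fun P hP => ?_⟩
  all_goals obtain ⟨c, h⟩ := hP.exists_regular hρ
  · exact h.norm_le_of_sum_edgeIntegral hf hJ h0
  · exact h.approx hs0 hs1 hf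
  · exact ⟨fun v hv => ⟨fun w => h.eq_Ih_iff, hstab P c h v hv,
      h.semi1_sub_Ih_le (hstab P c h) hv, h.norm_add_semi1_sub_Pi1_Ih_le hv⟩,
      fun σ hσ0 hσ1 v hv => h.norm_add_semi1_sub_Ih_le (by positivity) (hstab P c h) hσ0.le hσ1 hv⟩
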